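/- Let $\Sigma$ be a compact oriented smooth surface (without boundary) with a Riemannian metric $\mathbf g$, volume measure $\mu_{\mathbf g}$ and Hodge star $\star$ (so $\star dx=dy$, $\star dy=-dx$ in positively oriented Euclidean coordinates), and let $M=\Sigma\times S^1$ with the product orientation. Let $\partial/\partial t$ be the vector field on $S^1\subset\mathbb C$ induced by $s\mapsto e^{2\pi i s}$, and let $dt$ be the dual 1-form (so $\int_{S^1}dt=1$). Let $\mathfrak g$ be a real Lie subalgebra of $u(N)$ (for example the Lie algebra of a Lie subgroup $G\subset U(N)$), let $\mathrm{Tr}=c\cdot\mathrm{Tr}_{\mathrm{Mat}(N,\mathbb C)}$ with a constant $c>0$, let $(X,Y)_{\mathfrak g}=-\mathrm{Tr}(XY)$ on $\mathfrak g$, and let $k\in\mathbb Z$. For a smooth $\mathfrak g$-valued 1-form $A$ on $M$ put $$S_{CS}(A)=\frac{k}{4\pi}\int_M \mathrm{Tr}\bigl(A\wedge dA+\tfrac23 A\wedge A\wedge A\bigr).$$ Let $\mathcal H_\Sigma$ be the Hilbert space of $L^2$-sections of $\mathrm{Hom}(T\Sigma,\mathfrak g)$ with scalar product $\ll\alpha,\beta\gg_{\mathcal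 H_\Sigma}=\int_\Sigma(\alpha,\beta)_{\mathbf g,\mathfrak g}\,d\mu_{\mathbf g}$, where $(\cdot,\cdot)_{\mathbf g,\mathfrak g}$ is the fibre metric induced by $\mathbf g$ and $(\cdot,\cdot)_{\mathfrak g}$, and let $\mathcal H^\perp=L^2(S^1,\mathcal H_\Sigma)$ with scalar product $\ll a,b\gg_{\mathcal H^\perp}=\int_{S^1}\ll a(t),b(t)\gg_{\mathcal H_\Sigma}dt$. Let $A^\perp$ be a smooth $\mathfrak g$-valued 1-form on $M$ with $A^\perp(\partial/\partial t)=0$, identified with the family $t\mapsto A^\perp(t)$ of smooth $\mathfrak g$-valued 1-forms on $\Sigma$, and let $B\in C^\infty(\Sigma,\mathfrak g)$. Let $\star$, $\partial/\partial t$ and $\mathrm{ad}(B)=[B,\cdot\,]$ act on such families pointwise in the obvious way, and regard $\star dB$ as a family that is constant in $t$. Then $A^\perp$, $\star(\tfrac{\partial}{\partial t}+\mathrm{ad}(B))A^\perp$ and $\star dB$ are elements of $\mathcal H^\perp$, and $$S_{CS}(A^\perp+B\,dt)=-\frac{k}{4\pi}\Bigl[\ll A^\perp,\star\bigl(\tfrac{\partial}{\partial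 t}+\mathrm{ad}(B)\bigr)A^\perp\gg_{\mathcal H^\perp}-2\ll A^\perp,\star dB\gg_{\mathcal H^\perp}\Bigr].$$ -/

import Mathlib

open scoped Manifold ContDiff Bundle Topology Matrix
open Set MeasureTheory Module

/-! ### Matrices -/

/-- `N × N` complex matrices. The type carries its standard topology through the row-sum operator
norm; all norms on this finite-dimensional space are equivalent, so the choice is immaterial. -/
def Mat (N : ℕ) : Type := Matrix (Fin N) (Fin N) ℂ

namespace Mat

noncomputable instance (N : ℕ) : NormedRing (Mat N) :=
  Matrix.linftyOpNormedRing (n := Fin N) (α := ℂ)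

noncomputable instance (N : ℕ) : NormedAlgebra ℝ (Mat N) :=
  Matrix.linftyOpNormedAlgebra (n := Fin N) (R := ℝ) (α := ℂ)

instance (N : ℕ) : FiniteDimensional ℝ (Mat N) :=
  inferInstanceAs (FiniteDimensional ℝ (Matrix (Fin N) (Fin N) ℂ))

/-- The commutator bracket `[X, Y] = XY - YX`. -/
noncomputable instance (N : ℕ) : LieRing (Mat N) := LieRing.ofAssociativeRing

/-- The usual trace of a matrix. -/
def tr {N : ℕ} : Mat N →ₗ[ℝ] ℂ where
  toFun X := Matrix.trace (X : Matrix (Fin N) (Fin N) ℂ)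
  map_add' X Y := Matrix.trace_add (n := Fin N) (R := ℂ) X Y
  map_smul' r X := Matrix.trace_smul (n := Fin N) (R := ℂ) r X

/-- The conjugate transpose. -/
def ct {N : ℕ} (X : Mat N) : Mat N := Matrix.conjTranspose (X : Matrix (Fin N) (Fin N) ℂ)

end Mat

/-- The Lie algebra `u(N)` of skew-Hermitian matrices. -/
def uLie (N : ℕ) : LieSubalgebra ℝ (Mat N) where
  carrier := {X | X.ct = -X}
  add_mem' {X Y} hX hY := by
    have h : (X + Y).ct = X.ct + Y.ct :=
      Matrix.conjTranspose_add (m := Fin N) (n := Fin N) (α := ℂ) X Y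
    simp only [mem_ofPred_eq] at hX hY ⊢
    rw [h, hX, hY, neg_add]
  zero_mem' := by
    have h : (0 : Mat N).ct = 0 := Matrix.conjTranspose_zero (m := Fin N) (n := Fin N) (α := ℂ)
    simp [h]
  smul_mem' r X hX := by
    have h : (r • X).ct = r • X.ct :=
      Matrix.conjTranspose_smul (m := Fin N) (n := Fin N) (α := ℂ) (R := ℝ) r X
    simp only [mem_ofPred_eq] at hX ⊢
    rw [h, hX, smul_neg]
  lie_mem' {X Y} hX hY := by
    have h : ∀ X Y : Mat N, (X * Y).ct = Y.ct * X.ct :=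
      Matrix.conjTranspose_mul (m := Fin N) (n := Fin N) (l := Fin N) (α := ℂ)
    have h' : ∀ X Y : Mat N, (X - Y).ct = X.ct - Y.ct :=
      Matrix.conjTranspose_sub (m := Fin N) (n := Fin N) (α := ℂ)
    have e : ∀ X Y : Mat N, ⁅X, Y⁆ = X * Y - Y * X := fun _ _ => rfl
    change X.ct = -X at hX
    change Y.ct = -Y at hY
    change (⁅X, Y⁆).ct = -⁅X, Y⁆
    rw [e, h', h, h, hX, hY]
    noncomm_ring

/-! ### One-forms, exterior derivative, wedge product -/

section Forms

variable {E : Type*} [NormedAddCommGroup E] [NormedSpace ℝ E]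
  {H : Type*} [TopologicalSpace H] (I : ModelWithCorners ℝ E H)
  {M : Type*} [TopologicalSpace M] [ChartedSpace H M]
  {V : Type*} [NormedAddCommGroup V] [NormedSpace ℝ V]

/-- A (not necessarily smooth) `V`-valued one-form on the manifold `M`. -/
abbrev OneForm (M : Type*) [TopologicalSpace M] [ChartedSpace H M]
    (V : Type*) [NormedAddCommGroup V] [NormedSpace ℝ V] : Type _ :=
  (x : M) → TangentSpace I x →L[ℝ] V

/-- The one-form `A` is a `C^∞` section of the bundle `Hom(TM, V)`. -/
def IsSmoothOneForm [IsManifold I ∞ M] (A : OneForm I M V) : Prop :=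
  ContMDiff I (I.prod 𝓘(ℝ, E →L[ℝ] V)) ∞
    (fun x : M => Bundle.TotalSpace.mk' (E →L[ℝ] V)
      (E := fun x : M => TangentSpace I x →L[ℝ] Bundle.Trivial M V x) x (A x))

/-- The differential at `y` of the inverse of the chart around `x₀`; it sends a basis of the model
vector space to the corresponding coordinate frame. -/
noncomputable def chartFrame (x₀ : M) (y : E) :
    E →L[ℝ] TangentSpace I ((extChartAt I x₀).symm y) :=
  mfderiv 𝓘(ℝ, E) I (extChartAt I x₀).symm y

/-- The one-form `A` in the coordinates given by the chart around `x₀`. -/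
noncomputable def OneForm.inChart (A : OneForm I M V) (x₀ : M) (y : E) : E →L[ℝ] V :=
  (A ((extChartAt I x₀).symm y)).comp (chartFrame I x₀ y)

/-- The exterior derivative of a one-form, computed at `x` in the chart around `x`. -/
noncomputable def OneForm.d (A : OneForm I M V) (x : M) : TangentSpace I x [⋀^Fin 2]→ₗ[ℝ] V :=
  ((extDeriv (fun y => ContinuousAlternatingMap.ofSubsingleton ℝ E V (0 : Fin 1)
      (OneForm.inChart I A x y)) (extChartAt I x x)).compContinuousLinearMap
    (mfderiv I 𝓘(ℝ, E) (extChartAt I x) x)).toAlternatingMap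

end Forms

section Wedge

variable {W : Type*} [AddCommGroup W] [Module ℝ W] {R : Type*} [Ring R] [Algebra ℝ R]

/-- The wedge product of an algebra-valued one-form and an algebra-valued `n`-form:
`(α ∧ η)(v₀, …, vₙ) = ∑ i, (-1)^i α(vᵢ) η(v₀, …, v̂ᵢ, …, vₙ)`. -/
def wedgeOne {n : ℕ} (α : W →ₗ[ℝ] R) (η : W [⋀^Fin n]→ₗ[ℝ] R) : W [⋀^Fin (n + 1)]→ₗ[ℝ] R :=
  AlternatingMap.alternatizeUncurryFin
    { toFun := fun v => (LinearMap.mulLeft ℝ (α v)).compAlternatingMap η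
      map_add' := fun v w => by ext; simp [add_mul]
      map_smul' := fun r v => by ext; simp }

/-- A linear map regarded as an alternating map in one variable. -/
def asOneForm (α : W →ₗ[ℝ] R) : W [⋀^Fin 1]→ₗ[ℝ] R :=
  AlternatingMap.ofSubsingleton ℝ W R (0 : Fin 1) α

end Wedge

/-! ### Orientations and integration -/

/-- The sign (`1`, `-1`, or `0` if linearly dependent) of the tuple `v` for the orientation `o`. -/
noncomputable def orientSign {W : Type*} [AddCommGroup W] [Module ℝ W] {n : ℕ}
    (o : Orientation ℝ W (Fin n)) (v : Fin n → W) : ℝ :=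
  Real.sign (Module.Ray.someVector o v)

section Integration

variable {E : Type*} [NormedAddCommGroup E] [NormedSpace ℝ E] [FiniteDimensional ℝ E]
  [MeasurableSpace E] [BorelSpace E]
  {H : Type*} [TopologicalSpace H] (I : ModelWithCorners ℝ E H)
  (M : Type*) [TopologicalSpace M] [ChartedSpace H M]
  {n : ℕ} (b : Basis (Fin n) ℝ E)

variable {M} in
/-- A pointwise orientation of the tangent spaces is continuous, i.e. an orientation of the
manifold, if the sign of every coordinate frame is a continuous (so locally constant) function. -/
def IsOrientation (o : (x : M) → Orientation ℝ (TangentSpace I x) (Fin n)) : Prop :=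
  ∀ x₀ : M, ContinuousOn
    (fun y : E => orientSign (o ((extChartAt I x₀).symm y)) (fun j => chartFrame I x₀ y (b j)))
    (extChartAt I x₀).target

variable [T2Space M] [SigmaCompactSpace M] [IsManifold I ∞ M]

/-- A smooth partition of unity on `M` subordinate to the cover by the domains of the charts. -/
noncomputable def chartPartition : SmoothPartitionOfUnity M I M univ :=
  (SmoothPartitionOfUnity.exists_isSubordinate_chartAt_source I M).choose

variable {M}

/-- The integral of an `n`-form over a compact oriented `n`-manifold: by a partition of unity the
form is cut into pieces supported in charts, and every piece is integrated in its chart with respect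
to Lebesgue measure, with the sign `±1` that tells if the chart preserves orientations. (The
Lebesgue measure `b.addHaar` gives volume `1` to the parallelepiped spanned by `b`.) -/
noncomputable def formIntegral (o : (x : M) → Orientation ℝ (TangentSpace I x) (Fin n))
    (η : (x : M) → TangentSpace I x [⋀^Fin n]→ₗ[ℝ] ℂ) : ℂ :=
  ∑ᶠ x₀ : M, ∫ y in (extChartAt I x₀).target,
    ((chartPartition I M x₀ ((extChartAt I x₀).symm y) *
      orientSign (o ((extChartAt I x₀).symm y)) (fun j => chartFrame I x₀ y (b j)) : ℝ) : ℂ) *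
    η ((extChartAt I x₀).symm y) (fun j => chartFrame I x₀ y (b j)) ∂b.addHaar

variable (M) in
/-- The Riemannian volume measure: in a chart it has the density `√det(g(∂ᵢ, ∂ⱼ))` with respect to
Lebesgue measure; the charts are patched by the partition of unity. -/
noncomputable def riemannianVolume [MeasurableSpace M]
    [Bundle.RiemannianBundle (fun x : M => TangentSpace I x)] : Measure M :=
  Measure.sum fun x₀ : M =>
    ((b.addHaar.restrict (extChartAt I x₀).target).withDensity fun y =>
      ENNReal.ofReal (chartPartition I M x₀ ((extChartAt I x₀).symm y) *
        √(Matrix.det (Matrix.of fun i j =>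
          inner ℝ (chartFrame I x₀ y (b i)) (chartFrame I x₀ y (b j)))))).map
      (extChartAt I x₀).symm

end Integration

/-! ### The circle -/

noncomputable instance : MeasurableSpace Circle := borel Circle

instance : BorelSpace Circle := ⟨rfl⟩

/-- The curve `s ↦ exp(2πis)` in the unit circle. -/
noncomputable def iS1 (s : ℝ) : Circle := Circle.exp (2 * Real.pi * s)

/-- The vector field `∂/∂t` on the circle: the velocity of `s ↦ exp(2πis)·t` at `s = 0`. -/
noncomputable def circleVec (t : Circle) : TangentSpace (𝓡 1) t :=
  (mfderiv 𝓘(ℝ, ℝ) (𝓡 1) (fun s : ℝ => iS1 s * t) 0 (1 : ℝ) : EuclideanSpace ℝ (Fin 1))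

theorem circleVec_ne_zero (t : Circle) : circleVec t ≠ 0 := by
  intro h
  have h1 : MDifferentiable 𝓘(ℝ, ℝ) (𝓡 1) (fun s : ℝ => iS1 s * t) := by
    have : ContMDiff 𝓘(ℝ, ℝ) (𝓡 1) 1 (fun s : ℝ => Circle.exp (2 * Real.pi * s) * t) := by
      have e : ContMDiff 𝓘(ℝ, ℝ) (𝓡 1) 1 (fun s : ℝ => Circle.exp (2 * Real.pi * s)) :=
        contMDiff_circleExp.comp (ContDiff.contMDiff (by fun_prop))
      exact e.mul contMDiff_const
    exact this.mdifferentiable (by simp)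
  have h2 : MDifferentiable (𝓡 1) 𝓘(ℝ, ℂ) (fun z : Circle => (z : ℂ)) := by
    have : Fact (finrank ℝ ℂ = 1 + 1) := finrank_real_complex_fact'
    exact (contMDiff_coe_sphere (E := ℂ) (n := 1) (m := 1)).mdifferentiable (by simp)
  have h3 := mfderiv_comp (0 : ℝ) (h2 _) (h1 0)
  have h4 : HasDerivAt (fun s : ℝ => ((iS1 s * t : Circle) : ℂ))
      (2 * Real.pi * Complex.I * t) 0 := by
    have e : (fun s : ℝ => ((iS1 s * t : Circle) : ℂ)) =
        fun s : ℝ => Complex.exp ((s : ℂ) * (2 * Real.pi * Complex.I)) * t := by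
      funext s
      simp only [iS1, Circle.coe_mul, Circle.coe_exp]
      congr 2
      push_cast
      ring
    rw [e]
    have d0 : HasDerivAt (fun s : ℝ => (s : ℂ)) 1 0 := Complex.ofRealCLM.hasDerivAt
    simpa using ((d0.mul_const (2 * Real.pi * Complex.I)).cexp).mul_const (t : ℂ)
  have h5 : mfderiv 𝓘(ℝ, ℝ) 𝓘(ℝ, ℂ) ((fun z : Circle => (z : ℂ)) ∘ fun s : ℝ => iS1 s * t) 0
      (1 : ℝ) = (0 : ℂ) := by
    rw [h3]
    have h6 : mfderiv 𝓘(ℝ, ℝ) (𝓡 1) (fun s : ℝ => iS1 s * t) 0 (1 : ℝ) = 0 := h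
    erw [ContinuousLinearMap.comp_apply, h6]
    exact ContinuousLinearMap.map_zero _
  rw [mfderiv_eq_fderiv] at h5
  have h7 : fderiv ℝ (fun s : ℝ => ((iS1 s * t : Circle) : ℂ)) 0 1 = 0 := h5
  rw [fderiv_apply_one_eq_deriv, h4.deriv] at h7
  simp [Real.pi_ne_zero] at h7

theorem finrank_tangentSpace_euclidean {n : ℕ} {M : Type*} [TopologicalSpace M]
    [ChartedSpace (EuclideanSpace ℝ (Fin n)) M] (x : M) :
    finrank ℝ (TangentSpace (𝓡 n) x) = n :=
  finrank_euclideanSpace_fin (𝕜 := ℝ) (n := n)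

instance {n : ℕ} {M : Type*} [TopologicalSpace M]
    [ChartedSpace (EuclideanSpace ℝ (Fin n)) M] (x : M) :
    FiniteDimensional ℝ (TangentSpace (𝓡 n) x) :=
  inferInstanceAs (FiniteDimensional ℝ (EuclideanSpace ℝ (Fin n)))

instance {n : ℕ} {M : Type*} [TopologicalSpace M]
    [ChartedSpace (EuclideanSpace ℝ (Fin n)) M] (x : M) : T2Space (TangentSpace (𝓡 n) x) :=
  inferInstanceAs (T2Space (EuclideanSpace ℝ (Fin n)))

/-- `∂/∂t` as a basis of the tangent line. -/
noncomputable def circleBasis (t : Circle) : Basis (Fin 1) ℝ (TangentSpace (𝓡 1) t) :=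
  FiniteDimensional.basisSingleton (Fin 1) (finrank_tangentSpace_euclidean t) (circleVec t)
    (circleVec_ne_zero t)

/-- The one-form `dt` on the circle, dual to `∂/∂t`. -/
noncomputable def circleDt : OneForm (𝓡 1) Circle ℝ := fun t =>
  LinearMap.toContinuousLinearMap ((circleBasis t).coord 0)

/-- The measure `dt` on the circle (of total mass one). -/
noncomputable def circleMeasure : Measure Circle :=
  (volume.restrict (Ioc (0 : ℝ) 1)).map iS1

/-! ### The three-manifold `M = Σ × S¹` and the Chern–Simons action -/

section ChernSimons

variable {S : Type*} [TopologicalSpace S] [ChartedSpace (EuclideanSpace ℝ (Fin 2)) S] {N : ℕ}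

/-- The product orientation of `Σ × S¹`: `(u₁, u₂, ∂/∂t)` is positive if `(u₁, u₂)` is positive. -/
noncomputable def prodOrientation (o : (x : S) → Orientation ℝ (TangentSpace (𝓡 2) x) (Fin 2))
    (p : S × Circle) : Orientation ℝ (TangentSpace ((𝓡 2).prod (𝓡 1)) p) (Fin 3) :=
  ((((o p.1).someBasis (finrank_tangentSpace_euclidean (n := 2) p.1).symm).prod
    (circleBasis p.2)).reindex finSumFinEquiv).orientation

/-- The standard basis of the model vector space `ℝ² × ℝ¹` of `Σ × S¹`. -/
noncomputable def stdBasis3 :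
    Basis (Fin 3) ℝ (EuclideanSpace ℝ (Fin 2) × EuclideanSpace ℝ (Fin 1)) :=
  ((EuclideanSpace.basisFun (Fin 2) ℝ).toBasis.prod
    (EuclideanSpace.basisFun (Fin 1) ℝ).toBasis).reindex finSumFinEquiv

/-- The vector field `∂/∂t` on `Σ × S¹`. -/
noncomputable def prodVec (p : S × Circle) : TangentSpace ((𝓡 2).prod (𝓡 1)) p :=
  ((0 : TangentSpace (𝓡 2) p.1), circleVec p.2)

/-- The one-form `f dt` on `Σ × S¹`, for a function `f` on `Σ × S¹`. -/
noncomputable def mulDt (f : S × Circle → Mat N) : OneForm ((𝓡 2).prod (𝓡 1)) (S × Circle) (Mat N) :=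
  fun p => ((circleDt p.2).comp (ContinuousLinearMap.snd ℝ (EuclideanSpace ℝ (Fin 2))
    (EuclideanSpace ℝ (Fin 1)))).smulRight (f p)

/-- The trace `Tr = c · Tr_{Mat(N, ℂ)}`. -/
noncomputable def traceC (c : ℝ) : Mat N →ₗ[ℝ] ℂ :=
  c • Mat.tr

/-- The three-form `Tr(A ∧ dA + (2/3) A ∧ A ∧ A)`. -/
noncomputable def chernSimonsForm (c : ℝ) (A : OneForm ((𝓡 2).prod (𝓡 1)) (S × Circle) (Mat N))
    (p : S × Circle) : TangentSpace ((𝓡 2).prod (𝓡 1)) p [⋀^Fin 3]→ₗ[ℝ] ℂ :=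
  (traceC c).compAlternatingMap
    (wedgeOne (A p).toLinearMap (OneForm.d _ A p) +
      (2 / 3 : ℝ) • wedgeOne (A p).toLinearMap
        (wedgeOne (A p).toLinearMap (asOneForm (A p).toLinearMap)))

variable [T2Space S] [CompactSpace S] [IsManifold (𝓡 2) ∞ S]

/-- The Chern–Simons action `S_CS(A) = (k/4π) ∫_M Tr(A ∧ dA + (2/3) A ∧ A ∧ A)`. -/
noncomputable def chernSimons (k : ℤ) (c : ℝ)
    (o : (x : S) → Orientation ℝ (TangentSpace (𝓡 2) x) (Fin 2))
    (A : OneForm ((𝓡 2).prod (𝓡 1)) (S × Circle) (Mat N)) : ℂ :=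
  (k / (4 * Real.pi) : ℂ) *
    formIntegral ((𝓡 2).prod (𝓡 1)) stdBasis3 (prodOrientation o) (chernSimonsForm c A)

end ChernSimons

/-! ### The Hilbert spaces `ℋ_Σ` and `ℋ^⊥`, the Hodge star, `∂/∂t` and `ad(B)` -/

section Hilbert

open scoped Bundle

variable {S : Type*} [TopologicalSpace S] [ChartedSpace (EuclideanSpace ℝ (Fin 2)) S] {N : ℕ}

/-- The scalar product `(X, Y)_𝔤 = -Tr(XY)`, which is real for skew-Hermitian `X`, `Y`. -/
noncomputable def gInner (c : ℝ) (X Y : Mat N) : ℝ := -(traceC c (X * Y)).re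

/-- The identification of `𝒜^⊥` with families of one-forms on `Σ` parametrised by the circle:
`A(t)_σ(v) = A_{(σ,t)}(v, 0)`. -/
noncomputable def OneForm.slice (A : OneForm ((𝓡 2).prod (𝓡 1)) (S × Circle) (Mat N)) (t : Circle) :
    OneForm (𝓡 2) S (Mat N) :=
  fun x => (A (x, t)).comp (ContinuousLinearMap.inl ℝ (EuclideanSpace ℝ (Fin 2))
    (EuclideanSpace ℝ (Fin 1)))

/-- `∂/∂t` on families of one-forms on `Σ` parametrised by the circle. -/
noncomputable def ddt (a : Circle → OneForm (𝓡 2) S (Mat N)) : Circle → OneForm (𝓡 2) S (Mat N) :=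
  fun t x =>
    let f : ℝ → (EuclideanSpace ℝ (Fin 2) →L[ℝ] Mat N) := fun s => a (iS1 s * t) x
    deriv f 0

/-- `ad(B)` on families of one-forms on `Σ`: `(ad(B) a)(t)_σ(v) = [B(σ), a(t)_σ(v)]`. -/
noncomputable def adB (B : S → Mat N) (a : Circle → OneForm (𝓡 2) S (Mat N)) :
    Circle → OneForm (𝓡 2) S (Mat N) :=
  fun t x => (LinearMap.toContinuousLinearMap (LieAlgebra.ad ℝ (Mat N) (B x))).comp (a t x)

/-- The differential `dB` of a function on `Σ`. -/
noncomputable def dFun (B : S → Mat N) : OneForm (𝓡 2) S (Mat N) :=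
  fun x => mfderiv (𝓡 2) 𝓘(ℝ, Mat N) B x

variable [Bundle.RiemannianBundle (fun x : S => TangentSpace (𝓡 2) x)]

instance (x : S) : Fact (finrank ℝ (TangentSpace (𝓡 2) x) = 2) :=
  ⟨finrank_tangentSpace_euclidean x⟩

/-- The Hodge star on one-forms on the oriented Riemannian surface `Σ`: `(⋆α)(v) = -α(Jv)`, with `J`
the rotation by a positive right angle; so `α ∧ ⋆β = (α, β) vol`, `⋆dx = dy`, `⋆dy = -dx`. -/
noncomputable def hodgeStar (o : (x : S) → Orientation ℝ (TangentSpace (𝓡 2) x) (Fin 2))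
    (α : OneForm (𝓡 2) S (Mat N)) : OneForm (𝓡 2) S (Mat N) :=
  fun x =>
    -(α x).comp ((o x).rightAngleRotation.toContinuousLinearEquiv :
      TangentSpace (𝓡 2) x →L[ℝ] TangentSpace (𝓡 2) x)

/-- The fibre metric `(·,·)_{g,𝔤}` on `Hom(TΣ, 𝔤)`: `∑ᵢ (α(eᵢ), β(eᵢ))_𝔤` for an orthonormal basis
`eᵢ` of the tangent space (the sum does not depend on the basis). -/
noncomputable def fiberInner (c : ℝ) (α β : OneForm (𝓡 2) S (Mat N)) (x : S) : ℝ :=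
  ∑ i, gInner c (α x (stdOrthonormalBasis ℝ (TangentSpace (𝓡 2) x) i))
    (β x (stdOrthonormalBasis ℝ (TangentSpace (𝓡 2) x) i))

variable [T2Space S] [CompactSpace S] [IsManifold (𝓡 2) ∞ S] [MeasurableSpace S]

variable (S) in
/-- The Riemannian volume measure `μ_g` on the surface `Σ`. -/
noncomputable def surfaceMeasure : Measure S :=
  riemannianVolume (𝓡 2) S (EuclideanSpace.basisFun (Fin 2) ℝ).toBasis

/-- The scalar product of `ℋ_Σ = L²-Γ(Hom(TΣ, 𝔤), μ_g)`. -/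
noncomputable def hSigmaInner (c : ℝ) (α β : OneForm (𝓡 2) S (Mat N)) : ℝ :=
  ∫ x, fiberInner c α β x ∂(surfaceMeasure S)

/-- Elements (representatives) of `ℋ_Σ`: the `𝔤`-valued one-forms on `Σ` that are almost everywhere
measurable (tested on smooth vector fields) and square-integrable. -/
structure MemHSigma (𝔤 : LieSubalgebra ℝ (Mat N)) (c : ℝ) (α : OneForm (𝓡 2) S (Mat N)) :
    Prop where
  mem : ∀ x v, α x v ∈ 𝔤
  aestronglyMeasurable : ∀ X : (x : S) → TangentSpace (𝓡 2) x,
    ContMDiff (𝓡 2) (𝓡 2).tangent ∞ (fun x => (⟨x, X x⟩ : TangentBundle (𝓡 2) S)) →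
      AEStronglyMeasurable (fun x => α x (X x)) (surfaceMeasure S)
  integrable : Integrable (fun x => fiberInner c α α x) (surfaceMeasure S)

/-- The scalar product of `ℋ^⊥ = L²(S¹, ℋ_Σ)`. -/
noncomputable def hPerpInner (c : ℝ) (a b : Circle → OneForm (𝓡 2) S (Mat N)) : ℝ :=
  ∫ t, hSigmaInner c (a t) (b t) ∂circleMeasure

/-- Elements (representatives) of `ℋ^⊥ = L²(S¹, ℋ_Σ)`: the `ℋ_Σ`-valued functions on the circle that
are almost everywhere measurable (weakly, which is the same as strongly since `ℋ_Σ` is separable)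
and square-integrable. -/
structure MemHPerp (𝔤 : LieSubalgebra ℝ (Mat N)) (c : ℝ) (a : Circle → OneForm (𝓡 2) S (Mat N)) :
    Prop where
  mem : ∀ t, MemHSigma 𝔤 c (a t)
  aestronglyMeasurable : ∀ β, MemHSigma 𝔤 c β →
    AEStronglyMeasurable (fun t => hSigmaInner c (a t) β) circleMeasure
  integrable : Integrable (fun t => hSigmaInner c (a t) (a t)) circleMeasure

end Hilbert

section ChartFrame

variable {E : Type*} [NormedAddCommGroup E] [NormedSpace ℝ E]
  {H : Type*} [TopologicalSpace H] {I : ModelWithCorners ℝ E H}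
  {M : Type*} [TopologicalSpace M] [ChartedSpace H M]
  {V : Type*} [NormedAddCommGroup V] [NormedSpace ℝ V]

theorem isOpen_chartTransition_source [I.Boundaryless] (x₀ x₁ : M) :
    IsOpen ((extChartAt I x₀).target ∩
      (extChartAt I x₀).symm ⁻¹' (extChartAt I x₁).source) :=
  (continuousOn_extChartAt_symm x₀).isOpen_inter_preimage (isOpen_extChartAt_target x₀)
    (isOpen_extChartAt_source x₁)

variable [IsManifold I ∞ M]

theorem contDiffOn_chartTransition (x₀ x₁ : M) :
    ContDiffOn ℝ ∞ (extChartAt I x₁ ∘ (extChartAt I x₀).symm)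
      ((extChartAt I x₀).target ∩ (extChartAt I x₀).symm ⁻¹' (extChartAt I x₁).source) := by
  have h := contDiffOn_ext_coord_change (I := I) (n := ∞) x₁ x₀
  rwa [PartialEquiv.trans_source, PartialEquiv.symm_source] at h

theorem IsSmoothOneForm.contMDiffOn_symmL {A : OneForm I M V} (hA : IsSmoothOneForm I A) (x₀ : M) :
    ContMDiffOn I 𝓘(ℝ, E →L[ℝ] V) ∞
      (fun x => (A x).comp ((trivializationAt E (TangentSpace I) x₀).symmL ℝ x))
      (chartAt H x₀).source := by
  intro x hx
  refine ContMDiffAt.contMDiffWithinAt ?_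
  have hb : x ∈ (trivializationAt E (TangentSpace I) x₀).baseSet := hx
  have hb' : x ∈ (trivializationAt (E →L[ℝ] V)
      (fun x : M => TangentSpace I x →L[ℝ] Bundle.Trivial M V x) x₀).baseSet := by
    rw [hom_trivializationAt_baseSet]
    exact ⟨hx, mem_univ _⟩
  have h := (Bundle.Trivialization.contMDiffAt_section_iff (IB := I) (n := ∞) (s := A) _ hb').1
    (hA x)
  refine h.congr_of_eventuallyEq ?_
  filter_upwards [(chartAt H x₀).open_source.mem_nhds hx] with z hz
  rw [hom_trivializationAt_apply]
  ext v
  simp [ContinuousLinearMap.inCoordinates]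

variable [I.Boundaryless]

theorem chartFrame_eq_symmL {x₀ : M} {y : E} (hy : y ∈ (extChartAt I x₀).target) :
    chartFrame I x₀ y =
      (trivializationAt E (TangentSpace I) x₀).symmL ℝ ((extChartAt I x₀).symm y) := by
  have : IsManifold I 1 M := IsManifold.of_le (n := ∞) (by simp)
  have hs : (extChartAt I x₀).symm y ∈ (chartAt H x₀).source := by
    simpa using (extChartAt I x₀).map_target hy
  rw [TangentBundle.symmL_trivializationAt hs, (extChartAt I x₀).right_inv hy, I.range_eq_univ,
    mfderivWithin_univ]
  rfl

theorem mdifferentiableAt_extChartAt_symm {x₀ : M} {y : E} (hy : y ∈ (extChartAt I x₀).target) :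
    MDifferentiableAt 𝓘(ℝ, E) I (extChartAt I x₀).symm y := by
  have : IsManifold I 1 M := IsManifold.of_le (n := ∞) (by simp)
  have h := mdifferentiableWithinAt_extChartAt_symm hy
  rwa [I.range_eq_univ, mdifferentiableWithinAt_univ] at h

theorem fderiv_chartTransition {x₀ x₁ : M} {y : E} (hy : y ∈ (extChartAt I x₀).target)
    (h1 : (extChartAt I x₀).symm y ∈ (extChartAt I x₁).source) :
    fderiv ℝ (extChartAt I x₁ ∘ (extChartAt I x₀).symm) y =
      (mfderiv I 𝓘(ℝ, E) (extChartAt I x₁) ((extChartAt I x₀).symm y)).comp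
        (chartFrame I x₀ y) := by
  have : IsManifold I 1 M := IsManifold.of_le (n := ∞) (by simp)
  rw [← mfderiv_eq_fderiv]
  exact mfderiv_comp y (mdifferentiableAt_extChartAt (by simpa using h1))
    (mdifferentiableAt_extChartAt_symm hy)

/-- Coordinate frames of two charts differ by the derivative of the chart transition. -/
theorem symmL_eq_symmL_fderiv {x₀ x₁ : M} {y : E} (hy : y ∈ (extChartAt I x₀).target)
    (h1 : (extChartAt I x₀).symm y ∈ (extChartAt I x₁).source) :
    (trivializationAt E (TangentSpace I) x₀).symmL ℝ ((extChartAt I x₀).symm y) =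
      ((trivializationAt E (TangentSpace I) x₁).symmL ℝ ((extChartAt I x₀).symm y)).comp
        (fderiv ℝ (extChartAt I x₁ ∘ (extChartAt I x₀).symm) y) := by
  have : IsManifold I 1 M := IsManifold.of_le (n := ∞) (by simp)
  have hs1 : (extChartAt I x₀).symm y ∈ (chartAt H x₁).source := by simpa using h1
  rw [← chartFrame_eq_symmL hy, TangentBundle.symmL_trivializationAt hs1]
  rw [fderiv_chartTransition hy h1]
  have hi := mfderivWithin_extChartAt_symm_comp_mfderiv_extChartAt' (I := I) h1
  ext v
  exact (DFunLike.congr_fun hi (chartFrame I x₀ y v)).symm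

theorem OneForm.inChart_eq {A : OneForm I M V} {x₀ : M} {y : E}
    (hy : y ∈ (extChartAt I x₀).target) :
    A.inChart I x₀ y = (A ((extChartAt I x₀).symm y)).comp
      ((trivializationAt E (TangentSpace I) x₀).symmL ℝ ((extChartAt I x₀).symm y)) := by
  rw [OneForm.inChart, chartFrame_eq_symmL hy]

theorem OneForm.inChart_change {A : OneForm I M V} {x₀ x₁ : M} {y : E}
    (hy : y ∈ (extChartAt I x₀).target)
    (h1 : (extChartAt I x₀).symm y ∈ (extChartAt I x₁).source) :
    A.inChart I x₀ y = (A.inChart I x₁ ((extChartAt I x₁ ∘ (extChartAt I x₀).symm) y)).comp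
      (fderiv ℝ (extChartAt I x₁ ∘ (extChartAt I x₀).symm) y) := by
  rw [inChart_eq hy, symmL_eq_symmL_fderiv hy h1,
    Function.comp_apply, inChart_eq ((extChartAt I x₁).map_source h1)]
  ext v
  change _ = (A ((extChartAt I x₁).symm (extChartAt I x₁ ((extChartAt I x₀).symm y))))
    ((trivializationAt E (TangentSpace I) x₁).symmL ℝ
      ((extChartAt I x₁).symm (extChartAt I x₁ ((extChartAt I x₀).symm y))) _)
  rw [(extChartAt I x₁).left_inv h1]
  rfl

theorem IsSmoothOneForm.contDiffOn_inChart {A : OneForm I M V} (hA : IsSmoothOneForm I A)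
    (x₀ : M) : ContDiffOn ℝ ∞ (A.inChart I x₀) (extChartAt I x₀).target := by
  have h := (hA.contMDiffOn_symmL x₀).comp (contMDiffOn_extChartAt_symm (n := ∞) x₀)
    (fun y hy => by simpa using (extChartAt I x₀).map_target hy)
  rw [contMDiffOn_iff_contDiffOn] at h
  exact h.congr fun y hy => OneForm.inChart_eq hy

theorem extDeriv_ofSubsingleton_apply {W : E → E →L[ℝ] V} {y : E} (hW : DifferentiableAt ℝ W y)
    (v : Fin 2 → E) :
    extDeriv (fun y => ContinuousAlternatingMap.ofSubsingleton ℝ E V (0 : Fin 1) (W y)) y v =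
      fderiv ℝ W y (v 0) (v 1) - fderiv ℝ W y (v 1) (v 0) := by
  have h (u : E) (y : E) : ContinuousAlternatingMap.ofSubsingleton ℝ E V (0 : Fin 1) (W y)
      ![u] = W y u := rfl
  have hd : DifferentiableAt ℝ
      (fun y => ContinuousAlternatingMap.ofSubsingleton ℝ E V (0 : Fin 1) (W y)) y :=
    (ContinuousAlternatingMap.ofSubsingletonLIE (𝕜 := ℝ) (E := E) (F := V)
      (0 : Fin 1)).toContinuousLinearEquiv.differentiableAt.comp y hW
  have h0 : (0 : Fin 2).removeNth v = ![v 1] := by ext i; fin_cases i; rfl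
  have h1 : (1 : Fin 2).removeNth v = ![v 0] := by ext i; fin_cases i; rfl
  rw [extDeriv_apply hd, Fin.sum_univ_two, h0, h1]
  simp only [h]
  rw [fderiv_clm_apply hW (differentiableAt_const _),
    fderiv_clm_apply hW (differentiableAt_const _)]
  simp [sub_eq_add_neg]

theorem OneForm.d_apply_of_mem_source {A : OneForm I M V} {x₀ x : M}
    (hx : x ∈ (extChartAt I x₀).source)
    (hA : DifferentiableAt ℝ (A.inChart I x₀) (extChartAt I x₀ x)) (v : Fin 2 → TangentSpace I x) :
    A.d I x v = fderiv ℝ (A.inChart I x₀) (extChartAt I x₀ x)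
        (mfderiv I 𝓘(ℝ, E) (extChartAt I x₀) x (v 0))
          (mfderiv I 𝓘(ℝ, E) (extChartAt I x₀) x (v 1)) -
      fderiv ℝ (A.inChart I x₀) (extChartAt I x₀ x)
        (mfderiv I 𝓘(ℝ, E) (extChartAt I x₀) x (v 1))
          (mfderiv I 𝓘(ℝ, E) (extChartAt I x₀) x (v 0)) := by
  have : IsManifold I 1 M := IsManifold.of_le (n := ∞) (by simp)
  set y := extChartAt I x x with hy
  have hyt : y ∈ (extChartAt I x).target := mem_extChartAt_target x
  have hyx : (extChartAt I x).symm y = x := (extChartAt I x).left_inv (mem_extChartAt_source x)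
  have hyU : y ∈ (extChartAt I x).target ∩ (extChartAt I x).symm ⁻¹' (extChartAt I x₀).source :=
    ⟨hyt, by rw [mem_preimage, hyx]; exact hx⟩
  have hU := (isOpen_chartTransition_source (I := I) x x₀).mem_nhds hyU
  set φ := extChartAt I x₀ ∘ (extChartAt I x).symm with hφ
  have hφy : φ y = extChartAt I x₀ x := by simp only [hφ, Function.comp_apply, hyx]
  have hev : (fun y => ContinuousAlternatingMap.ofSubsingleton ℝ E V (0 : Fin 1)
      (A.inChart I x y)) =ᶠ[𝓝 y] fun y => ((fun y =>
        ContinuousAlternatingMap.ofSubsingleton ℝ E V (0 : Fin 1) (A.inChart I x₀ y))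
          (φ y)).compContinuousLinearMap (fderiv ℝ φ y) := by
    filter_upwards [hU] with z hz
    rw [OneForm.inChart_change hz.1 hz.2]
    rfl
  have hA' : DifferentiableAt ℝ (fun y =>
      ContinuousAlternatingMap.ofSubsingleton ℝ E V (0 : Fin 1) (A.inChart I x₀ y)) (φ y) :=
    (ContinuousAlternatingMap.ofSubsingletonLIE (𝕜 := ℝ) (E := E) (F := V)
      (0 : Fin 1)).toContinuousLinearEquiv.differentiableAt.comp _ (hφy ▸ hA)
  have hpb := extDeriv_pullback (𝕜 := ℝ) (r := ∞) (x := y) (f := φ) hA'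
      ((contDiffOn_chartTransition x x₀).contDiffAt hU) (by simpa using ENat.LEInfty.out)
  have hL (w : TangentSpace I x) : fderiv ℝ φ y (mfderiv I 𝓘(ℝ, E) (extChartAt I x) x w) =
      mfderiv I 𝓘(ℝ, E) (extChartAt I x₀) x w := by
    have hi := mfderivWithin_extChartAt_symm_comp_mfderiv_extChartAt' (I := I)
      (mem_extChartAt_source (I := I) x)
    rw [fderiv_chartTransition hyU.1 hyU.2]
    rw [I.range_eq_univ, mfderivWithin_univ] at hi
    have := congrArg (mfderiv I 𝓘(ℝ, E) (extChartAt I x₀) x) (DFunLike.congr_fun hi w)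
    rw [hyx]
    exact this
  unfold OneForm.d
  rw [← hy, hev.extDeriv_eq, hpb]
  change extDeriv _ (φ y) (fun i => fderiv ℝ φ y (mfderiv I 𝓘(ℝ, E) (extChartAt I x) x (v i))) = _
  simp only [hL]
  rw [hφy]
  exact extDeriv_ofSubsingleton_apply hA _

end ChartFrame

section Determinants

variable {W : Type*} [AddCommGroup W] [Module ℝ W] {V : Type*} [AddCommGroup V] [Module ℝ V]

theorem AlternatingMap.apply_eq_basis_det_smul {ι : Type*} [Fintype ι] [DecidableEq ι]
    (f : W [⋀^ι]→ₗ[ℝ] V) (b : Basis ι ℝ W) (v : ι → W) : f v = b.det v • f b := by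
  have h : f = (LinearMap.toSpanSingleton ℝ V (f b)).compAlternatingMap b.det := by
    refine Basis.ext_alternating b fun i hi => ?_
    let σ : Equiv.Perm ι := Equiv.ofBijective i (Finite.injective_iff_bijective.1 hi)
    have h1 : (fun j => b (i j)) = b ∘ σ := rfl
    rw [h1, LinearMap.compAlternatingMap_apply, AlternatingMap.map_perm, AlternatingMap.map_perm,
      b.det_self]
    simp
  conv_lhs => rw [h]
  simp

theorem orientSign_eq_sign_det {n : ℕ} (b : Basis (Fin n) ℝ W) (v : Fin n → W) :
    orientSign b.orientation v = Real.sign (b.det v) := by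
  have h : SameRay ℝ (Module.Ray.someVector b.orientation) b.det := by
    rw [← ray_eq_iff (Module.Ray.someVector_ne_zero _) b.det_ne_zero, Module.Ray.someVector_ray]
    rfl
  obtain ⟨r₁, r₂, h₁, h₂, h⟩ := h.exists_pos (Module.Ray.someVector_ne_zero _) b.det_ne_zero
  have h' := DFunLike.congr_fun h v
  simp only [AlternatingMap.smul_apply, smul_eq_mul] at h'
  have : Module.Ray.someVector b.orientation v = r₁⁻¹ * r₂ * b.det v := by
    field_simp
    linarith
  unfold orientSign
  have hr : 0 < r₁⁻¹ * r₂ := by positivity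
  rw [this]
  rcases lt_trichotomy (b.det v) 0 with h0 | h0 | h0
  · rw [Real.sign_of_neg h0, Real.sign_of_neg (mul_neg_of_pos_of_neg hr h0)]
  · rw [h0, mul_zero]
  · rw [Real.sign_of_pos h0, Real.sign_of_pos (mul_pos hr h0)]

theorem orientSign_smul_apply {n : ℕ} (b : Basis (Fin n) ℝ W)
    (f : W [⋀^Fin n]→ₗ[ℝ] V) (v : Fin n → W) :
    orientSign b.orientation v • f v = |b.det v| • f b := by
  rw [f.apply_eq_basis_det_smul b v, orientSign_eq_sign_det, smul_smul]
  congr 1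
  rcases lt_trichotomy (b.det v) 0 with h | h | h
  · rw [Real.sign_of_neg h, abs_of_neg h]; ring
  · simp [h]
  · rw [Real.sign_of_pos h, abs_of_pos h]; ring

theorem Module.Basis.det_prod_apply {W' : Type*} [AddCommGroup W'] [Module ℝ W'] {ι κ : Type*}
    [Fintype ι] [DecidableEq ι] [Fintype κ] [DecidableEq κ] (b : Basis ι ℝ W) (c : Basis κ ℝ W')
    (u : ι → W) (w : κ → W') :
    (b.prod c).det (Sum.elim (fun i => (u i, 0)) (fun j => (0, w j))) = b.det u * c.det w := by
  rw [Basis.det_apply, Basis.det_apply, Basis.det_apply,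
    ← Matrix.det_fromBlocks_zero₂₁ (b.toMatrix u) 0 (c.toMatrix w)]
  congr 1
  ext i j
  rcases i with i | i <;> rcases j with j | j <;> simp [Basis.toMatrix_apply]

theorem Module.Basis.orientation_prod_congr {W' : Type*} [AddCommGroup W'] [Module ℝ W']
    {m n : ℕ} (b b' : Basis (Fin m) ℝ W) (c : Basis (Fin n) ℝ W')
    (h : b.orientation = b'.orientation) :
    ((b.prod c).reindex finSumFinEquiv).orientation =
      ((b'.prod c).reindex finSumFinEquiv).orientation := by
  rw [Basis.orientation_reindex, Basis.orientation_reindex]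
  congr 1
  rw [Basis.orientation_eq_iff_det_pos] at h ⊢
  have : ⇑(b'.prod c) = Sum.elim (fun i => (b' i, 0)) (fun j => (0, c j)) := by
    ext i <;> rcases i with i | i <;> simp
  rw [this, Basis.det_prod_apply, c.det_self]
  simpa using h

end Determinants

section TwoDim

variable {W : Type*} [NormedAddCommGroup W] [InnerProductSpace ℝ W] [Fact (finrank ℝ W = 2)]
  (o : Orientation ℝ W (Fin 2))

theorem Orientation.areaForm_smul_rightAngleRotation (u v : W) :
    o.areaForm u v • o.rightAngleRotation u = inner ℝ u u • v - inner ℝ u v • u := by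
  refine ext_inner_right ℝ fun w => ?_
  have := o.inner_mul_inner_add_areaForm_mul_areaForm u v w
  simp only [inner_smul_left, inner_sub_left, o.inner_rightAngleRotation_left,
    real_inner_self_eq_norm_sq, RCLike.conj_to_real]
  linarith

theorem Orientation.areaForm_smul_rightAngleRotation' (u v : W) :
    o.areaForm u v • o.rightAngleRotation v = inner ℝ u v • v - inner ℝ v v • u := by
  have := o.areaForm_smul_rightAngleRotation v u
  rw [o.areaForm_swap, neg_smul, this, real_inner_comm u v]
  abel

theorem Orientation.areaForm_sq (u v : W) :
    o.areaForm u v ^ 2 = inner ℝ u u * inner ℝ v v - inner ℝ u v ^ 2 := by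
  have := o.inner_sq_add_areaForm_sq u v
  rw [real_inner_self_eq_norm_sq, real_inner_self_eq_norm_sq]
  linarith

theorem Orientation.sqrt_det_gram (v : Fin 2 → W) :
    √(Matrix.det (Matrix.of fun i j => inner ℝ (v i) (v j))) = |o.areaForm (v 0) (v 1)| := by
  rw [← Real.sqrt_sq_eq_abs, o.areaForm_sq, Matrix.det_fin_two]
  simp only [Matrix.of_apply]
  rw [real_inner_comm (v 0) (v 1)]
  ring_nf

/-- The orthonormal basis `(e, Je)` is positively oriented. -/
theorem Orientation.exists_positive_orthonormalBasis :
    ∃ b : Basis (Fin 2) ℝ W, b.orientation = o ∧ (∀ v, b.det v = o.areaForm (v 0) (v 1)) ∧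
      ‖b 0‖ = 1 ∧ b 1 = o.rightAngleRotation (b 0) := by
  let b := o.finOrthonormalBasis two_pos Fact.out
  have hb : b.toBasis.orientation = o := o.finOrthonormalBasis_orientation two_pos Fact.out
  have hd : ∀ v, b.toBasis.det v = o.areaForm (v 0) (v 1) := fun v => by
    rw [o.areaForm_to_volumeForm, o.volumeForm_robust b hb]
    congr 1
    ext i; fin_cases i <;> rfl
  have h0 : inner ℝ (b 0) (b 0) = 1 := by simp
  have h1 : inner ℝ (b 0) (b 1) = 0 := b.orthonormal.2 (by simp)
  refine ⟨b.toBasis, hb, hd, by simp, ?_⟩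
  have h2 := hd b.toBasis
  rw [Basis.det_self] at h2
  have h3 := o.areaForm_smul_rightAngleRotation (b 0) (b 1)
  simp only [OrthonormalBasis.coe_toBasis] at h2 ⊢
  rw [← h2, h0, h1] at h3
  simpa using h3.symm

/-- The trace of a bilinear form with respect to the metric, in terms of an arbitrary frame. -/
theorem OrthonormalBasis.sum_apply_mul_gram {ι : Type*} [Fintype ι] (b : OrthonormalBasis ι ℝ W)
    (Q : W →ₗ[ℝ] W →ₗ[ℝ] ℝ) (u v : W) :
    (∑ i, Q (b i) (b i)) * (inner ℝ u u * inner ℝ v v - inner ℝ u v ^ 2) =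
      inner ℝ v v * Q u u - inner ℝ u v * (Q u v + Q v u) + inner ℝ u u * Q v v := by
  have hc : Fintype.card ι = 2 := by
    rw [← finrank_eq_card_basis b.toBasis]; exact Fact.out
  let b' := b.reindex (Fintype.equivFinOfCardEq hc)
  have hs : ∑ i, Q (b i) (b i) = ∑ i, Q (b' i) (b' i) := by
    rw [← (Fintype.equivFinOfCardEq hc).symm.sum_comp]
    simp [b']
  have hu := b'.sum_repr u
  have hv := b'.sum_repr v
  have h0 : inner ℝ (b' 0) (b' 0) = 1 := by simp
  have h3 : inner ℝ (b' 1) (b' 1) = 1 := by simp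
  have h1 : inner ℝ (b' 0) (b' 1) = 0 := b'.orthonormal.2 (by simp)
  have h2 : inner ℝ (b' 1) (b' 0) = 0 := b'.orthonormal.2 (by simp)
  rw [hs]
  rw [Fin.sum_univ_two] at hu hv ⊢
  generalize b'.repr u 0 = u0 at hu
  generalize b'.repr u 1 = u1 at hu
  generalize b'.repr v 0 = v0 at hv
  generalize b'.repr v 1 = v1 at hv
  rw [← hu, ← hv]
  simp only [inner_add_left, inner_add_right, inner_smul_left, inner_smul_right, h0, h1, h2, h3,
    map_add, map_smul, LinearMap.add_apply, LinearMap.smul_apply, smul_eq_mul, RCLike.conj_to_real]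
  ring

theorem OrthonormalBasis.sum_apply_eq {ι : Type*} [Fintype ι] (b : OrthonormalBasis ι ℝ W)
    (Q : W →ₗ[ℝ] W →ₗ[ℝ] ℝ) {e : W} (he : ‖e‖ = 1) :
    ∑ i, Q (b i) (b i) =
      Q e e + Q (o.rightAngleRotation e) (o.rightAngleRotation e) := by
  have := b.sum_apply_mul_gram Q e (o.rightAngleRotation e)
  simp only [real_inner_self_eq_norm_sq, he,
    o.inner_rightAngleRotation_right, o.areaForm_apply_self, o.areaForm_rightAngleRotation_left]
    at this
  linarith

end TwoDim

section Partition

variable {E : Type*} [NormedAddCommGroup E] [NormedSpace ℝ E] [FiniteDimensional ℝ E]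
  {H : Type*} [TopologicalSpace H] (I : ModelWithCorners ℝ E H)
  (M : Type*) [TopologicalSpace M] [ChartedSpace H M] [T2Space M]

theorem exists_finset_chartPartition [CompactSpace M] [IsManifold I ∞ M] : ∃ F : Finset M,
    (∀ x₀ ∉ F, ∀ x, chartPartition I M x₀ x = 0) ∧
      ∀ x, ∑ x₀ ∈ F, chartPartition I M x₀ x = 1 := by
  have hf := (chartPartition I M).locallyFinite.finite_nonempty_of_compact
  have h0 : ∀ x₀ ∉ hf.toFinset, ∀ x, chartPartition I M x₀ x = 0 := by
    intro x₀ hx₀ x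
    by_contra h
    exact hx₀ (hf.mem_toFinset.2 ⟨x, h⟩)
  refine ⟨hf.toFinset, h0, fun x => ?_⟩
  rw [← (chartPartition I M).sum_eq_one (mem_univ x), finsum_eq_sum_of_support_subset]
  intro x₀ hx₀
  by_contra h
  exact hx₀ (h0 x₀ h x)

variable [SigmaCompactSpace M] [IsManifold I ∞ M]

theorem tsupport_chartPartition_subset (x₀ : M) :
    tsupport (chartPartition I M x₀) ⊆ (chartAt H x₀).source :=
  (SmoothPartitionOfUnity.exists_isSubordinate_chartAt_source I M).choose_spec x₀

theorem chartPartition_eq_zero {x₀ x : M} (hx : x ∉ (chartAt H x₀).source) :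
    chartPartition I M x₀ x = 0 := by
  by_contra h
  exact hx (tsupport_chartPartition_subset I M x₀ (subset_tsupport _ h))

theorem continuous_chartPartition (x₀ : M) : Continuous (chartPartition I M x₀) :=
  (chartPartition I M x₀).contMDiff.continuous

end Partition

section ChartMeasure

variable {E : Type*} [NormedAddCommGroup E] [NormedSpace ℝ E]
  {H : Type*} [TopologicalSpace H] {I : ModelWithCorners ℝ E H} [I.Boundaryless]
  {M : Type*} [TopologicalSpace M] [ChartedSpace H M] [MeasurableSpace M] [BorelSpace M]
  [MeasurableSpace E] [BorelSpace E] {μ : Measure E}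

theorem aemeasurable_extChartAt_symm (x₀ : M) : AEMeasurable (extChartAt I x₀).symm
    (μ.restrict (extChartAt I x₀).target) :=
  (continuousOn_extChartAt_symm x₀).aemeasurable (isOpen_extChartAt_target x₀).measurableSet

theorem lintegral_map_withDensity_extChartAt_symm (x₀ : M) {g : E → ENNReal}
    (hg : AEMeasurable g (μ.restrict (extChartAt I x₀).target)) {f : M → ENNReal}
    (hf : Measurable f) :
    ∫⁻ x, f x ∂(((μ.restrict (extChartAt I x₀).target).withDensity g).map (extChartAt I x₀).symm) =
      ∫⁻ y in (extChartAt I x₀).target, g y * f ((extChartAt I x₀).symm y) ∂μ := by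
  have hm := aemeasurable_extChartAt_symm (I := I) (μ := μ) x₀
  rw [lintegral_map' hf.aemeasurable (hm.mono_ac (withDensity_absolutelyContinuous _ _))]
  exact lintegral_withDensity_eq_lintegral_mul₀ hg (hf.comp_aemeasurable hm)

end ChartMeasure

section SurfaceMeasure

local notation "E2" => EuclideanSpace ℝ (Fin 2)

variable {S : Type*} [TopologicalSpace S] [ChartedSpace (EuclideanSpace ℝ (Fin 2)) S]
  [IsManifold (𝓡 2) ∞ S]

/-- The coordinate vector fields of the chart of the surface around `x₀`. -/
noncomputable def coordField (x₀ : S) (i : Fin 2) (x : S) : TangentSpace (𝓡 2) x :=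
  (trivializationAt E2 (TangentSpace (𝓡 2)) x₀).symmL ℝ x (EuclideanSpace.basisFun (Fin 2) ℝ i)

theorem chartFrame_basisFun {x₀ : S} {y : E2} (hy : y ∈ (extChartAt (𝓡 2) x₀).target) (i : Fin 2) :
    chartFrame (𝓡 2) x₀ y ((EuclideanSpace.basisFun (Fin 2) ℝ).toBasis i) =
      coordField x₀ i ((extChartAt (𝓡 2) x₀).symm y) := by
  rw [chartFrame_eq_symmL hy, coordField, OrthonormalBasis.coe_toBasis]

theorem contMDiffOn_coordField (x₀ : S) (i : Fin 2) :
    ContMDiffOn (𝓡 2) (𝓡 2).tangent ∞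
      (fun x => (⟨x, coordField x₀ i x⟩ : TangentBundle (𝓡 2) S)) (chartAt E2 x₀).source := by
  have h :=
    (trivializationAt E2 (TangentSpace (𝓡 2) : S → Type _) x₀).contMDiffOn_localFrame_baseSet
    (I := 𝓡 2) ∞ (EuclideanSpace.basisFun (Fin 2) ℝ).toBasis i
  refine h.congr fun x hx => ?_
  rw [Bundle.Trivialization.localFrame_apply_of_mem_baseSet _ _ hx]
  simp only [coordField, Bundle.Trivialization.basisAt, Basis.map_apply,
    OrthonormalBasis.coe_toBasis]
  rw [← Bundle.Trivialization.symm_continuousLinearEquivAt_eq _ hx]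
  rfl

variable [Bundle.RiemannianBundle (fun x : S => TangentSpace (𝓡 2) x)]

/-- The volume density `√det(g(∂ᵢ, ∂ⱼ))` of the chart around `x₀`. -/
noncomputable def coordDensity (x₀ x : S) : ℝ :=
  √(Matrix.det (Matrix.of fun i j => inner ℝ (coordField x₀ i x) (coordField x₀ j x)))

theorem coordDensity_eq_abs_areaForm (o : (x : S) → Orientation ℝ (TangentSpace (𝓡 2) x) (Fin 2))
    (x₀ x : S) :
    coordDensity x₀ x = |(o x).areaForm (coordField x₀ 0 x) (coordField x₀ 1 x)| :=
  (o x).sqrt_det_gram fun i => coordField x₀ i x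

theorem areaForm_coordField_change (o : (x : S) → Orientation ℝ (TangentSpace (𝓡 2) x) (Fin 2))
    {x₀ x₁ : S} {y : E2} (hy : y ∈ (extChartAt (𝓡 2) x₀).target)
    (h1 : (extChartAt (𝓡 2) x₀).symm y ∈ (extChartAt (𝓡 2) x₁).source) :
    (o ((extChartAt (𝓡 2) x₀).symm y)).areaForm (coordField x₀ 0 ((extChartAt (𝓡 2) x₀).symm y))
        (coordField x₀ 1 ((extChartAt (𝓡 2) x₀).symm y)) =
      (fderiv ℝ (extChartAt (𝓡 2) x₁ ∘ (extChartAt (𝓡 2) x₀).symm) y).det *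
      (o ((extChartAt (𝓡 2) x₀).symm y)).areaForm (coordField x₁ 0 ((extChartAt (𝓡 2) x₀).symm y))
        (coordField x₁ 1 ((extChartAt (𝓡 2) x₀).symm y)) := by
  set x := (extChartAt (𝓡 2) x₀).symm y
  set T := fderiv ℝ (extChartAt (𝓡 2) x₁ ∘ (extChartAt (𝓡 2) x₀).symm) y with hT
  let L : E2 →ₗ[ℝ] TangentSpace (𝓡 2) x :=
    ((trivializationAt E2 (TangentSpace (𝓡 2)) x₁).symmL ℝ x).toLinearMap
  let b := (EuclideanSpace.basisFun (Fin 2) ℝ).toBasis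
  have key := ((o x).volumeForm.compLinearMap L).apply_eq_basis_det_smul b (T ∘ b)
  have hd : b.det (T ∘ b) = T.det := by
    have := b.det_comp T.toLinearMap b
    rw [b.det_self, mul_one] at this
    exact this
  have hf (i : Fin 2) : coordField x₀ i x = L (T (b i)) := by
    have := DFunLike.congr_fun (symmL_eq_symmL_fderiv hy h1) (b i)
    simpa [coordField, b, L] using! this
  rw [hd] at key
  rw [hf, hf, (o x).areaForm_to_volumeForm, (o x).areaForm_to_volumeForm]
  have e0 : (fun i => L (T (b i))) = ![L (T (b 0)), L (T (b 1))] := by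
    ext i; fin_cases i <;> rfl
  have e1 : (fun i => L (b i)) = ![coordField x₁ 0 x, coordField x₁ 1 x] := by
    ext i; fin_cases i <;> simp [coordField, b, L]
  rw [← e0, ← e1]
  exact key

theorem areaForm_coordField_ne_zero (o : (x : S) → Orientation ℝ (TangentSpace (𝓡 2) x) (Fin 2))
    {x₀ x : S} (hx : x ∈ (chartAt E2 x₀).source) :
    (o x).areaForm (coordField x₀ 0 x) (coordField x₀ 1 x) ≠ 0 := by
  obtain ⟨b, -, hb, -⟩ := (o x).exists_positive_orthonormalBasis
  let L := (trivializationAt E2 (TangentSpace (𝓡 2)) x₀).continuousLinearEquivAt ℝ x hx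
  let c := (EuclideanSpace.basisFun (Fin 2) ℝ).toBasis.map L.symm.toLinearEquiv
  have h := (b.isUnit_det c).ne_zero
  rw [hb] at h
  have hc (i : Fin 2) : c i = coordField x₀ i x := by
    rw [coordField, ← Bundle.Trivialization.symm_continuousLinearEquivAt_eq _ hx]
    simp [c, L]
  rwa [hc, hc] at h

variable [IsContMDiffRiemannianBundle (𝓡 2) ∞ (EuclideanSpace ℝ (Fin 2))
  (fun x : S => TangentSpace (𝓡 2) x)]

theorem continuousOn_inner_coordField (x₀ : S) (i j : Fin 2) :
    ContinuousOn (fun x => inner ℝ (coordField x₀ i x) (coordField x₀ j x))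
      (chartAt E2 x₀).source :=
  (ContMDiffOn.inner_bundle (contMDiffOn_coordField x₀ i)
    (contMDiffOn_coordField x₀ j)).continuousOn

theorem continuousOn_coordDensity (x₀ : S) :
    ContinuousOn (coordDensity x₀) (chartAt E2 x₀).source := by
  refine Real.continuous_sqrt.comp_continuousOn ?_
  simp only [Matrix.det_fin_two, Matrix.of_apply]
  exact ((continuousOn_inner_coordField x₀ 0 0).mul (continuousOn_inner_coordField x₀ 1 1)).sub
    ((continuousOn_inner_coordField x₀ 0 1).mul (continuousOn_inner_coordField x₀ 1 0))

theorem continuousOn_coordDensity_symm (x₀ : S) :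
    ContinuousOn (fun y => coordDensity x₀ ((extChartAt (𝓡 2) x₀).symm y))
      (extChartAt (𝓡 2) x₀).target :=
  (continuousOn_coordDensity x₀).comp (continuousOn_extChartAt_symm x₀) fun y hy => by
    simpa using (extChartAt (𝓡 2) x₀).map_target hy

theorem aemeasurable_coordDensity_symm (x₀ : S) :
    AEMeasurable (fun y => ENNReal.ofReal (coordDensity x₀ ((extChartAt (𝓡 2) x₀).symm y)))
      (volume.restrict (extChartAt (𝓡 2) x₀).target) :=
  ((continuousOn_coordDensity_symm x₀).aemeasurable
    (isOpen_extChartAt_target x₀).measurableSet).ennreal_ofReal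

variable [MeasurableSpace S]

/-- The Riemannian volume of the domain of the chart around `x₀`, computed in this chart. -/
noncomputable def chartMeasure (x₀ : S) : Measure S :=
  ((volume.restrict (extChartAt (𝓡 2) x₀).target).withDensity fun y =>
    ENNReal.ofReal (coordDensity x₀ ((extChartAt (𝓡 2) x₀).symm y))).map (extChartAt (𝓡 2) x₀).symm

variable [BorelSpace S]

theorem lintegral_chartMeasure (x₀ : S) {f : S → ENNReal} (hf : Measurable f) :
    ∫⁻ x, f x ∂(chartMeasure x₀) = ∫⁻ y in (extChartAt (𝓡 2) x₀).target,
      ENNReal.ofReal (coordDensity x₀ ((extChartAt (𝓡 2) x₀).symm y)) *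
        f ((extChartAt (𝓡 2) x₀).symm y) := by
  exact lintegral_map_withDensity_extChartAt_symm x₀ (aemeasurable_coordDensity_symm x₀) hf

theorem setLIntegral_chartMeasure_change
    (o : (x : S) → Orientation ℝ (TangentSpace (𝓡 2) x) (Fin 2)) (x₀ x₁ : S) {f : S → ENNReal}
    (hf : Measurable f) :
    ∫⁻ x in (chartAt E2 x₁).source, f x ∂(chartMeasure x₀) =
      ∫⁻ x in (chartAt E2 x₀).source, f x ∂(chartMeasure x₁) := by
  have hO (x : S) : MeasurableSet (chartAt E2 x).source := (chartAt E2 x).open_source.measurableSet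
  rw [← lintegral_indicator (hO _), ← lintegral_indicator (hO _),
    lintegral_chartMeasure _ (hf.indicator (hO _)), lintegral_chartMeasure _ (hf.indicator (hO _))]
  have key (a b : S) : ∫⁻ y in (extChartAt (𝓡 2) a).target,
      ENNReal.ofReal (coordDensity a ((extChartAt (𝓡 2) a).symm y)) *
        (chartAt E2 b).source.indicator f ((extChartAt (𝓡 2) a).symm y) =
      ∫⁻ y in (extChartAt (𝓡 2) a).target ∩ (extChartAt (𝓡 2) a).symm ⁻¹'
          (extChartAt (𝓡 2) b).source,
        ENNReal.ofReal (coordDensity a ((extChartAt (𝓡 2) a).symm y)) *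
          f ((extChartAt (𝓡 2) a).symm y) := by
    have ho := isOpen_chartTransition_source (I := 𝓡 2) a b
    rw [← Measure.restrict_restrict_of_subset inter_subset_left,
      ← lintegral_indicator ho.measurableSet]
    refine setLIntegral_congr_fun (isOpen_extChartAt_target a).measurableSet fun y hy => ?_
    by_cases h : (extChartAt (𝓡 2) a).symm y ∈ (chartAt E2 b).source
    · have h' : y ∈ (extChartAt (𝓡 2) a).target ∩ (extChartAt (𝓡 2) a).symm ⁻¹'
          (extChartAt (𝓡 2) b).source := ⟨hy, by simpa using h⟩
      rw [indicator_of_mem h, indicator_of_mem h']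
    · have h' : y ∉ (extChartAt (𝓡 2) a).target ∩ (extChartAt (𝓡 2) a).symm ⁻¹'
          (extChartAt (𝓡 2) b).source := fun h' => h (by simpa using h'.2)
      rw [indicator_of_notMem h, indicator_of_notMem h', mul_zero]
  rw [key, key]
  set φ := extChartAt (𝓡 2) x₁ ∘ (extChartAt (𝓡 2) x₀).symm with hφ
  set s := (extChartAt (𝓡 2) x₀).target ∩ (extChartAt (𝓡 2) x₀).symm ⁻¹'
    (extChartAt (𝓡 2) x₁).source with hs
  have hso : IsOpen s := isOpen_chartTransition_source x₀ x₁
  have himg : (extChartAt (𝓡 2) x₁).target ∩ (extChartAt (𝓡 2) x₁).symm ⁻¹'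
      (extChartAt (𝓡 2) x₀).source = φ '' s := by
    ext z
    constructor
    · rintro ⟨hz, hz'⟩
      refine ⟨extChartAt (𝓡 2) x₀ ((extChartAt (𝓡 2) x₁).symm z),
        ⟨(extChartAt (𝓡 2) x₀).map_source hz', ?_⟩, ?_⟩
      · rw [mem_preimage, (extChartAt (𝓡 2) x₀).left_inv hz']
        exact (extChartAt (𝓡 2) x₁).map_target hz
      · rw [hφ, Function.comp_apply, (extChartAt (𝓡 2) x₀).left_inv hz',
          (extChartAt (𝓡 2) x₁).right_inv hz]
    · rintro ⟨y, hy, rfl⟩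
      refine ⟨(extChartAt (𝓡 2) x₁).map_source hy.2, ?_⟩
      rw [mem_preimage, hφ, Function.comp_apply, (extChartAt (𝓡 2) x₁).left_inv hy.2]
      exact (extChartAt (𝓡 2) x₀).map_target hy.1
  have hinj : InjOn φ s := fun y hy z hz h =>
    (extChartAt (𝓡 2) x₀).symm.injOn hy.1 hz.1 ((extChartAt (𝓡 2) x₁).injOn hy.2 hz.2 h)
  rw [himg, lintegral_image_eq_lintegral_abs_det_fderiv_mul volume hso.measurableSet
    (f' := fderiv ℝ φ) (fun y hy => (((contDiffOn_chartTransition x₀ x₁).contDiffAt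
      (hso.mem_nhds hy)).differentiableAt (by simp)).hasFDerivAt.hasFDerivWithinAt) hinj]
  refine setLIntegral_congr_fun hso.measurableSet fun y hy => ?_
  have e : (extChartAt (𝓡 2) x₁).symm (φ y) = (extChartAt (𝓡 2) x₀).symm y :=
    (extChartAt (𝓡 2) x₁).left_inv hy.2
  rw [e, ← mul_assoc, ← ENNReal.ofReal_mul (abs_nonneg _), coordDensity_eq_abs_areaForm o,
    coordDensity_eq_abs_areaForm o, areaForm_coordField_change o hy.1 hy.2, abs_mul]

variable [T2Space S] [CompactSpace S]

theorem lintegral_surfaceMeasure {f : S → ENNReal} (hf : Measurable f) :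
    ∫⁻ x, f x ∂(surfaceMeasure S) =
      ∑' x₀, ∫⁻ x, ENNReal.ofReal (chartPartition (𝓡 2) S x₀ x) * f x ∂(chartMeasure x₀) := by
  have hρ (x₀ : S) : Measurable fun x => ENNReal.ofReal (chartPartition (𝓡 2) S x₀ x) :=
    (continuous_chartPartition (𝓡 2) S x₀).measurable.ennreal_ofReal
  have hρf (x₀ : S) : Measurable fun x => ENNReal.ofReal (chartPartition (𝓡 2) S x₀ x) * f x :=
    (hρ x₀).mul hf
  unfold surfaceMeasure riemannianVolume
  rw [lintegral_sum_measure, OrthonormalBasis.addHaar_eq_volume]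
  congr 1 with x₀
  have hT := (isOpen_extChartAt_target (I := 𝓡 2) x₀).measurableSet
  have he : EqOn (fun y =>
      ENNReal.ofReal (chartPartition (𝓡 2) S x₀ ((extChartAt (𝓡 2) x₀).symm y) *
      √(Matrix.det (Matrix.of fun i j => inner ℝ
        (chartFrame (𝓡 2) x₀ y ((EuclideanSpace.basisFun (Fin 2) ℝ).toBasis i))
        (chartFrame (𝓡 2) x₀ y ((EuclideanSpace.basisFun (Fin 2) ℝ).toBasis j))))))
      (fun y => ENNReal.ofReal (chartPartition (𝓡 2) S x₀ ((extChartAt (𝓡 2) x₀).symm y)) *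
        ENNReal.ofReal (coordDensity x₀ ((extChartAt (𝓡 2) x₀).symm y)))
      (extChartAt (𝓡 2) x₀).target := by
    intro y hy
    simp only [chartFrame_basisFun hy, coordDensity,
      ENNReal.ofReal_mul ((chartPartition (𝓡 2) S).nonneg x₀ _)]
  have hm : AEMeasurable (fun y =>
      ENNReal.ofReal (chartPartition (𝓡 2) S x₀ ((extChartAt (𝓡 2) x₀).symm y)) *
        ENNReal.ofReal (coordDensity x₀ ((extChartAt (𝓡 2) x₀).symm y)))
      (volume.restrict (extChartAt (𝓡 2) x₀).target) :=
    ((hρ x₀).comp_aemeasurable (aemeasurable_extChartAt_symm x₀)).mul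
      (aemeasurable_coordDensity_symm x₀)
  rw [lintegral_map_withDensity_extChartAt_symm x₀ (hm.congr
    ((ae_restrict_iff' hT).2 (ae_of_all _ fun y hy => (he hy).symm))) hf,
    lintegral_chartMeasure x₀ (hρf x₀)]
  refine setLIntegral_congr_fun hT fun y hy => ?_
  have := he hy
  simp only at this ⊢
  rw [this]
  ring

theorem surfaceMeasure_restrict_source
    (o : (x : S) → Orientation ℝ (TangentSpace (𝓡 2) x) (Fin 2)) (x₁ : S) :
    (surfaceMeasure S).restrict (chartAt E2 x₁).source = chartMeasure x₁ := by
  have hO (x : S) : MeasurableSet (chartAt E2 x).source := (chartAt E2 x).open_source.measurableSet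
  have hρ (x₀ : S) : Measurable fun x => ENNReal.ofReal (chartPartition (𝓡 2) S x₀ x) :=
    (continuous_chartPartition (𝓡 2) S x₀).measurable.ennreal_ofReal
  refine Measure.ext_of_lintegral _ fun f hf => ?_
  have hρf (x₀ : S) : Measurable fun x => ENNReal.ofReal (chartPartition (𝓡 2) S x₀ x) * f x :=
    (hρ x₀).mul hf
  rw [← lintegral_indicator (hO _), lintegral_surfaceMeasure (hf.indicator (hO _))]
  have h1 (x₀ : S) : ∫⁻ x, ENNReal.ofReal (chartPartition (𝓡 2) S x₀ x) *
      (chartAt E2 x₁).source.indicator f x ∂(chartMeasure x₀) =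
      ∫⁻ x, ENNReal.ofReal (chartPartition (𝓡 2) S x₀ x) * f x ∂(chartMeasure x₁) := by
    have e1 (x : S) : ENNReal.ofReal (chartPartition (𝓡 2) S x₀ x) *
        (chartAt E2 x₁).source.indicator f x = (chartAt E2 x₁).source.indicator
          (fun x => ENNReal.ofReal (chartPartition (𝓡 2) S x₀ x) * f x) x := by
      by_cases h : x ∈ (chartAt E2 x₁).source <;> simp [h]
    have e2 (x : S) : ENNReal.ofReal (chartPartition (𝓡 2) S x₀ x) * f x =
        (chartAt E2 x₀).source.indicator
          (fun x => ENNReal.ofReal (chartPartition (𝓡 2) S x₀ x) * f x) x := by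
      by_cases h : x ∈ (chartAt E2 x₀).source
      · simp [h]
      · simp [h, chartPartition_eq_zero (𝓡 2) S h]
    simp_rw [e1]
    rw [lintegral_indicator (hO _), setLIntegral_chartMeasure_change o _ _ (hρf x₀),
      ← lintegral_indicator (hO _)]
    exact (lintegral_congr e2).symm
  simp_rw [h1]
  obtain ⟨F, hF, hF1⟩ := exists_finset_chartPartition (𝓡 2) S
  rw [tsum_eq_sum (s := F) fun x₀ hx₀ => by simp [hF x₀ hx₀],
    ← lintegral_finsetSum _ fun x₀ _ => hρf x₀]
  refine lintegral_congr fun x => ?_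
  rw [← Finset.sum_mul, ← ENNReal.ofReal_sum_of_nonneg
    fun x₀ _ => (chartPartition (𝓡 2) S).nonneg x₀ x, hF1 x]
  simp

theorem isFiniteMeasure_surfaceMeasure
    (o : (x : S) → Orientation ℝ (TangentSpace (𝓡 2) x) (Fin 2)) :
    IsFiniteMeasure (surfaceMeasure S) := by
  have : IsLocallyFiniteMeasure (surfaceMeasure S) := by
    refine ⟨fun x => ?_⟩
    obtain ⟨K, hK, hKT, hKc⟩ := local_compact_nhds
      ((isOpen_extChartAt_target (I := 𝓡 2) x).mem_nhds (mem_extChartAt_target x))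
    set s := (chartAt E2 x).source ∩ extChartAt (𝓡 2) x ⁻¹' interior K with hs
    have hso : IsOpen s := by
      have := (continuousOn_extChartAt (I := 𝓡 2) x).isOpen_inter_preimage
        (isOpen_extChartAt_source x) (isOpen_interior (s := K))
      rwa [extChartAt_source] at this
    refine ⟨s, hso.mem_nhds ⟨mem_chart_source _ x, mem_interior_iff_mem_nhds.2 hK⟩, ?_⟩
    have h1 : surfaceMeasure S s = ∫⁻ y in (extChartAt (𝓡 2) x).target,
        ENNReal.ofReal (coordDensity x ((extChartAt (𝓡 2) x).symm y)) *
          s.indicator 1 ((extChartAt (𝓡 2) x).symm y) := by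
      rw [← lintegral_chartMeasure x (measurable_one.indicator hso.measurableSet),
        lintegral_indicator_one hso.measurableSet, ← surfaceMeasure_restrict_source o x,
        Measure.restrict_apply hso.measurableSet, inter_eq_left.2 inter_subset_left]
    have h2 : IntegrableOn (fun y => coordDensity x ((extChartAt (𝓡 2) x).symm y)) K :=
      ((continuousOn_coordDensity_symm x).mono hKT).integrableOn_compact hKc
    rw [h1]
    refine lt_of_le_of_lt ?_ h2.lintegral_lt_top
    rw [← lintegral_indicator hKc.measurableSet,
      ← lintegral_indicator (isOpen_extChartAt_target x).measurableSet]
    refine lintegral_mono fun y => ?_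
    by_cases hy : y ∈ (extChartAt (𝓡 2) x).target
    · rw [indicator_of_mem hy]
      by_cases hy' : (extChartAt (𝓡 2) x).symm y ∈ s
      · have hyK : y ∈ K := by
          have := hy'.2
          rw [mem_preimage, (extChartAt (𝓡 2) x).right_inv hy] at this
          exact interior_subset this
        rw [indicator_of_mem hy', indicator_of_mem hyK]
        simp
      · rw [indicator_of_notMem hy', mul_zero]
        exact zero_le
    · rw [indicator_of_notMem hy]
      exact zero_le
  infer_instance

end SurfaceMeasure

section CircleMeasure

local notation "E1" => EuclideanSpace ℝ (Fin 1)

theorem iS1_add (r s : ℝ) : iS1 (r + s) = iS1 r * iS1 s := by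
  simp only [iS1, mul_add, Circle.exp_add]

theorem iS1_zero : iS1 0 = 1 := by simp [iS1]

theorem contMDiff_iS1 : ContMDiff 𝓘(ℝ, ℝ) (𝓡 1) ∞ iS1 :=
  contMDiff_circleExp.comp (ContDiff.contMDiff (by fun_prop))

theorem continuous_iS1 : Continuous iS1 := contMDiff_iS1.continuous

theorem injOn_iS1 : InjOn iS1 (Ioc 0 1) := by
  intro r hr s hs h
  have hpi := Real.pi_pos
  have := Circle.exp_injOn_Ioc (a := 0) (b := 2 * Real.pi) (by linarith)
    (x₁ := 2 * Real.pi * r) (x₂ := 2 * Real.pi * s)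
    ⟨by nlinarith [hr.1], by nlinarith [hr.2]⟩ ⟨by nlinarith [hs.1], by nlinarith [hs.2]⟩ h
  exact mul_left_cancel₀ (by positivity) this

theorem surjOn_iS1 : SurjOn iS1 (Ioc 0 1) univ := by
  intro t _
  obtain ⟨x, rfl⟩ := Circle.exp_surjective t
  have hpi : 2 * Real.pi ≠ 0 := by positivity
  obtain ⟨y, hy, h⟩ := Circle.periodic_exp.exists_mem_Ioc (by positivity) x 0
  rw [zero_add] at hy
  refine ⟨y / (2 * Real.pi), ⟨by have := hy.1; positivity, ?_⟩, ?_⟩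
  · rw [div_le_one (by positivity)]; exact hy.2
  · rw [h, iS1, mul_div_cancel₀ _ hpi]

theorem circleVec_iS1 (s : ℝ) :
    circleVec (iS1 s) = mfderiv 𝓘(ℝ, ℝ) (𝓡 1) iS1 s (1 : ℝ) := by
  have h1 : MDifferentiableAt 𝓘(ℝ, ℝ) (𝓡 1) iS1 (0 + s) := contMDiff_iS1.mdifferentiable (by simp) _
  have h2 : HasMFDerivAt 𝓘(ℝ, ℝ) 𝓘(ℝ, ℝ) (fun r : ℝ => r + s) 0 (ContinuousLinearMap.id ℝ ℝ) :=
    ((hasFDerivAt_id (𝕜 := ℝ) (0 : ℝ)).add_const s).hasMFDerivAt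
  have h3 := (h1.hasMFDerivAt.comp (0 : ℝ) h2).mfderiv
  have h4 : iS1 ∘ (fun r : ℝ => r + s) = fun r => iS1 r * iS1 s := funext fun r => iS1_add r s
  rw [h4] at h3
  have h5 := DFunLike.congr_fun h3 (1 : ℝ)
  refine h5.trans ?_
  rw [zero_add]
  rfl

/-- The coordinate vector field of the chart of the circle around `t₀`. -/
noncomputable def circleCoordField (t₀ t : Circle) : TangentSpace (𝓡 1) t :=
  (trivializationAt E1 (TangentSpace (𝓡 1)) t₀).symmL ℝ t (EuclideanSpace.basisFun (Fin 1) ℝ 0)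

/-- The density of the measure `dt` in the chart around `t₀`. -/
noncomputable def circleDensity (t₀ t : Circle) : ℝ :=
  |(circleBasis t).coord 0 (circleCoordField t₀ t)|

theorem hasDerivAt_extChartAt_iS1 (t₀ : Circle) {s : ℝ} (hs : iS1 s ∈ (chartAt E1 t₀).source) :
    HasDerivAt (fun r => extChartAt (𝓡 1) t₀ (iS1 r))
      (mfderiv (𝓡 1) 𝓘(ℝ, E1) (extChartAt (𝓡 1) t₀) (iS1 s) (circleVec (iS1 s)) : E1) s := by
  have h1 : MDifferentiableAt 𝓘(ℝ, ℝ) (𝓡 1) iS1 s := contMDiff_iS1.mdifferentiable (by simp) _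
  have h2 := ((mdifferentiableAt_extChartAt (I := 𝓡 1) hs).hasMFDerivAt.comp s h1.hasMFDerivAt)
  rw [hasMFDerivAt_iff_hasFDerivAt] at h2
  rw [circleVec_iS1]
  let L : ℝ →L[ℝ] E1 :=
    (mfderiv (𝓡 1) 𝓘(ℝ, E1) (extChartAt (𝓡 1) t₀) (iS1 s)).comp (mfderiv 𝓘(ℝ, ℝ) (𝓡 1) iS1 s)
  have h3 : HasFDerivAt (fun r => extChartAt (𝓡 1) t₀ (iS1 r)) L s := h2
  exact h3.hasDerivAt

theorem circleBasis_zero (t : Circle) : circleBasis t 0 = circleVec t := by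
  simp [circleBasis]

theorem circleBasis_coord_circleVec (t : Circle) : (circleBasis t).coord 0 (circleVec t) = 1 := by
  rw [← circleBasis_zero, Basis.coord_apply, Basis.repr_self, Finsupp.single_eq_same]

/-- The coordinate on the model space of the circle. -/
noncomputable def lineCoord : E1 →L[ℝ] ℝ := EuclideanSpace.proj (𝕜 := ℝ) (0 : Fin 1)

theorem lineCoord_smul_basisFun (w : E1) :
    lineCoord w • EuclideanSpace.basisFun (Fin 1) ℝ 0 = w := by
  ext i; fin_cases i; simp [lineCoord]

/-- The coordinate of `∂/∂t` in the chart around `t₀`. -/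
noncomputable def circleVecCoord (t₀ t : Circle) : ℝ :=
  lineCoord (mfderiv (𝓡 1) 𝓘(ℝ, E1) (extChartAt (𝓡 1) t₀) t (circleVec t) : E1)

theorem circleVecCoord_mul {t₀ t : Circle} (ht : t ∈ (chartAt E1 t₀).source) :
    circleVecCoord t₀ t * (circleBasis t).coord 0 (circleCoordField t₀ t) = 1 := by
  have h1 : (trivializationAt E1 (TangentSpace (𝓡 1)) t₀).symmL ℝ t
      (mfderiv (𝓡 1) 𝓘(ℝ, E1) (extChartAt (𝓡 1) t₀) t (circleVec t)) = circleVec t := by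
    rw [TangentBundle.symmL_trivializationAt ht]
    have ht' : t ∈ (extChartAt (𝓡 1) t₀).source := by simpa using ht
    have hi := mfderivWithin_extChartAt_symm_comp_mfderiv_extChartAt' (I := 𝓡 1) ht'
    exact DFunLike.congr_fun hi (circleVec t)
  generalize hw : (mfderiv (𝓡 1) 𝓘(ℝ, E1) (extChartAt (𝓡 1) t₀) t (circleVec t) : E1) = w at h1
  have h2 : circleVecCoord t₀ t = lineCoord w := by rw [← hw]; rfl
  have h1' : lineCoord w • circleCoordField t₀ t = circleVec t := by
    rw [circleCoordField, ← map_smul]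
    exact (congrArg ((trivializationAt E1 (TangentSpace (𝓡 1)) t₀).symmL ℝ t)
      (lineCoord_smul_basisFun w)).trans h1
  rw [h2]
  have h3 := congrArg ((circleBasis t).coord 0) h1'
  rw [circleBasis_coord_circleVec, map_smul] at h3
  exact h3

theorem circleDensity_eq {t₀ t : Circle} (ht : t ∈ (chartAt E1 t₀).source) :
    circleDensity t₀ t = |circleVecCoord t₀ t|⁻¹ := by
  have := circleVecCoord_mul ht
  rw [← abs_inv, circleDensity, eq_inv_of_mul_eq_one_right this]

theorem isOpenQuotientMap_iS1 : IsOpenQuotientMap iS1 := by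
  have h2 : IsOpenQuotientMap Circle.exp :=
    ⟨Circle.exp_surjective, Circle.exp.continuous, isLocalHomeomorph_circleExp.isOpenMap⟩
  exact h2.comp (Homeomorph.mulLeft₀ (2 * Real.pi) (by positivity)).isOpenQuotientMap

theorem continuousOn_circleVecCoord (t₀ : Circle) :
    ContinuousOn (circleVecCoord t₀) (chartAt E1 t₀).source := by
  have hsrc := (chartAt E1 t₀).open_source
  intro t ht
  refine ContinuousAt.continuousWithinAt ?_
  obtain ⟨s, rfl⟩ := isOpenQuotientMap_iS1.surjective t
  rw [← isOpenQuotientMap_iS1.continuousAt_comp_iff]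
  have hU : IsOpen (iS1 ⁻¹' (chartAt E1 t₀).source) := hsrc.preimage continuous_iS1
  have hsm : ContDiffOn ℝ ∞ (fun r => extChartAt (𝓡 1) t₀ (iS1 r))
      (iS1 ⁻¹' (chartAt E1 t₀).source) := by
    rw [← contMDiffOn_iff_contDiffOn]
    exact (contMDiffOn_extChartAt (I := 𝓡 1) (n := ∞) (x := t₀)).comp contMDiff_iS1.contMDiffOn
      fun r hr => hr
  have hc := (hsm.continuousOn_deriv_of_isOpen hU (by simp)).continuousAt (hU.mem_nhds ht)
  refine (lineCoord.continuous.continuousAt.comp hc).congr ?_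
  filter_upwards [hU.mem_nhds ht] with r hr
  rw [Function.comp_apply, (hasDerivAt_extChartAt_iS1 t₀ hr).deriv]
  rfl

theorem continuousOn_circleDensity (t₀ : Circle) :
    ContinuousOn (circleDensity t₀) (chartAt E1 t₀).source := by
  refine ((continuousOn_circleVecCoord t₀).abs.inv₀ fun t ht h => ?_).congr
    fun t ht => circleDensity_eq ht
  have := circleVecCoord_mul ht
  rw [abs_eq_zero.1 h, zero_mul] at this
  exact zero_ne_one this

theorem aemeasurable_circleDensity_symm (t₀ : Circle) :
    AEMeasurable (fun z => ENNReal.ofReal (circleDensity t₀ ((extChartAt (𝓡 1) t₀).symm z)))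
      (volume.restrict (extChartAt (𝓡 1) t₀).target) :=
  (((continuousOn_circleDensity t₀).comp (continuousOn_extChartAt_symm t₀) fun y hy => by
    simpa using (extChartAt (𝓡 1) t₀).map_target hy).aemeasurable
      (isOpen_extChartAt_target t₀).measurableSet).ennreal_ofReal

theorem circleMeasure_restrict_source (t₀ : Circle) :
    circleMeasure.restrict (chartAt E1 t₀).source =
      ((volume.restrict (extChartAt (𝓡 1) t₀).target).withDensity fun z =>
        ENNReal.ofReal (circleDensity t₀ ((extChartAt (𝓡 1) t₀).symm z))).map
          (extChartAt (𝓡 1) t₀).symm := by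
  have hO := (chartAt E1 t₀).open_source.measurableSet
  have hT := (isOpen_extChartAt_target (I := 𝓡 1) t₀).measurableSet
  have hm := continuous_iS1.measurable
  refine Measure.ext_of_lintegral _ fun f hf => ?_
  rw [lintegral_map_withDensity_extChartAt_symm t₀ (aemeasurable_circleDensity_symm t₀) hf,
    circleMeasure, Measure.restrict_map hm hO, Measure.restrict_restrict (hm hO),
    lintegral_map hf hm]
  set P := iS1 ⁻¹' (chartAt E1 t₀).source ∩ Ioc 0 1 with hP
  let κ := (OrthonormalBasis.singleton (Fin 1) ℝ).repr
  have hκ : MeasurePreserving κ := (OrthonormalBasis.singleton (Fin 1) ℝ).measurePreserving_repr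
  have hκe : MeasurableEmbedding κ := κ.toHomeomorph.measurableEmbedding
  have hκs (w : E1) : κ.symm w = lineCoord w := by
    obtain ⟨r, rfl⟩ := κ.surjective w
    rw [κ.symm_apply_apply]
    exact (OrthonormalBasis.singleton_repr r 0).symm
  rw [← hκ.setLIntegral_comp_preimage_emb hκe]
  have himg : κ ⁻¹' (extChartAt (𝓡 1) t₀).target =
      (fun s => κ.symm (extChartAt (𝓡 1) t₀ (iS1 s))) '' P := by
    ext r
    constructor
    · intro hr
      obtain ⟨s, hs, hs'⟩ := surjOn_iS1 (mem_univ ((extChartAt (𝓡 1) t₀).symm (κ r)))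
      refine ⟨s, ⟨?_, hs⟩, ?_⟩
      · rw [mem_preimage, hs']
        simpa using (extChartAt (𝓡 1) t₀).map_target hr
      · simp only [hs']
        rw [(extChartAt (𝓡 1) t₀).right_inv hr, κ.symm_apply_apply]
    · rintro ⟨s, hs, rfl⟩
      rw [mem_preimage, κ.apply_symm_apply]
      exact (extChartAt (𝓡 1) t₀).map_source (by simpa using hs.1)
  have hinj : InjOn (fun s => κ.symm (extChartAt (𝓡 1) t₀ (iS1 s))) P := by
    intro r hr s hs h
    refine injOn_iS1 hr.2 hs.2 ((extChartAt (𝓡 1) t₀).injOn (by simpa using hr.1)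
      (by simpa using hs.1) (κ.symm.injective h))
  rw [himg, lintegral_image_eq_lintegral_abs_deriv_mul ((hm hO).inter measurableSet_Ioc)
    (f' := fun s => circleVecCoord t₀ (iS1 s)) (fun s hs => ?_) hinj]
  · refine setLIntegral_congr_fun ((hm hO).inter measurableSet_Ioc) fun s hs => ?_
    have hs1 : iS1 s ∈ (chartAt E1 t₀).source := hs.1
    simp only [κ.apply_symm_apply]
    rw [(extChartAt (𝓡 1) t₀).left_inv (by simpa using hs1), ← mul_assoc,
      ← ENNReal.ofReal_mul (abs_nonneg _), circleDensity, ← abs_mul, circleVecCoord_mul hs1]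
    simp
  · have h1 := lineCoord.hasFDerivAt.comp_hasDerivAt s
      (hasDerivAt_extChartAt_iS1 t₀ hs.1)
    refine (h1.congr_of_eventuallyEq ?_).hasDerivWithinAt
    exact Filter.Eventually.of_forall fun r => hκs _

instance : IsProbabilityMeasure circleMeasure := by
  have : IsProbabilityMeasure (volume.restrict (Ioc (0 : ℝ) 1)) := ⟨by simp⟩
  exact Measure.isProbabilityMeasure_map continuous_iS1.measurable.aemeasurable

end CircleMeasure

theorem MeasureTheory.Measure.map_prod_map_of_aemeasurable {α β γ δ : Type*} [MeasurableSpace α]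
    [MeasurableSpace β] [MeasurableSpace γ] [MeasurableSpace δ] {f : α → β} {g : γ → δ}
    {μ : Measure α} {ν : Measure γ} [SFinite μ] [SFinite ν] (hf : AEMeasurable f μ)
    (hg : AEMeasurable g ν) :
    (μ.map f).prod (ν.map g) = (μ.prod ν).map (Prod.map f g) := by
  rw [Measure.map_congr hf.ae_eq_mk, Measure.map_congr hg.ae_eq_mk,
    Measure.map_prod_map _ _ hf.measurable_mk hg.measurable_mk]
  refine Measure.map_congr ?_
  have h1 := Measure.quasiMeasurePreserving_fst (μ := μ) (ν := ν) |>.ae_eq_comp hf.ae_eq_mk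
  have h2 := Measure.quasiMeasurePreserving_snd (μ := μ) (ν := ν) |>.ae_eq_comp hg.ae_eq_mk
  filter_upwards [h1, h2] with x hx1 hx2
  exact Prod.ext hx1.symm hx2.symm

theorem Module.Basis.det_reindex_prod_apply {W W' : Type*} [AddCommGroup W] [Module ℝ W]
    [AddCommGroup W'] [Module ℝ W'] {m n : ℕ} (b : Basis (Fin m) ℝ W) (c : Basis (Fin n) ℝ W')
    {F : Fin (m + n) → W × W'} (u : Fin m → W) (w : Fin n → W')
    (hF : F ∘ finSumFinEquiv = Sum.elim (fun i => (u i, 0)) (fun j => (0, w j))) :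
    ((b.prod c).reindex finSumFinEquiv).det F = b.det u * c.det w := by
  rw [Basis.det_reindex, hF, Basis.det_prod_apply]

section FormIntegral

local notation "E1" => EuclideanSpace ℝ (Fin 1)
local notation "E2" => EuclideanSpace ℝ (Fin 2)

variable {S : Type*} [TopologicalSpace S] [ChartedSpace (EuclideanSpace ℝ (Fin 2)) S]

section PosBasis

variable [Bundle.RiemannianBundle (fun x : S => TangentSpace (𝓡 2) x)]
  (o : (x : S) → Orientation ℝ (TangentSpace (𝓡 2) x) (Fin 2))

/-- A positive orthonormal basis of each tangent plane. -/
noncomputable def posBasis (x : S) : Basis (Fin 2) ℝ (TangentSpace (𝓡 2) x) :=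
  (o x).exists_positive_orthonormalBasis.choose

theorem posBasis_orientation (x : S) : (posBasis o x).orientation = o x :=
  (o x).exists_positive_orthonormalBasis.choose_spec.1

theorem posBasis_det (x : S) (v : Fin 2 → TangentSpace (𝓡 2) x) :
    (posBasis o x).det v = (o x).areaForm (v 0) (v 1) :=
  (o x).exists_positive_orthonormalBasis.choose_spec.2.1 v

theorem norm_posBasis_zero (x : S) : ‖posBasis o x 0‖ = 1 :=
  (o x).exists_positive_orthonormalBasis.choose_spec.2.2.1

theorem posBasis_one (x : S) : posBasis o x 1 = (o x).rightAngleRotation (posBasis o x 0) :=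
  (o x).exists_positive_orthonormalBasis.choose_spec.2.2.2

/-- The positive basis `(e₁, e₂, ∂/∂t)` of the tangent space of `Σ × S¹`. -/
noncomputable def posBasis3 (p : S × Circle) :
    Basis (Fin 3) ℝ (TangentSpace ((𝓡 2).prod (𝓡 1)) p) :=
  ((posBasis o p.1).prod (circleBasis p.2)).reindex finSumFinEquiv

theorem posBasis3_orientation (p : S × Circle) :
    (posBasis3 o p).orientation = prodOrientation o p := by
  refine Basis.orientation_prod_congr _ _ _ ?_
  rw [posBasis_orientation]
  exact ((o p.1).someBasis_orientation _).symm

end PosBasis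

theorem extChartAt_prod_target (x₀ : S) (t₀ : Circle) :
    (extChartAt ((𝓡 2).prod (𝓡 1)) (x₀, t₀)).target =
      (extChartAt (𝓡 2) x₀).target ×ˢ (extChartAt (𝓡 1) t₀).target := by
  rw [extChartAt_prod]; rfl

theorem extChartAt_prod_symm_apply (x₀ : S) (t₀ : Circle) (y : E2 × E1) :
    (extChartAt ((𝓡 2).prod (𝓡 1)) (x₀, t₀)).symm y =
      ((extChartAt (𝓡 2) x₀).symm y.1, (extChartAt (𝓡 1) t₀).symm y.2) := rfl

variable [IsManifold (𝓡 2) ∞ S]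

theorem chartFrame_prod {x₀ : S} {t₀ : Circle} {y : E2 × E1}
    (hy : y ∈ (extChartAt ((𝓡 2).prod (𝓡 1)) (x₀, t₀)).target) (v : E2 × E1) :
    (chartFrame ((𝓡 2).prod (𝓡 1)) (x₀, t₀) y v : E2 × E1) =
      (chartFrame (𝓡 2) x₀ y.1 v.1, chartFrame (𝓡 1) t₀ y.2 v.2) := by
  rw [extChartAt_prod_target] at hy
  have h1 := (mdifferentiableAt_extChartAt_symm hy.1).hasMFDerivAt
  have h2 := (mdifferentiableAt_extChartAt_symm hy.2).hasMFDerivAt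
  have h3 := h1.prodMap h2
  rw [← modelWithCornersSelf_prod] at h3
  have h4 : HasMFDerivAt 𝓘(ℝ, E2 × E1) ((𝓡 2).prod (𝓡 1))
    (extChartAt ((𝓡 2).prod (𝓡 1)) (x₀, t₀)).symm y
    ((chartFrame (𝓡 2) x₀ y.1).prodMap (chartFrame (𝓡 1) t₀ y.2)) := h3
  exact DFunLike.congr_fun h4.mfderiv v

/-- The coordinate frame of a product chart of `Σ × S¹`. -/
theorem chartFrame_stdBasis3 {x₀ : S} {t₀ : Circle} {y : E2 × E1}
    (hy : y ∈ (extChartAt ((𝓡 2).prod (𝓡 1)) (x₀, t₀)).target) (j : Fin 3) :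
    (chartFrame ((𝓡 2).prod (𝓡 1)) (x₀, t₀) y (stdBasis3 j) : E2 × E1) =
      Sum.elim (fun i => (coordField x₀ i ((extChartAt (𝓡 2) x₀).symm y.1), 0))
        (fun _ => (0, circleCoordField t₀ ((extChartAt (𝓡 1) t₀).symm y.2)))
        ((finSumFinEquiv (m := 2) (n := 1)).symm j) := by
  obtain ⟨k, rfl⟩ := (finSumFinEquiv (m := 2) (n := 1)).surjective j
  rw [chartFrame_prod hy, Equiv.symm_apply_apply]
  rw [extChartAt_prod_target] at hy
  have hb : stdBasis3 (finSumFinEquiv k) = ((EuclideanSpace.basisFun (Fin 2) ℝ).toBasis.prod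
      (EuclideanSpace.basisFun (Fin 1) ℝ).toBasis) k := by
    rw [stdBasis3, Basis.reindex_apply, Equiv.symm_apply_apply]
  rw [hb, Basis.prod_apply]
  rcases k with i | i
  · simp only [Sum.elim_inl, Function.comp_apply, LinearMap.inl_apply, map_zero]
    rw [chartFrame_basisFun hy.1]
  · obtain rfl : i = 0 := Subsingleton.elim _ _
    simp only [Sum.elim_inr, Function.comp_apply, LinearMap.inr_apply, map_zero]
    rw [chartFrame_eq_symmL hy.2, circleCoordField, OrthonormalBasis.coe_toBasis]

variable [Bundle.RiemannianBundle (fun x : S => TangentSpace (𝓡 2) x)]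
  (o : (x : S) → Orientation ℝ (TangentSpace (𝓡 2) x) (Fin 2))

theorem orientSign_mul_chartFrame {x₀ : S} {t₀ : Circle} {y : E2 × E1}
    (hy : y ∈ (extChartAt ((𝓡 2).prod (𝓡 1)) (x₀, t₀)).target) (r : ℝ)
    (η : (p : S × Circle) → TangentSpace ((𝓡 2).prod (𝓡 1)) p [⋀^Fin 3]→ₗ[ℝ] ℂ) :
    ((r * orientSign (prodOrientation o ((extChartAt ((𝓡 2).prod (𝓡 1)) (x₀, t₀)).symm y))
        (fun j => chartFrame ((𝓡 2).prod (𝓡 1)) (x₀, t₀) y (stdBasis3 j)) : ℝ) : ℂ) *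
      η ((extChartAt ((𝓡 2).prod (𝓡 1)) (x₀, t₀)).symm y)
        (fun j => chartFrame ((𝓡 2).prod (𝓡 1)) (x₀, t₀) y (stdBasis3 j)) =
    (coordDensity x₀ ((extChartAt (𝓡 2) x₀).symm y.1) *
      circleDensity t₀ ((extChartAt (𝓡 1) t₀).symm y.2)) • (r •
        η ((extChartAt ((𝓡 2).prod (𝓡 1)) (x₀, t₀)).symm y)
          (posBasis3 o ((extChartAt ((𝓡 2).prod (𝓡 1)) (x₀, t₀)).symm y))) := by
  set p := (extChartAt ((𝓡 2).prod (𝓡 1)) (x₀, t₀)).symm y with hp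
  set F : Fin 3 → TangentSpace ((𝓡 2).prod (𝓡 1)) p :=
    fun j => chartFrame ((𝓡 2).prod (𝓡 1)) (x₀, t₀) y (stdBasis3 j) with hF
  have hd : (posBasis3 o p).det F = (o p.1).areaForm (coordField x₀ 0 p.1) (coordField x₀ 1 p.1) *
      (circleBasis p.2).coord 0 (circleCoordField t₀ p.2) := by
    have hFe : F ∘ (finSumFinEquiv (m := 2) (n := 1)) = Sum.elim (fun i => (coordField x₀ i p.1, 0))
        (fun _ => (0, circleCoordField t₀ p.2)) := by
      funext k
      have := chartFrame_stdBasis3 hy (finSumFinEquiv k)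
      rw [Equiv.symm_apply_apply] at this
      exact this
    refine (Basis.det_reindex_prod_apply (posBasis o p.1) (circleBasis p.2) _ _ hFe).trans ?_
    rw [posBasis_det, Basis.det_apply (circleBasis p.2), Matrix.det_fin_one, Basis.toMatrix_apply,
      Basis.coord_apply]
  have hs := orientSign_smul_apply (posBasis3 o p) (η p) F
  rw [posBasis3_orientation, hd, abs_mul, ← coordDensity_eq_abs_areaForm] at hs
  simp only [Complex.real_smul] at hs ⊢
  rw [Complex.ofReal_mul, mul_assoc, hs]
  change _ = ((coordDensity x₀ p.1 * circleDensity t₀ p.2 : ℝ) : ℂ) * _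
  rw [circleDensity]
  ring

variable [IsContMDiffRiemannianBundle (𝓡 2) ∞ (EuclideanSpace ℝ (Fin 2))
  (fun x : S => TangentSpace (𝓡 2) x)] [T2Space S] [CompactSpace S] [MeasurableSpace S]
  [BorelSpace S]

theorem prod_restrict_source
    (o : (x : S) → Orientation ℝ (TangentSpace (𝓡 2) x) (Fin 2))
    (x₀ : S) (t₀ : Circle) :
    ((surfaceMeasure S).prod circleMeasure).restrict (chartAt (ModelProd E2 E1) (x₀, t₀)).source =
      ((volume.restrict (extChartAt ((𝓡 2).prod (𝓡 1)) (x₀, t₀)).target).withDensity fun y =>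
        ENNReal.ofReal (coordDensity x₀ ((extChartAt (𝓡 2) x₀).symm y.1) *
          circleDensity t₀ ((extChartAt (𝓡 1) t₀).symm y.2))).map
        (extChartAt ((𝓡 2).prod (𝓡 1)) (x₀, t₀)).symm := by
  have := isFiniteMeasure_surfaceMeasure o
  have hs : (chartAt (ModelProd E2 E1) (x₀, t₀)).source =
    (chartAt E2 x₀).source ×ˢ (chartAt E1 t₀).source := rfl
  rw [hs, ← Measure.prod_restrict, surfaceMeasure_restrict_source o, circleMeasure_restrict_source,
    chartMeasure]
  have h1 := aemeasurable_coordDensity_symm (S := S) x₀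
  have h2 := aemeasurable_circleDensity_symm t₀
  rw [Measure.map_prod_map_of_aemeasurable
    ((aemeasurable_extChartAt_symm x₀).mono_ac (withDensity_absolutelyContinuous _ _))
    ((aemeasurable_extChartAt_symm t₀).mono_ac (withDensity_absolutelyContinuous _ _)),
    prod_withDensity₀ h1 h2, Measure.prod_restrict, extChartAt_prod_target]
  congr 2
  funext y
  exact (ENNReal.ofReal_mul (Real.sqrt_nonneg _)).symm

theorem formIntegral_eq_integral
    {η : (p : S × Circle) → TangentSpace ((𝓡 2).prod (𝓡 1)) p [⋀^Fin 3]→ₗ[ℝ] ℂ}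
    (hη : Integrable (fun p => η p (posBasis3 o p)) ((surfaceMeasure S).prod circleMeasure)) :
    formIntegral ((𝓡 2).prod (𝓡 1)) stdBasis3 (prodOrientation o) η =
      ∫ p, η p (posBasis3 o p) ∂((surfaceMeasure S).prod circleMeasure) := by
  have := isFiniteMeasure_surfaceMeasure o
  set μ := (surfaceMeasure S).prod circleMeasure with hμ
  have hvol : stdBasis3.addHaar = volume := by
    rw [stdBasis3, Basis.addHaar_reindex, Basis.prod_addHaar, OrthonormalBasis.addHaar_eq_volume,
      OrthonormalBasis.addHaar_eq_volume]
    rfl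
  set ρ := chartPartition ((𝓡 2).prod (𝓡 1)) (S × Circle) with hρ
  have hi (p₀ : S × Circle) : Integrable (fun p => ρ p₀ p • η p (posBasis3 o p)) μ := by
    refine hη.bdd_smul 1
      (continuous_chartPartition _ _ p₀).aestronglyMeasurable (ae_of_all _ fun p => ?_)
    rw [Real.norm_eq_abs, abs_of_nonneg (ρ.nonneg _ _)]
    exact ρ.le_one _ _
  have key (p₀ : S × Circle) : ∫ y in (extChartAt ((𝓡 2).prod (𝓡 1)) p₀).target,
      ((ρ p₀ ((extChartAt ((𝓡 2).prod (𝓡 1)) p₀).symm y) *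
        orientSign (prodOrientation o ((extChartAt ((𝓡 2).prod (𝓡 1)) p₀).symm y))
          (fun j => chartFrame ((𝓡 2).prod (𝓡 1)) p₀ y (stdBasis3 j)) : ℝ) : ℂ) *
      η ((extChartAt ((𝓡 2).prod (𝓡 1)) p₀).symm y)
        (fun j => chartFrame ((𝓡 2).prod (𝓡 1)) p₀ y (stdBasis3 j)) ∂stdBasis3.addHaar =
      ∫ p, ρ p₀ p • η p (posBasis3 o p) ∂μ := by
    obtain ⟨x₀, t₀⟩ := p₀
    have hO := (chartAt (ModelProd E2 E1) (x₀, t₀)).open_source.measurableSet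
    have hT := (isOpen_extChartAt_target (I := (𝓡 2).prod (𝓡 1)) (x₀, t₀)).measurableSet
    have h0 : ∫ p, ρ (x₀, t₀) p • η p (posBasis3 o p) ∂μ =
        ∫ p in (chartAt (ModelProd E2 E1) (x₀, t₀)).source,
          ρ (x₀, t₀) p • η p (posBasis3 o p) ∂μ := by
      rw [setIntegral_eq_integral_of_forall_compl_eq_zero fun p hp => ?_]
      rw [hρ, chartPartition_eq_zero _ _ hp, zero_smul]
    have hm := (hi (x₀, t₀)).aestronglyMeasurable.restrict
      (s := (chartAt (ModelProd E2 E1) (x₀, t₀)).source)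
    rw [h0]
    rw [hμ, prod_restrict_source o] at hm ⊢
    have hd1 := ((continuousOn_coordDensity_symm x₀).comp continuousOn_fst fun y hy => hy.1).mul
      ((((continuousOn_circleDensity t₀).comp (continuousOn_extChartAt_symm t₀) fun y hy => by
        simpa using (extChartAt (𝓡 1) t₀).map_target hy)).comp
          (s := (extChartAt (𝓡 2) x₀).target ×ˢ (extChartAt (𝓡 1) t₀).target)
          continuousOn_snd fun y hy => hy.2)
    rw [← extChartAt_prod_target] at hd1
    have hd2 : AEMeasurable (fun y : E2 × E1 =>
        ENNReal.ofReal (coordDensity x₀ ((extChartAt (𝓡 2) x₀).symm y.1) *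
          circleDensity t₀ ((extChartAt (𝓡 1) t₀).symm y.2)))
        (volume.restrict (extChartAt ((𝓡 2).prod (𝓡 1)) (x₀, t₀)).target) :=
      (hd1.aemeasurable hT).ennreal_ofReal
    rw [integral_map ((aemeasurable_extChartAt_symm (x₀, t₀)).mono_ac
      (withDensity_absolutelyContinuous _ _)) hm,
      integral_withDensity_eq_integral_toReal_smul₀ hd2
        (ae_of_all _ fun _ => ENNReal.ofReal_lt_top), hvol]
    refine setIntegral_congr_fun hT fun y hy => ?_
    rw [orientSign_mul_chartFrame o hy, ENNReal.toReal_ofReal]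
    exact mul_nonneg (Real.sqrt_nonneg _) (abs_nonneg _)
  obtain ⟨F, hF, hF1⟩ := exists_finset_chartPartition ((𝓡 2).prod (𝓡 1)) (S × Circle)
  unfold formIntegral
  rw [finsum_congr key, finsum_eq_sum_of_support_subset (s := F), ← integral_finsetSum _
    fun p₀ _ => hi p₀]
  · refine integral_congr_ae (ae_of_all _ fun p => ?_)
    simp only
    rw [← Finset.sum_smul, hρ, hF1 p, one_smul]
  · intro p₀ hp₀
    by_contra h
    refine hp₀ ?_
    change ∫ p, ρ p₀ p • η p (posBasis3 o p) ∂μ = 0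
    have h0 (p : S × Circle) : ρ p₀ p = 0 := hF p₀ h p
    simp [h0]

end FormIntegral

theorem OneForm.inChart_extChartAt_apply {E : Type*} [NormedAddCommGroup E] [NormedSpace ℝ E]
    {H : Type*} [TopologicalSpace H] {I : ModelWithCorners ℝ E H} [I.Boundaryless]
    {M : Type*} [TopologicalSpace M] [ChartedSpace H M] [IsManifold I ∞ M]
    {V : Type*} [NormedAddCommGroup V] [NormedSpace ℝ V] (A : OneForm I M V) {x₀ x : M}
    (hx : x ∈ (extChartAt I x₀).source) (v : TangentSpace I x) :
    OneForm.inChart I A x₀ (extChartAt I x₀ x)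
      (mfderiv I 𝓘(ℝ, E) (extChartAt I x₀) x v) = A x v := by
  have : IsManifold I 1 M := IsManifold.of_le (n := ∞) (by simp)
  have hx' : x ∈ (chartAt H x₀).source := by simpa using hx
  have h1 : OneForm.inChart I A x₀ (extChartAt I x₀ x) =
      (A x).comp ((trivializationAt E (TangentSpace I) x₀).symmL ℝ x) := by
    rw [OneForm.inChart_eq ((extChartAt I x₀).map_source hx), (extChartAt I x₀).left_inv hx]
  have h2 := mfderivWithin_extChartAt_symm_comp_mfderiv_extChartAt' (I := I) hx
  let w : E := mfderiv I 𝓘(ℝ, E) (extChartAt I x₀) x v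
  exact (DFunLike.congr_fun h1 w).trans (congrArg (A x)
    ((DFunLike.congr_fun (TangentBundle.symmL_trivializationAt hx') w).trans
      (DFunLike.congr_fun h2 v)))

section Gluing

local notation "E2" => EuclideanSpace ℝ (Fin 2)

variable {S : Type*} [TopologicalSpace S] [ChartedSpace (EuclideanSpace ℝ (Fin 2)) S]
  {Y : Type*} [TopologicalSpace Y]

theorem continuousOn_of_lift {x₀ : S} {f : S × Circle → Y}
    {F : E2 × ℝ → Y} (hF : ContinuousOn F ((extChartAt (𝓡 2) x₀).target ×ˢ univ))
    (h : ∀ y, y ∈ (chartAt E2 x₀).source → ∀ s, f (y, iS1 s) = F (extChartAt (𝓡 2) x₀ y, s)) :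
    ContinuousOn f ((chartAt E2 x₀).source ×ˢ univ) := by
  rintro ⟨x, t⟩ ⟨hx, -⟩
  refine ContinuousAt.continuousWithinAt ?_
  obtain ⟨s, rfl⟩ := isOpenQuotientMap_iS1.surjective t
  have hQ : IsOpenQuotientMap (Prod.map id iS1 : S × ℝ → S × Circle) :=
    IsOpenQuotientMap.id.prodMap isOpenQuotientMap_iS1
  have hx' : x ∈ (extChartAt (𝓡 2) x₀).source := by simpa using hx
  change ContinuousAt f (Prod.map id iS1 (x, s))
  rw [← hQ.continuousAt_comp_iff]
  have h1 : ContinuousAt (fun p : S × ℝ => (extChartAt (𝓡 2) x₀ p.1, p.2)) (x, s) :=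
    ((continuousAt_extChartAt' hx').comp continuousAt_fst).prodMk continuousAt_snd
  have h2 : ContinuousAt F (extChartAt (𝓡 2) x₀ x, s) :=
    hF.continuousAt (((isOpen_extChartAt_target x₀).prod isOpen_univ).mem_nhds
      ⟨(extChartAt (𝓡 2) x₀).map_source hx', mem_univ _⟩)
  refine (ContinuousAt.comp (f := fun p : S × ℝ => (extChartAt (𝓡 2) x₀ p.1, p.2)) h2 h1).congr ?_
  filter_upwards [((chartAt E2 x₀).open_source.prod isOpen_univ).mem_nhds
    (show (x, s) ∈ (chartAt E2 x₀).source ×ˢ (univ : Set ℝ) from ⟨hx, mem_univ _⟩)] with q hq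
  exact (h q.1 hq.1 q.2).symm

theorem continuous_of_continuousOn_sources {f : S × Circle → Y}
    (h : ∀ x₀, ContinuousOn f ((chartAt E2 x₀).source ×ˢ univ)) : Continuous f :=
  continuous_iff_continuousAt.2 fun p => (h p.1).continuousAt
    (((chartAt E2 p.1).open_source.prod isOpen_univ).mem_nhds ⟨mem_chart_source E2 p.1, mem_univ _⟩)

end Gluing

section Families

local notation "E1" => EuclideanSpace ℝ (Fin 1)
local notation "E2" => EuclideanSpace ℝ (Fin 2)

variable {S : Type*} [TopologicalSpace S] [ChartedSpace (EuclideanSpace ℝ (Fin 2)) S]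
  {V : Type*} [NormedAddCommGroup V] [NormedSpace ℝ V]
  {V₂ : Type*} [NormedAddCommGroup V₂] [NormedSpace ℝ V₂]

/-- A family of one-forms on the surface, parametrised by the circle, that is jointly smooth. -/
def SmoothFamily (a : Circle → OneForm (𝓡 2) S V) : Prop :=
  ∀ x₀ : S, ContDiffOn ℝ ∞ (fun q : E2 × ℝ => OneForm.inChart (𝓡 2) (a (iS1 q.2)) x₀ q.1)
    ((extChartAt (𝓡 2) x₀).target ×ˢ univ)

theorem isOpen_target_prod_univ (x₀ : S) :
    IsOpen ((extChartAt (𝓡 2) x₀).target ×ˢ (univ : Set ℝ)) :=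
  (isOpen_extChartAt_target x₀).prod isOpen_univ

theorem SmoothFamily.add {a b : Circle → OneForm (𝓡 2) S V} (ha : SmoothFamily a)
    (hb : SmoothFamily b) : SmoothFamily (fun t => a t + b t) := fun x₀ =>
  ((ha x₀).add (hb x₀)).congr fun q _ => by
    ext w
    rfl

theorem SmoothFamily.contDiffOn_inChart {a : Circle → OneForm (𝓡 2) S V} (ha : SmoothFamily a)
    (t : Circle) (x₀ : S) :
    ContDiffOn ℝ ∞ (OneForm.inChart (𝓡 2) (a t) x₀) (extChartAt (𝓡 2) x₀).target := by
  obtain ⟨s, rfl⟩ := isOpenQuotientMap_iS1.surjective t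
  exact (ha x₀).comp (contDiff_prodMk_left s).contDiffOn fun y hy => ⟨hy, mem_univ _⟩

variable [IsManifold (𝓡 2) ∞ S]

theorem contDiffOn_comp_extChartAt_symm {B : S → V} (hB : ContMDiff (𝓡 2) 𝓘(ℝ, V) ∞ B) (x₀ : S) :
    ContDiffOn ℝ ∞ (B ∘ (extChartAt (𝓡 2) x₀).symm) (extChartAt (𝓡 2) x₀).target := by
  rw [← contMDiffOn_iff_contDiffOn]
  exact hB.comp_contMDiffOn (contMDiffOn_extChartAt_symm x₀)

/-- Families of one-forms multiplied by a smooth function under a bilinear pairing. -/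
theorem SmoothFamily.bilin_comp {V₁ : Type*} [NormedAddCommGroup V₁] [NormedSpace ℝ V₁]
    {a : Circle → OneForm (𝓡 2) S V} (ha : SmoothFamily a) {B : S → V₁}
    (hB : ContMDiff (𝓡 2) 𝓘(ℝ, V₁) ∞ B) (L : V₁ →L[ℝ] V →L[ℝ] V₂) :
    SmoothFamily (fun t x => (L (B x)).comp (a t x)) := fun x₀ => by
  have h1 : ContDiffOn ℝ ∞ (fun q : E2 × ℝ => L (B ((extChartAt (𝓡 2) x₀).symm q.1)))
      ((extChartAt (𝓡 2) x₀).target ×ˢ univ) :=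
    L.contDiff.comp_contDiffOn ((contDiffOn_comp_extChartAt_symm hB x₀).comp
      contDiff_fst.contDiffOn fun q hq => hq.1)
  exact h1.clm_comp (ha x₀)

theorem mfderiv_extChartAt_coordField {x₀ x : S} (hx : x ∈ (chartAt E2 x₀).source) (i : Fin 2) :
    (mfderiv (𝓡 2) 𝓘(ℝ, E2) (extChartAt (𝓡 2) x₀) x (coordField x₀ i x) : E2) =
      EuclideanSpace.basisFun (Fin 2) ℝ i := by
  have : IsManifold (𝓡 2) 1 S := IsManifold.of_le (n := ∞) (by simp)
  have hb : x ∈ (trivializationAt E2 (TangentSpace (𝓡 2)) x₀).baseSet := hx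
  rw [← TangentBundle.continuousLinearMapAt_trivializationAt hx, coordField]
  exact Bundle.Trivialization.continuousLinearMapAt_symmL _ hb _

theorem OneForm.apply_coordField (A : OneForm (𝓡 2) S V) {x₀ x : S}
    (hx : x ∈ (chartAt E2 x₀).source) (i : Fin 2) :
    A x (coordField x₀ i x) = OneForm.inChart (𝓡 2) A x₀ (extChartAt (𝓡 2) x₀ x)
      (EuclideanSpace.basisFun (Fin 2) ℝ i) := by
  rw [← OneForm.inChart_extChartAt_apply A (x₀ := x₀) (by simpa using hx)]
  exact congrArg _ (mfderiv_extChartAt_coordField hx i)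

theorem SmoothFamily.dFun {N : ℕ} {B : S → Mat N} (hB : ContMDiff (𝓡 2) 𝓘(ℝ, Mat N) ∞ B) :
    SmoothFamily (fun _ => _root_.dFun B) := fun x₀ => by
  have h1 := ((contDiffOn_comp_extChartAt_symm hB x₀).fderiv_of_isOpen
    (isOpen_extChartAt_target x₀) (m := ∞) (by simp))
  refine (h1.comp contDiff_fst.contDiffOn fun q hq => hq.1).congr fun q hq => ?_
  rw [Function.comp_apply, ← mfderiv_eq_fderiv]
  exact (mfderiv_comp q.1 (hB.mdifferentiable (by simp) _)
    (mdifferentiableAt_extChartAt_symm hq.1)).symm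

/-- The values over a point of a family of one-forms, as a curve. -/
noncomputable def timeCurve (a : Circle → OneForm (𝓡 2) S V) (x : S) :
    ℝ → E2 →L[ℝ] V :=
  fun r => a (iS1 r) x

theorem SmoothFamily.contDiff_timeCurve {a : Circle → OneForm (𝓡 2) S V} (ha : SmoothFamily a)
    (x : S) : ContDiff ℝ ∞ (timeCurve a x) := by
  have hx := mem_extChartAt_source (I := 𝓡 2) x
  let L : E2 →L[ℝ] E2 := mfderiv (𝓡 2) 𝓘(ℝ, E2) (extChartAt (𝓡 2) x) x
  let W : ℝ → E2 →L[ℝ] V := fun r =>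
    OneForm.inChart (𝓡 2) (a (iS1 r)) x (extChartAt (𝓡 2) x x)
  have hW : ContDiff ℝ ∞ W := by
    rw [← contDiffOn_univ]
    exact (ha x).comp (contDiff_prodMk_right _).contDiffOn
      fun r _ => ⟨(extChartAt (𝓡 2) x).map_source hx, mem_univ _⟩
  have he : timeCurve a x = fun r => (W r).comp L := by
    funext r
    ext1 v
    exact ((a (iS1 r)).inChart_extChartAt_apply hx v).symm
  rw [he]
  exact hW.clm_comp contDiff_const

theorem SmoothFamily.hasDerivAt {N : ℕ} {a : Circle → OneForm (𝓡 2) S (Mat N)}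
    (ha : SmoothFamily a) (x : S) (s : ℝ) :
    HasDerivAt (timeCurve a x) (ddt a (iS1 s) x) s := by
  have hd := (ha.contDiff_timeCurve x).differentiable (by simp)
  have h1 : ddt a (iS1 s) x = deriv (fun r => timeCurve a x (r + s)) 0 := by
    simp only [_root_.ddt, timeCurve, iS1_add]
    rfl
  rw [h1, deriv_comp_add_const, zero_add]
  exact (hd s).hasDerivAt

theorem SmoothFamily.hasDerivAt_inChart {N : ℕ} {a : Circle → OneForm (𝓡 2) S (Mat N)}
    (ha : SmoothFamily a) (x₀ : S) (y : E2) (s : ℝ) :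
    HasDerivAt (fun r => OneForm.inChart (𝓡 2) (a (iS1 r)) x₀ y)
      (OneForm.inChart (𝓡 2) (ddt a (iS1 s)) x₀ y) s := by
  let L : E2 →L[ℝ] E2 := chartFrame (𝓡 2) x₀ y
  exact ((ContinuousLinearMap.compL ℝ E2 E2 (Mat N)).flip L).hasFDerivAt.comp_hasDerivAt s
    (ha.hasDerivAt ((extChartAt (𝓡 2) x₀).symm y) s)

theorem SmoothFamily.ddt {N : ℕ} {a : Circle → OneForm (𝓡 2) S (Mat N)} (ha : SmoothFamily a) :
    SmoothFamily (_root_.ddt a) := fun x₀ => by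
  have ho := isOpen_target_prod_univ x₀
  have h1 := ((ha x₀).fderiv_of_isOpen ho (m := ∞) (by simp)).clm_apply
    (contDiffOn_const (c := ((0 : E2), (1 : ℝ))))
  refine h1.congr fun q hq => ?_
  have h2 := (((ha x₀).differentiableOn (by simp)).differentiableAt
    (ho.mem_nhds hq)).hasFDerivAt.comp_hasDerivAt q.2
      ((hasDerivAt_const q.2 q.1).prodMk (hasDerivAt_id q.2))
  exact (ha.hasDerivAt_inChart x₀ q.1 q.2).unique h2

theorem SmoothFamily.adB {N : ℕ} {a : Circle → OneForm (𝓡 2) S (Mat N)} (ha : SmoothFamily a)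
    {B : S → Mat N} (hB : ContMDiff (𝓡 2) 𝓘(ℝ, Mat N) ∞ B) :
    SmoothFamily (_root_.adB B a) :=
  ha.bilin_comp hB (ContinuousLinearMap.mul ℝ (Mat N) - (ContinuousLinearMap.mul ℝ (Mat N)).flip)

theorem OneForm.inChart_slice {N : ℕ} (A : OneForm ((𝓡 2).prod (𝓡 1)) (S × Circle) (Mat N))
    {x₀ : S} {t₀ : Circle} {y : E2 × E1}
    (hy : y ∈ (extChartAt ((𝓡 2).prod (𝓡 1)) (x₀, t₀)).target) :
    OneForm.inChart (𝓡 2) (A.slice ((extChartAt (𝓡 1) t₀).symm y.2)) x₀ y.1 =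
      (OneForm.inChart ((𝓡 2).prod (𝓡 1)) A (x₀, t₀) y).comp
        (ContinuousLinearMap.inl ℝ E2 E1) := by
  ext1 w
  have h := chartFrame_prod hy (w, 0)
  have h' := congrArg (A ((extChartAt ((𝓡 2).prod (𝓡 1)) (x₀, t₀)).symm y)) h
  refine Eq.trans ?_ h'.symm
  simp only [map_zero]
  rfl

theorem SmoothFamily.slice {N : ℕ} {A : OneForm ((𝓡 2).prod (𝓡 1)) (S × Circle) (Mat N)}
    (hA : IsSmoothOneForm ((𝓡 2).prod (𝓡 1)) A) : SmoothFamily A.slice := fun x₀ => by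
  rintro ⟨y, s⟩ ⟨hy, -⟩
  have hO : IsOpen (iS1 ⁻¹' (chartAt E1 (iS1 s)).source) :=
    (chartAt E1 (iS1 s)).open_source.preimage continuous_iS1
  have hsm : ContDiffOn ℝ ∞ (fun r => extChartAt (𝓡 1) (iS1 s) (iS1 r))
      (iS1 ⁻¹' (chartAt E1 (iS1 s)).source) := by
    rw [← contMDiffOn_iff_contDiffOn]
    exact (contMDiffOn_extChartAt (I := 𝓡 1) (n := ∞) (x := iS1 s)).comp contMDiff_iS1.contMDiffOn
      fun r hr => hr
  have hmaps (q : E2 × ℝ) (hq : q ∈ (extChartAt (𝓡 2) x₀).target ×ˢ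
      (iS1 ⁻¹' (chartAt E1 (iS1 s)).source)) : (q.1, extChartAt (𝓡 1) (iS1 s) (iS1 q.2)) ∈
        (extChartAt ((𝓡 2).prod (𝓡 1)) (x₀, iS1 s)).target := by
    rw [extChartAt_prod_target]
    exact ⟨hq.1, (extChartAt (𝓡 1) (iS1 s)).map_source (by simpa using hq.2)⟩
  have h1 := (((hA.contDiffOn_inChart (x₀, iS1 s)).comp
    (contDiff_fst.contDiffOn.prodMk (hsm.comp contDiff_snd.contDiffOn fun q hq => hq.2))
    hmaps).clm_comp (contDiffOn_const (c := ContinuousLinearMap.inl ℝ E2 E1)))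
  have h2 := h1.congr (f₁ := fun q : E2 × ℝ =>
      OneForm.inChart (𝓡 2) (A.slice (iS1 q.2)) x₀ q.1) fun q hq => by
    have := A.inChart_slice (hmaps q hq)
    rw [(extChartAt (𝓡 1) (iS1 s)).left_inv (by simpa using hq.2)] at this
    exact this
  have hU : (extChartAt (𝓡 2) x₀).target ×ˢ (iS1 ⁻¹' (chartAt E1 (iS1 s)).source) ∈ 𝓝 (y, s) :=
    ((isOpen_extChartAt_target x₀).prod hO).mem_nhds ⟨hy, mem_chart_source E1 (iS1 s)⟩
  exact (h2.contDiffAt hU).contDiffWithinAt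

/-- A family of one-forms on the surface, parametrised by the circle, that is jointly continuous. -/
def ContFamily (a : Circle → OneForm (𝓡 2) S V) : Prop :=
  ∀ (x₀ : S) (i : Fin 2), ContinuousOn
    (fun p : S × Circle => a p.2 p.1 (coordField x₀ i p.1)) ((chartAt E2 x₀).source ×ˢ univ)

theorem SmoothFamily.contFamily {a : Circle → OneForm (𝓡 2) S V} (ha : SmoothFamily a) :
    ContFamily a := fun x₀ i =>
  continuousOn_of_lift (F := fun q => OneForm.inChart (𝓡 2) (a (iS1 q.2)) x₀ q.1
      (EuclideanSpace.basisFun (Fin 2) ℝ i))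
    ((ha x₀).continuousOn.clm_apply continuousOn_const)
    fun _ hx s => (a (iS1 s)).apply_coordField hx i

end Families

theorem Matrix.star_trace_mul_of_skew {n : Type*} [Fintype n] {X Y : Matrix n n ℂ}
    (hX : X.conjTranspose = -X) (hY : Y.conjTranspose = -Y) :
    star (X * Y).trace = (X * Y).trace := by
  rw [← Matrix.trace_conjTranspose, Matrix.conjTranspose_mul, hX, hY, neg_mul_neg,
    Matrix.trace_mul_comm]

open scoped ComplexOrder in
theorem Matrix.re_trace_mul_self_nonpos_of_skew {n : Type*} [Fintype n] {X : Matrix n n ℂ}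
    (hX : X.conjTranspose = -X) : (X * X).trace.re ≤ 0 := by
  have h1 := (Matrix.posSemidef_conjTranspose_mul_self X).trace_nonneg
  rw [hX, Matrix.neg_mul, Matrix.trace_neg] at h1
  have := (Complex.le_def.1 h1).1
  simpa using this

section RightAngle

variable {W : Type*} [NormedAddCommGroup W] [InnerProductSpace ℝ W] [Fact (finrank ℝ W = 2)]
  (o : Orientation ℝ W (Fin 2)) {V : Type*} [NormedAddCommGroup V] [NormedSpace ℝ V]
  (L : W →L[ℝ] V) (u v : W)

theorem Orientation.areaForm_smul_neg_apply_rightAngleRotation :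
    o.areaForm u v • -L (o.rightAngleRotation u) =
      (inner ℝ u v : ℝ) • L u - (inner ℝ u u : ℝ) • L v := by
  rw [smul_neg, ← map_smul, o.areaForm_smul_rightAngleRotation, map_sub,
    map_smul, map_smul, neg_sub]

theorem Orientation.areaForm_smul_neg_apply_rightAngleRotation' :
    o.areaForm u v • -L (o.rightAngleRotation v) =
      (inner ℝ v v : ℝ) • L u - (inner ℝ u v : ℝ) • L v := by
  rw [smul_neg, ← map_smul, o.areaForm_smul_rightAngleRotation', map_sub,
    map_smul, map_smul, neg_sub]

end RightAngle

section Trace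

variable {N : ℕ} (c : ℝ)

theorem gInner_eq (X Y : Mat N) : gInner c X Y = -(traceC c (X * Y)).re := rfl

theorem traceC_mul_comm (X Y : Mat N) : traceC c (X * Y) = traceC c (Y * X) :=
  congrArg (fun z : ℂ => c • z) (Matrix.trace_mul_comm (R := ℂ) (n := Fin N) (m := Fin N) X Y)

theorem gInner_comm (X Y : Mat N) : gInner c X Y = gInner c Y X := by
  rw [gInner_eq, gInner_eq, traceC_mul_comm]

/-- The scalar product of the Lie algebra as a bilinear map. -/
noncomputable def gInnerBilin : Mat N →ₗ[ℝ] Mat N →ₗ[ℝ] ℝ :=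
  LinearMap.mk₂ ℝ (gInner c)
    (fun X Y Z => by simp only [gInner_eq, add_mul, map_add, Complex.add_re]; ring)
    (fun r X Y => by
      simp only [gInner_eq, smul_mul_assoc, map_smul, Complex.smul_re, smul_eq_mul]; ring)
    (fun X Y Z => by simp only [gInner_eq, mul_add, map_add, Complex.add_re]; ring)
    (fun r X Y => by
      simp only [gInner_eq, mul_smul_comm, map_smul, Complex.smul_re, smul_eq_mul]; ring)

theorem gInnerBilin_apply (X Y : Mat N) : gInnerBilin c X Y = gInner c X Y := rfl

theorem continuous_traceC : Continuous (traceC c : Mat N → ℂ) :=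
  (traceC c).continuous_of_finiteDimensional

theorem ContinuousOn.traceC_mul {X : Type*} [TopologicalSpace X] {s : Set X} {f g : X → Mat N}
    (hf : ContinuousOn f s) (hg : ContinuousOn g s) :
    ContinuousOn (fun x => traceC c (f x * g x)) s :=
  (continuous_traceC c).comp_continuousOn (hf.mul hg)

theorem ContinuousOn.gInner {X : Type*} [TopologicalSpace X] {s : Set X} {f g : X → Mat N}
    (hf : ContinuousOn f s) (hg : ContinuousOn g s) :
    ContinuousOn (fun x => _root_.gInner c (f x) (g x)) s := by
  simp only [gInner_eq]
  exact (Complex.continuous_re.comp_continuousOn (hf.traceC_mul c hg)).neg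

theorem traceC_mul_of_mem_uLie {X Y : Mat N} (hX : X ∈ uLie N) (hY : Y ∈ uLie N) :
    traceC c (X * Y) = ((-gInner c X Y : ℝ) : ℂ) := by
  have h1 : (starRingEnd ℂ) (traceC c (X * Y)) = traceC c (X * Y) := by
    have h2 : (starRingEnd ℂ) (Mat.tr (X * Y)) = Mat.tr (X * Y) :=
      Matrix.star_trace_mul_of_skew hX hY
    have h3 : traceC c (X * Y) = (c : ℂ) * Mat.tr (X * Y) := Complex.real_smul
    rw [h3, map_mul, Complex.conj_ofReal, h2]
  rw [gInner_eq, neg_neg]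
  exact (Complex.conj_eq_iff_re.1 h1).symm

theorem gInner_self_nonneg {c : ℝ} (hc : 0 < c) {X : Mat N} (hX : X ∈ uLie N) :
    0 ≤ gInner c X X := by
  have h3 : traceC c (X * X) = (c : ℂ) * Mat.tr (X * X) := Complex.real_smul
  rw [gInner_eq, h3, Complex.re_ofReal_mul, ← mul_neg]
  exact mul_nonneg hc.le (neg_nonneg.2 (Matrix.re_trace_mul_self_nonpos_of_skew hX))

theorem abs_gInner_le {c : ℝ} (hc : 0 < c) {X Y : Mat N} (hX : X ∈ uLie N) (hY : Y ∈ uLie N) :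
    |gInner c X Y| ≤ (gInner c X X + gInner c Y Y) / 2 := by
  have h1 := gInner_self_nonneg hc (add_mem hX hY)
  have h2 := gInner_self_nonneg hc (sub_mem hX hY)
  simp only [← gInnerBilin_apply, map_add, map_sub, LinearMap.add_apply, LinearMap.sub_apply] at *
  have h3 : gInnerBilin c Y X = gInnerBilin c X Y := gInner_comm c Y X
  rw [h3] at h1 h2
  rw [abs_le]
  constructor <;> linarith

end Trace

section FiberMetric

local notation "E2" => EuclideanSpace ℝ (Fin 2)

variable {S : Type*} [TopologicalSpace S] [ChartedSpace (EuclideanSpace ℝ (Fin 2)) S]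
  [Bundle.RiemannianBundle (fun x : S => TangentSpace (𝓡 2) x)]
  (o : (x : S) → Orientation ℝ (TangentSpace (𝓡 2) x) (Fin 2)) {N : ℕ} (c : ℝ)

/-- The bilinear form whose trace is the fibre metric. -/
noncomputable def fiberBilin (α β : OneForm (𝓡 2) S (Mat N)) (x : S) :
    TangentSpace (𝓡 2) x →ₗ[ℝ] TangentSpace (𝓡 2) x →ₗ[ℝ] ℝ :=
  (gInnerBilin c).compl₁₂ (α x).toLinearMap (β x).toLinearMap

theorem fiberInner_mul_areaForm_sq (α β : OneForm (𝓡 2) S (Mat N)) (x : S)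
    (u v : TangentSpace (𝓡 2) x) :
    fiberInner c α β x * (o x).areaForm u v ^ 2 =
      inner ℝ v v * gInner c (α x u) (β x u) -
        inner ℝ u v * (gInner c (α x u) (β x v) + gInner c (α x v) (β x u)) +
        inner ℝ u u * gInner c (α x v) (β x v) := by
  rw [Orientation.areaForm_sq]
  exact OrthonormalBasis.sum_apply_mul_gram _ (fiberBilin c α β x) u v

theorem fiberInner_eq_posBasis (α β : OneForm (𝓡 2) S (Mat N)) (x : S) :
    fiberInner c α β x = gInner c (α x (posBasis o x 0)) (β x (posBasis o x 0)) +
      gInner c (α x (posBasis o x 1)) (β x (posBasis o x 1)) := by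
  rw [posBasis_one]
  exact OrthonormalBasis.sum_apply_eq (o x) _ (fiberBilin c α β x) (norm_posBasis_zero o x)

theorem hodgeStar_apply (α : OneForm (𝓡 2) S (Mat N)) (x : S) (v : TangentSpace (𝓡 2) x) :
    hodgeStar o α x v = -α x ((o x).rightAngleRotation v) := rfl

theorem areaForm_smul_hodgeStar (α : OneForm (𝓡 2) S (Mat N)) (x : S)
    (u v : TangentSpace (𝓡 2) x) :
    (o x).areaForm u v • hodgeStar o α x u =
      (inner ℝ u v : ℝ) • α x u - (inner ℝ u u : ℝ) • α x v :=
  (o x).areaForm_smul_neg_apply_rightAngleRotation (α x) u v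

theorem areaForm_smul_hodgeStar' (α : OneForm (𝓡 2) S (Mat N)) (x : S)
    (u v : TangentSpace (𝓡 2) x) :
    (o x).areaForm u v • hodgeStar o α x v =
      (inner ℝ v v : ℝ) • α x u - (inner ℝ u v : ℝ) • α x v :=
  (o x).areaForm_smul_neg_apply_rightAngleRotation' (α x) u v

theorem fiberInner_hodgeStar (α β : OneForm (𝓡 2) S (Mat N)) (x : S) :
    fiberInner c α (hodgeStar o β) x =
      gInner c (α x (posBasis o x 1)) (β x (posBasis o x 0)) -
        gInner c (α x (posBasis o x 0)) (β x (posBasis o x 1)) := by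
  rw [fiberInner_eq_posBasis o, hodgeStar_apply, hodgeStar_apply, ← posBasis_one]
  have h : (o x).rightAngleRotation (posBasis o x 1) = -posBasis o x 0 := by
    rw [posBasis_one, (o x).rightAngleRotation_rightAngleRotation]
  rw [h, (β x).map_neg, neg_neg]
  simp only [← gInnerBilin_apply, map_neg]
  ring

variable {c} in
theorem abs_fiberInner_le (hc : 0 < c) {α β : OneForm (𝓡 2) S (Mat N)} {x : S}
    (hα : ∀ v, α x v ∈ uLie N) (hβ : ∀ v, β x v ∈ uLie N) :
    |fiberInner c α β x| ≤ (fiberInner c α α x + fiberInner c β β x) / 2 := by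
  unfold fiberInner
  rw [← Finset.sum_add_distrib, Finset.sum_div]
  exact (Finset.abs_sum_le_sum_abs _ _).trans
    (Finset.sum_le_sum fun i _ => abs_gInner_le hc (hα _) (hβ _))

variable [IsManifold (𝓡 2) ∞ S]

theorem orientSign_coordField (x₀ x : S) :
    orientSign (o x) (fun j => coordField x₀ j x) =
      Real.sign ((o x).areaForm (coordField x₀ 0 x) (coordField x₀ 1 x)) := by
  conv_lhs => rw [← posBasis_orientation o x]
  rw [orientSign_eq_sign_det, posBasis_det]

variable [IsContMDiffRiemannianBundle (𝓡 2) ∞ (EuclideanSpace ℝ (Fin 2))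
  (fun x : S => TangentSpace (𝓡 2) x)]

theorem continuousOn_areaForm_coordField
    {o : (x : S) → Orientation ℝ (TangentSpace (𝓡 2) x) (Fin 2)}
    (ho : IsOrientation (𝓡 2) (EuclideanSpace.basisFun (Fin 2) ℝ).toBasis o) (x₀ : S) :
    ContinuousOn (fun x => (o x).areaForm (coordField x₀ 0 x) (coordField x₀ 1 x))
      (chartAt E2 x₀).source := by
  have h1 : ContinuousOn (fun x => orientSign (o x) (fun j => coordField x₀ j x))
      (chartAt E2 x₀).source := by
    rw [← extChartAt_source (𝓡 2)]
    refine ((ho x₀).comp (continuousOn_extChartAt x₀)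
      fun x hx => (extChartAt (𝓡 2) x₀).map_source hx).congr fun x hx => ?_
    have h2 := fun j => chartFrame_basisFun ((extChartAt (𝓡 2) x₀).map_source hx) j
    simp only [Function.comp_apply, h2]
    rw [(extChartAt (𝓡 2) x₀).left_inv hx]
  refine (h1.mul (continuousOn_coordDensity x₀)).congr fun x hx => ?_
  rw [Pi.mul_apply, orientSign_coordField, coordDensity_eq_abs_areaForm o]
  rcases lt_trichotomy ((o x).areaForm (coordField x₀ 0 x) (coordField x₀ 1 x)) 0 with h | h | h
  · rw [Real.sign_of_neg h, abs_of_neg h]; ring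
  · rw [h]; simp
  · rw [Real.sign_of_pos h, abs_of_pos h]; ring

theorem ContFamily.continuous_fiberInner
    (o : (x : S) → Orientation ℝ (TangentSpace (𝓡 2) x) (Fin 2)) (c : ℝ)
    {a b : Circle → OneForm (𝓡 2) S (Mat N)}
    (ha : ContFamily a) (hb : ContFamily b) :
    Continuous (fun p : S × Circle => fiberInner c (a p.2) (b p.2) p.1) := by
  refine continuous_of_continuousOn_sources fun x₀ => ?_
  have hg (i j : Fin 2) (k l : Fin 2) : ContinuousOn (fun p : S × Circle =>
      inner ℝ (coordField x₀ i p.1) (coordField x₀ j p.1) *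
        gInner c (a p.2 p.1 (coordField x₀ k p.1)) (b p.2 p.1 (coordField x₀ l p.1)))
      ((chartAt E2 x₀).source ×ˢ univ) := by
    have h1 : ContinuousOn (fun p : S × Circle =>
        (inner ℝ (coordField x₀ i p.1) (coordField x₀ j p.1) : ℝ))
        ((chartAt E2 x₀).source ×ˢ univ) :=
      (continuousOn_inner_coordField x₀ i j).comp continuousOn_fst fun p hp => hp.1
    have h2 : ContinuousOn (fun p : S × Circle =>
        gInner c (a p.2 p.1 (coordField x₀ k p.1)) (b p.2 p.1 (coordField x₀ l p.1)))
        ((chartAt E2 x₀).source ×ˢ univ) := (ha x₀ k).gInner c (hb x₀ l)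
    exact h1.mul h2
  have hA : ContinuousOn (fun p : S × Circle => coordDensity x₀ p.1 ^ 2)
      ((chartAt E2 x₀).source ×ˢ univ) :=
    ((continuousOn_coordDensity x₀).comp continuousOn_fst fun p hp => hp.1).pow 2
  have h0 (p : S × Circle) (hp : p ∈ (chartAt E2 x₀).source ×ˢ (univ : Set Circle)) :
      coordDensity x₀ p.1 ^ 2 ≠ 0 := by
    rw [coordDensity_eq_abs_areaForm o]
    exact pow_ne_zero _ (abs_ne_zero.2 (areaForm_coordField_ne_zero o hp.1))
  refine ((((hg 1 1 0 0).sub ((hg 0 1 0 1).add (hg 0 1 1 0))).add (hg 0 0 1 1)).div hA h0).congr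
    fun p hp => ?_
  have h1 := fiberInner_mul_areaForm_sq o c (a p.2) (b p.2) p.1 (coordField x₀ 0 p.1)
    (coordField x₀ 1 p.1)
  have h2 : coordDensity x₀ p.1 ^ 2 =
      (o p.1).areaForm (coordField x₀ 0 p.1) (coordField x₀ 1 p.1) ^ 2 := by
    rw [coordDensity_eq_abs_areaForm o, sq_abs]
  rw [← h2] at h1
  simp only [Pi.div_apply, Pi.add_apply, Pi.sub_apply]
  rw [eq_div_iff (h0 p hp), h1]
  ring

theorem ContFamily.hodgeStar {o : (x : S) → Orientation ℝ (TangentSpace (𝓡 2) x) (Fin 2)}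
    (ho : IsOrientation (𝓡 2) (EuclideanSpace.basisFun (Fin 2) ℝ).toBasis o)
    {a : Circle → OneForm (𝓡 2) S (Mat N)} (ha : ContFamily a) :
    ContFamily (fun t => _root_.hodgeStar o (a t)) := fun x₀ => by
  have hA : ContinuousOn (fun p : S × Circle =>
      ((o p.1).areaForm (coordField x₀ 0 p.1) (coordField x₀ 1 p.1))⁻¹)
      ((chartAt E2 x₀).source ×ˢ univ) :=
    ((continuousOn_areaForm_coordField ho x₀).comp continuousOn_fst fun p hp => hp.1).inv₀
      fun p hp => areaForm_coordField_ne_zero o hp.1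
  have hg (i j : Fin 2) (k : Fin 2) : ContinuousOn (fun p : S × Circle =>
      (inner ℝ (coordField x₀ i p.1) (coordField x₀ j p.1) : ℝ) • a p.2 p.1 (coordField x₀ k p.1))
      ((chartAt E2 x₀).source ×ˢ univ) :=
    ((continuousOn_inner_coordField x₀ i j).comp continuousOn_fst fun p hp => hp.1).smul (ha x₀ k)
  have h0 := (hA.smul ((hg 0 1 0).sub (hg 0 0 1)))
  have h1 := (hA.smul ((hg 1 1 0).sub (hg 0 1 1)))
  intro i
  fin_cases i
  · refine h0.congr fun p hp => ?_
    exact eq_inv_smul_iff₀ (areaForm_coordField_ne_zero o hp.1) |>.2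
      (areaForm_smul_hodgeStar o (a p.2) p.1 _ _)
  · refine h1.congr fun p hp => ?_
    exact eq_inv_smul_iff₀ (areaForm_coordField_ne_zero o hp.1) |>.2
      (areaForm_smul_hodgeStar' o (a p.2) p.1 _ _)

end FiberMetric

section CoordinateFrames

local notation "E2" => EuclideanSpace ℝ (Fin 2)

variable {S : Type*} [TopologicalSpace S] [ChartedSpace (EuclideanSpace ℝ (Fin 2)) S]
  [IsManifold (𝓡 2) ∞ S] {V : Type*} [NormedAddCommGroup V] [NormedSpace ℝ V]

/-- The components of a tangent vector in a coordinate frame. -/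
noncomputable def coordComponent (x₀ : S) (i : Fin 2) (x : S) (v : TangentSpace (𝓡 2) x) : ℝ :=
  ((trivializationAt E2 (TangentSpace (𝓡 2)) x₀ ⟨x, v⟩).2 : E2) i

theorem sum_coordComponent_smul {x₀ x : S} (hx : x ∈ (chartAt E2 x₀).source)
    (v : TangentSpace (𝓡 2) x) :
    coordComponent x₀ 0 x v • coordField x₀ 0 x + coordComponent x₀ 1 x v • coordField x₀ 1 x =
      v := by
  have hb : x ∈ (trivializationAt E2 (TangentSpace (𝓡 2)) x₀).baseSet := hx
  let w : E2 := (trivializationAt E2 (TangentSpace (𝓡 2)) x₀).continuousLinearMapAt ℝ x v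
  have h1 : (trivializationAt E2 (TangentSpace (𝓡 2)) x₀).symmL ℝ x w = v :=
    Bundle.Trivialization.symmL_continuousLinearMapAt _ hb v
  have h2 (i : Fin 2) : coordComponent x₀ i x v = w i := by
    simp only [w]
    rw [coordComponent, Bundle.Trivialization.continuousLinearMapAt_apply,
      Bundle.Trivialization.coe_linearMapAt_of_mem _ hb]
  have h3 : w = w 0 • EuclideanSpace.basisFun (Fin 2) ℝ 0 +
      w 1 • EuclideanSpace.basisFun (Fin 2) ℝ 1 := by
    ext i; fin_cases i <;> simp
  rw [h2, h2]
  conv_rhs => rw [← h1, h3]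
  rw [map_add, map_smul, map_smul]
  rfl

theorem OneForm.apply_eq_coord (A : OneForm (𝓡 2) S V) {x₀ x : S}
    (hx : x ∈ (chartAt E2 x₀).source) (v : TangentSpace (𝓡 2) x) :
    A x v = coordComponent x₀ 0 x v • A x (coordField x₀ 0 x) +
      coordComponent x₀ 1 x v • A x (coordField x₀ 1 x) := by
  conv_lhs => rw [← sum_coordComponent_smul hx v]
  rw [map_add, map_smul, map_smul]

theorem continuousOn_coordComponent {X : (x : S) → TangentSpace (𝓡 2) x}
    (hX : Continuous (fun x => (⟨x, X x⟩ : TangentBundle (𝓡 2) S))) (x₀ : S) (i : Fin 2) :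
    ContinuousOn (fun x => coordComponent x₀ i x (X x)) (chartAt E2 x₀).source := by
  have h1 : ContinuousOn (fun x => (trivializationAt E2 (TangentSpace (𝓡 2)) x₀
      (⟨x, X x⟩ : TangentBundle (𝓡 2) S)).2) (chartAt E2 x₀).source :=
    continuous_snd.comp_continuousOn
      ((trivializationAt E2 (TangentSpace (𝓡 2) : S → Type _) x₀).continuousOn.comp
        hX.continuousOn fun x hx => by
          rw [Bundle.Trivialization.mem_source]; exact hx)
  exact (EuclideanSpace.proj (𝕜 := ℝ) i).continuous.comp_continuousOn h1

theorem ContFamily.continuous_apply {a : Circle → OneForm (𝓡 2) S V} (ha : ContFamily a)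
    {X : (x : S) → TangentSpace (𝓡 2) x}
    (hX : Continuous (fun x => (⟨x, X x⟩ : TangentBundle (𝓡 2) S))) :
    Continuous (fun p : S × Circle => a p.2 p.1 (X p.1)) := by
  refine continuous_of_continuousOn_sources fun x₀ => ?_
  have h1 (i : Fin 2) : ContinuousOn (fun p : S × Circle => coordComponent x₀ i p.1 (X p.1))
      ((chartAt E2 x₀).source ×ˢ univ) :=
    (continuousOn_coordComponent hX x₀ i).comp continuousOn_fst fun p hp => hp.1
  exact (((h1 0).smul (ha x₀ 0)).add ((h1 1).smul (ha x₀ 1))).congr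
    fun p hp => (a p.2).apply_eq_coord hp.1 _

theorem ContFamily.continuous_apply_vector {a : Circle → OneForm (𝓡 2) S V} (ha : ContFamily a)
    {x : S} (v : TangentSpace (𝓡 2) x) : Continuous (fun t => a t x v) := by
  have hx := mem_chart_source E2 x
  have h1 (i : Fin 2) : Continuous (fun t => a t x (coordField x i x)) := by
    rw [← continuousOn_univ]
    exact (ha x i).comp (f := fun t => (x, t)) (Continuous.prodMk_right x).continuousOn
      fun t _ => ⟨hx, mem_univ _⟩
  have h2 := ((h1 0).const_smul (coordComponent x 0 x v)).add
    ((h1 1).const_smul (coordComponent x 1 x v))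
  exact h2.congr fun t => ((a t).apply_eq_coord hx v).symm

variable [T2Space S] [SigmaCompactSpace S]

/-- The coordinate fields cut off by the partition of unity. -/
theorem contMDiff_chartPartition_smul_coordField (x₀ : S) (i : Fin 2) :
    ContMDiff (𝓡 2) (𝓡 2).tangent ∞ (fun x =>
      (⟨x, chartPartition (𝓡 2) S x₀ x • coordField x₀ i x⟩ : TangentBundle (𝓡 2) S)) :=
  ContMDiffOn.smul_section_of_tsupport (chartPartition (𝓡 2) S x₀).contMDiff.contMDiffOn
    (chartAt E2 x₀).open_source (tsupport_chartPartition_subset _ _ x₀)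
    (contMDiffOn_coordField x₀ i)

end CoordinateFrames

section SquareIntegrable

local notation "E2" => EuclideanSpace ℝ (Fin 2)

theorem MeasureTheory.AEStronglyMeasurable.gInner {N : ℕ} (c : ℝ) {X : Type*} [MeasurableSpace X]
    {μ : Measure X} {f g : X → Mat N} (hf : AEStronglyMeasurable f μ)
    (hg : AEStronglyMeasurable g μ) :
    AEStronglyMeasurable (fun x => _root_.gInner c (f x) (g x)) μ := by
  simp only [gInner_eq]
  exact (Complex.continuous_re.comp_aestronglyMeasurable
    ((continuous_traceC c).comp_aestronglyMeasurable (hf.mul hg))).neg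

variable {S : Type*} [TopologicalSpace S] [ChartedSpace (EuclideanSpace ℝ (Fin 2)) S]
  [IsManifold (𝓡 2) ∞ S] [Bundle.RiemannianBundle (fun x : S => TangentSpace (𝓡 2) x)]
  [IsContMDiffRiemannianBundle (𝓡 2) ∞ (EuclideanSpace ℝ (Fin 2))
    (fun x : S => TangentSpace (𝓡 2) x)] [T2Space S] [CompactSpace S] [MeasurableSpace S]
  [BorelSpace S] (o : (x : S) → Orientation ℝ (TangentSpace (𝓡 2) x) (Fin 2)) {N : ℕ} (c : ℝ)

theorem aestronglyMeasurable_fiberInner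
    (o : (x : S) → Orientation ℝ (TangentSpace (𝓡 2) x) (Fin 2)) (c : ℝ)
    {α β : OneForm (𝓡 2) S (Mat N)}
    (hα : ContFamily (fun _ => α))
    (hβ : ∀ X : (x : S) → TangentSpace (𝓡 2) x,
      ContMDiff (𝓡 2) (𝓡 2).tangent ∞ (fun x => (⟨x, X x⟩ : TangentBundle (𝓡 2) S)) →
        AEStronglyMeasurable (fun x => β x (X x)) (surfaceMeasure S)) :
    AEStronglyMeasurable (fiberInner c α β) (surfaceMeasure S) := by
  obtain ⟨F, -, hF1⟩ := exists_finset_chartPartition (𝓡 2) S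
  have hsum : fiberInner c α β = fun x =>
      ∑ x₀ ∈ F, chartPartition (𝓡 2) S x₀ x * fiberInner c α β x := by
    funext x
    rw [← Finset.sum_mul, hF1, one_mul]
  rw [hsum]
  refine Finset.aestronglyMeasurable_fun_sum F fun x₀ _ => ?_
  set U := (chartAt E2 x₀).source with hU
  have hUm : MeasurableSet U := (chartAt E2 x₀).open_source.measurableSet
  let X (i : Fin 2) (x : S) : TangentSpace (𝓡 2) x :=
    chartPartition (𝓡 2) S x₀ x • coordField x₀ i x
  have hg (i j k l : Fin 2) : AEStronglyMeasurable (fun x =>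
      (inner ℝ (coordField x₀ i x) (coordField x₀ j x) : ℝ) *
        gInner c (α x (coordField x₀ k x)) (β x (X l x))) ((surfaceMeasure S).restrict U) := by
    have h1 : ContinuousOn (fun x => α x (coordField x₀ k x)) U :=
      (hα x₀ k).comp (Continuous.prodMk_left (1 : Circle)).continuousOn
        fun x hx => ⟨hx, mem_univ _⟩
    exact ((continuousOn_inner_coordField x₀ i j).aestronglyMeasurable hUm).mul
      ((h1.aestronglyMeasurable hUm).gInner c
        (hβ _ (contMDiff_chartPartition_smul_coordField x₀ l)).restrict)
  have hA : AEStronglyMeasurable (fun x => (coordDensity x₀ x ^ 2)⁻¹)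
      ((surfaceMeasure S).restrict U) := by
    refine ContinuousOn.aestronglyMeasurable
      (((continuousOn_coordDensity x₀).pow 2).inv₀ fun x hx => ?_) hUm
    rw [Pi.pow_apply, coordDensity_eq_abs_areaForm o]
    exact pow_ne_zero _ (abs_ne_zero.2 (areaForm_coordField_ne_zero o hx))
  have hG := hA.mul (((hg 1 1 0 0).sub ((hg 0 1 0 1).add (hg 0 1 1 0))).add (hg 0 0 1 1))
  refine ((aestronglyMeasurable_indicator_iff hUm).2 hG).congr (ae_of_all _ fun x => ?_)
  by_cases hx : x ∈ U
  · rw [indicator_of_mem hx]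
    have h1 := fiberInner_mul_areaForm_sq o c α β x (coordField x₀ 0 x) (coordField x₀ 1 x)
    have h2 : coordDensity x₀ x ^ 2 =
        (o x).areaForm (coordField x₀ 0 x) (coordField x₀ 1 x) ^ 2 := by
      rw [coordDensity_eq_abs_areaForm o, sq_abs]
    have h3 (Y : Mat N) (l : Fin 2) : gInner c Y (β x (X l x)) =
        chartPartition (𝓡 2) S x₀ x * gInner c Y (β x (coordField x₀ l x)) := by
      simp only [X, ← gInnerBilin_apply]
      rw [(β x).map_smul, map_smul, smul_eq_mul]
    have h4 : (o x).areaForm (coordField x₀ 0 x) (coordField x₀ 1 x) ^ 2 ≠ 0 :=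
      pow_ne_zero _ (areaForm_coordField_ne_zero o hx)
    simp only [Pi.mul_apply, Pi.add_apply, Pi.sub_apply, h3, h2]
    rw [inv_mul_eq_iff_eq_mul₀ h4]
    linear_combination -(chartPartition (𝓡 2) S x₀ x) * h1
  · rw [indicator_of_notMem hx]
    change 0 = chartPartition (𝓡 2) S x₀ x * fiberInner c α β x
    rw [chartPartition_eq_zero _ _ hx, zero_mul]

theorem integrable_of_continuous
    (o : (x : S) → Orientation ℝ (TangentSpace (𝓡 2) x) (Fin 2))
    {Y : Type*} [NormedAddCommGroup Y] {f : S × Circle → Y}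
    (hf : Continuous f) : Integrable f ((surfaceMeasure S).prod circleMeasure) := by
  have := isFiniteMeasure_surfaceMeasure o
  have : SecondCountableTopology S := ChartedSpace.secondCountable_of_sigmaCompact E2 S
  exact hf.integrable_of_hasCompactSupport (HasCompactSupport.of_compactSpace f)

/-- Jointly continuous families of `𝔤`-valued one-forms belong to `ℋ^⊥`. -/
theorem ContFamily.memHPerp
    (o : (x : S) → Orientation ℝ (TangentSpace (𝓡 2) x) (Fin 2))
    {𝔤 : LieSubalgebra ℝ (Mat N)} (h𝔤 : 𝔤 ≤ uLie N) {c : ℝ} (hc : 0 < c)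
    {a : Circle → OneForm (𝓡 2) S (Mat N)} (ha : ContFamily a) (ha𝔤 : ∀ t x v, a t x v ∈ 𝔤) :
    MemHPerp 𝔤 c a := by
  have := isFiniteMeasure_surfaceMeasure o
  have : SecondCountableTopology S := ChartedSpace.secondCountable_of_sigmaCompact E2 S
  have hcont := ha.continuous_fiberInner o c ha
  have hconst (t : Circle) : ContFamily (fun _ => a t) := fun x₀ i =>
    (ha x₀ i).comp (continuous_fst.prodMk continuous_const).continuousOn
      fun p hp => ⟨hp.1, mem_univ _⟩
  refine ⟨fun t => ⟨ha𝔤 t, fun X hX => ?_, ?_⟩, fun β hβ => ?_, ?_⟩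
  · exact ((ha.continuous_apply hX.continuous).comp
      (Continuous.prodMk_left t)).aestronglyMeasurable
  · exact (hcont.comp
      (Continuous.prodMk_left t)).integrable_of_hasCompactSupport
      (HasCompactSupport.of_compactSpace _)
  · refine Continuous.aestronglyMeasurable ?_
    obtain ⟨C, hC⟩ := isCompact_univ.exists_bound_of_continuousOn hcont.continuousOn
    refine continuous_of_dominated (bound := fun x => (C + fiberInner c β β x) / 2)
      (fun t => aestronglyMeasurable_fiberInner o c (hconst t) hβ.aestronglyMeasurable)
      (fun t => ae_of_all _ fun x => ?_)
      (((integrable_const C).add hβ.integrable).div_const 2) (ae_of_all _ fun x => ?_)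
    · refine (abs_fiberInner_le hc (fun v => h𝔤 (ha𝔤 t x v))
        (fun v => h𝔤 (hβ.mem x v))).trans ?_
      have := (le_abs_self _).trans (hC (x, t) (mem_univ _))
      simp only at this
      linarith
    · refine continuous_finsetSum _ fun i _ => ?_
      rw [← continuousOn_univ]
      exact (ha.continuous_apply_vector _).continuousOn.gInner c continuousOn_const
  · exact (integrable_of_continuous o hcont).integral_prod_right

end SquareIntegrable

section CoordinateStokes

variable {E : Type*} [NormedAddCommGroup E] [NormedSpace ℝ E] [FiniteDimensional ℝ E]
  [MeasurableSpace E] [BorelSpace E] {V : Type*} [NormedAddCommGroup V] [NormedSpace ℝ V]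
  (μ : Measure E) [μ.IsAddHaarMeasure]

theorem integral_fderiv_apply_eq_zero {f : E → V} (hf : ContDiff ℝ 1 f)
    (hc : HasCompactSupport f) (v : E) : ∫ y, fderiv ℝ f y v ∂μ = 0 := by
  have h1 : Integrable (fun y => fderiv ℝ f y v) μ :=
    (hf.continuous_fderiv (by simp) |>.clm_apply continuous_const).integrable_of_hasCompactSupport
      (hc.fderiv_apply (𝕜 := ℝ) v)
  have h2 := integral_smul_fderiv_eq_neg_fderiv_smul_of_integrable (μ := μ) (𝕜 := ℝ)
    (f := fun _ : E => (1 : ℝ)) (g := f) (v := v) (by simp) (by simpa using h1)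
    (by simpa using hf.continuous.integrable_of_hasCompactSupport hc)
    (fun x _ => differentiableAt_const _) (fun x _ => (hf.differentiable (by simp)) x)
  simpa using h2

/-- A locally constant sign times an exact differential of a compactly supported one-form has
vanishing integral. -/
theorem setIntegral_sign_smul_curl_eq_zero {T K : Set E} (hT : IsOpen T) (hK : IsCompact K)
    (hKT : K ⊆ T) {s : E → ℝ} (hs : ContinuousOn s T) (hs1 : ∀ y ∈ T, s y = 1 ∨ s y = -1)
    {W : E → E →L[ℝ] V} (hW : ContDiffOn ℝ ∞ W T) (hW0 : ∀ y ∈ T, y ∉ K → W y = 0) (u v : E) :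
    ∫ y in T, s y • (fderiv ℝ W y u v - fderiv ℝ W y v u) ∂μ = 0 := by
  classical
  set G : E → E →L[ℝ] V := T.indicator fun y => s y • W y with hG
  have hGT (y : E) (hy : y ∈ T) : G =ᶠ[𝓝 y] fun z => s y • W z := by
    have h1 : ∀ᶠ z in 𝓝 y, s z ∈ Metric.ball (s y) 1 :=
      (hs.continuousAt (hT.mem_nhds hy)) (Metric.ball_mem_nhds _ one_pos)
    filter_upwards [h1, hT.mem_nhds hy] with z hz hzT
    rw [hG, indicator_of_mem hzT]
    congr 1
    rw [Metric.mem_ball, Real.dist_eq] at hz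
    rcases hs1 y hy with h | h <;> rcases hs1 z hzT with h' | h' <;> rw [h, h'] at hz ⊢ <;>
      norm_num at hz
  have hGK (y : E) (hy : y ∉ K) : G y = 0 := by
    by_cases hyT : y ∈ T
    · rw [hG, indicator_of_mem hyT, hW0 y hyT hy, smul_zero]
    · rw [hG, indicator_of_notMem hyT]
  have hGc : HasCompactSupport G := HasCompactSupport.intro hK hGK
  have hGs : ContDiff ℝ 1 G := by
    rw [contDiff_iff_contDiffAt]
    intro y
    by_cases hy : y ∈ T
    · have h1 : ContDiffAt ℝ 1 (fun z => s y • W z) y :=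
        ((hW.contDiffAt (hT.mem_nhds hy)).of_le (by simp)).const_smul (s y)
      exact h1.congr_of_eventuallyEq (hGT y hy)
    · refine (contDiffAt_const (c := (0 : E →L[ℝ] V))).congr_of_eventuallyEq ?_
      filter_upwards [hK.isClosed.isOpen_compl.mem_nhds fun h => hy (hKT h)] with z hz
      exact hGK z hz
  have hint (u v : E) : ∫ y, fderiv ℝ G y u v ∂μ = 0 ∧
      Integrable (fun y => fderiv ℝ G y u v) μ := by
    have h1 (y : E) : fderiv ℝ G y u v = fderiv ℝ (fun z => G z v) y u := by
      rw [fderiv_clm_apply (hGs.differentiable (by simp) y) (differentiableAt_const v)]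
      simp
    have h2 : ContDiff ℝ 1 (fun z => G z v) := hGs.clm_apply contDiff_const
    have h3 : HasCompactSupport (fun z => G z v) :=
      HasCompactSupport.intro hK fun y hy => by rw [hGK y hy]; rfl
    simp only [h1]
    exact ⟨integral_fderiv_apply_eq_zero μ h2 h3 u,
      (h2.continuous_fderiv (by simp) |>.clm_apply
        continuous_const).integrable_of_hasCompactSupport (h3.fderiv_apply (𝕜 := ℝ) u)⟩
  have h4 : ∫ y, (fderiv ℝ G y u v - fderiv ℝ G y v u) ∂μ = 0 := by
    rw [integral_sub (hint u v).2 (hint v u).2, (hint u v).1, (hint v u).1, sub_zero]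
  have h7 : ∫ y in T, (fderiv ℝ G y u v - fderiv ℝ G y v u) ∂μ =
      ∫ y, (fderiv ℝ G y u v - fderiv ℝ G y v u) ∂μ := by
    refine setIntegral_eq_integral_of_forall_compl_eq_zero fun y hy => ?_
    have h6 : G =ᶠ[𝓝 y] fun _ => 0 := by
      filter_upwards [hK.isClosed.isOpen_compl.mem_nhds fun h => hy (hKT h)] with z hz
      exact hGK z hz
    rw [h6.fderiv_eq]
    simp
  rw [← h4, ← h7]
  refine setIntegral_congr_fun hT.measurableSet fun y hy => ?_
  have h5 : fderiv ℝ G y = s y • fderiv ℝ W y := by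
    rw [(hGT y hy).fderiv_eq]
    exact (((hW.differentiableOn (by simp)).differentiableAt
      (hT.mem_nhds hy)).hasFDerivAt.const_smul (s y)).fderiv
  simp only [h5]
  simp [smul_sub]

end CoordinateStokes

section SurfaceStokes

local notation "E2" => EuclideanSpace ℝ (Fin 2)

variable {S : Type*} [TopologicalSpace S] [ChartedSpace (EuclideanSpace ℝ (Fin 2)) S]
  {V : Type*} [NormedAddCommGroup V] [NormedSpace ℝ V]

theorem areaForm_smul_apply_posBasis [Bundle.RiemannianBundle (fun x : S => TangentSpace (𝓡 2) x)]
    (o : (x : S) → Orientation ℝ (TangentSpace (𝓡 2) x) (Fin 2)) {x : S}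
    (f : TangentSpace (𝓡 2) x [⋀^Fin 2]→ₗ[ℝ] V)
    (u v : TangentSpace (𝓡 2) x) : (o x).areaForm u v • f (posBasis o x) = f ![u, v] := by
  rw [f.apply_eq_basis_det_smul (posBasis o x) ![u, v], posBasis_det]
  rfl

variable [IsManifold (𝓡 2) ∞ S]

theorem OneForm.d_coordField {A : OneForm (𝓡 2) S V} {x₀ x : S}
    (hx : x ∈ (chartAt E2 x₀).source)
    (hA : DifferentiableAt ℝ (OneForm.inChart (𝓡 2) A x₀) (extChartAt (𝓡 2) x₀ x)) :
    OneForm.d (𝓡 2) A x ![coordField x₀ 0 x, coordField x₀ 1 x] =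
      fderiv ℝ (OneForm.inChart (𝓡 2) A x₀) (extChartAt (𝓡 2) x₀ x)
        (EuclideanSpace.basisFun (Fin 2) ℝ 0) (EuclideanSpace.basisFun (Fin 2) ℝ 1) -
      fderiv ℝ (OneForm.inChart (𝓡 2) A x₀) (extChartAt (𝓡 2) x₀ x)
        (EuclideanSpace.basisFun (Fin 2) ℝ 1) (EuclideanSpace.basisFun (Fin 2) ℝ 0) := by
  refine (OneForm.d_apply_of_mem_source (by simpa using hx) hA _).trans ?_
  have h := mfderiv_extChartAt_coordField hx
  exact congrArg₂ (fun a b : E2 =>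
    fderiv ℝ (OneForm.inChart (𝓡 2) A x₀) (extChartAt (𝓡 2) x₀ x) a b -
      fderiv ℝ (OneForm.inChart (𝓡 2) A x₀) (extChartAt (𝓡 2) x₀ x) b a) (h 0) (h 1)

variable [Bundle.RiemannianBundle (fun x : S => TangentSpace (𝓡 2) x)]
  {o : (x : S) → Orientation ℝ (TangentSpace (𝓡 2) x) (Fin 2)}

variable [IsContMDiffRiemannianBundle (𝓡 2) ∞ (EuclideanSpace ℝ (Fin 2))
    (fun x : S => TangentSpace (𝓡 2) x)]

theorem SmoothFamily.continuous_d {a : Circle → OneForm (𝓡 2) S V} (ha : SmoothFamily a)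
    (ho : IsOrientation (𝓡 2) (EuclideanSpace.basisFun (Fin 2) ℝ).toBasis o) :
    Continuous (fun p : S × Circle => OneForm.d (𝓡 2) (a p.2) p.1 (posBasis o p.1)) := by
  refine continuous_of_continuousOn_sources fun x₀ => ?_
  have hA : ContinuousOn (fun p : S × Circle =>
      ((o p.1).areaForm (coordField x₀ 0 p.1) (coordField x₀ 1 p.1))⁻¹)
      ((chartAt E2 x₀).source ×ˢ univ) :=
    ((continuousOn_areaForm_coordField ho x₀).comp continuousOn_fst fun p hp => hp.1).inv₀
      fun p hp => areaForm_coordField_ne_zero o hp.1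
  have hT := isOpen_target_prod_univ x₀
  have hD : ContinuousOn (fun q : E2 × ℝ =>
      fderiv ℝ (OneForm.inChart (𝓡 2) (a (iS1 q.2)) x₀) q.1)
      ((extChartAt (𝓡 2) x₀).target ×ˢ univ) := by
    have h1 := ((ha x₀).continuousOn_fderiv_of_isOpen hT (by simp)).clm_comp
      (continuousOn_const (c := ContinuousLinearMap.inl ℝ E2 ℝ))
    refine h1.congr fun q hq => ?_
    have h2 := HasFDerivAt.comp (f := fun y : E2 => (y, q.2)) q.1
      (((ha x₀).differentiableOn (by simp)).differentiableAt (hT.mem_nhds hq)).hasFDerivAt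
      (hasFDerivAt_prodMk_left q.1 q.2)
    exact h2.fderiv
  have hd (i j : Fin 2) : ContinuousOn (fun q : E2 × ℝ =>
      fderiv ℝ (OneForm.inChart (𝓡 2) (a (iS1 q.2)) x₀) q.1 (EuclideanSpace.basisFun (Fin 2) ℝ i)
        (EuclideanSpace.basisFun (Fin 2) ℝ j)) ((extChartAt (𝓡 2) x₀).target ×ˢ univ) :=
    (hD.clm_apply continuousOn_const).clm_apply continuousOn_const
  have h3 : ContinuousOn (fun p : S × Circle =>
      OneForm.d (𝓡 2) (a p.2) p.1 ![coordField x₀ 0 p.1, coordField x₀ 1 p.1])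
      ((chartAt E2 x₀).source ×ˢ univ) := by
    refine continuousOn_of_lift ((hd 0 1).sub (hd 1 0)) fun x hx s => ?_
    refine OneForm.d_coordField hx ?_
    have hx' : x ∈ (extChartAt (𝓡 2) x₀).source := by simpa using hx
    exact (((ha.contDiffOn_inChart _ x₀).differentiableOn (by simp)).differentiableAt
      ((isOpen_extChartAt_target x₀).mem_nhds ((extChartAt (𝓡 2) x₀).map_source hx')))
  refine (hA.smul h3).congr fun p hp => ?_
  exact (eq_inv_smul_iff₀ (areaForm_coordField_ne_zero o hp.1)).2
    (areaForm_smul_apply_posBasis o _ _ _)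

variable [T2Space S] [CompactSpace S] [MeasurableSpace S] [BorelSpace S]

/-- Stokes' theorem on the closed oriented surface. -/
theorem integral_d_posBasis_eq_zero
    (ho : IsOrientation (𝓡 2) (EuclideanSpace.basisFun (Fin 2) ℝ).toBasis o)
    {a : Circle → OneForm (𝓡 2) S V} (ha : SmoothFamily a) (t : Circle) :
    ∫ x, OneForm.d (𝓡 2) (a t) x (posBasis o x) ∂(surfaceMeasure S) = 0 := by
  obtain ⟨F, -, hF1⟩ := exists_finset_chartPartition (𝓡 2) S
  let ρ := chartPartition (𝓡 2) S
  let b (x₀ : S) : Circle → OneForm (𝓡 2) S V := fun t x => ρ x₀ x • a t x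
  have hb (x₀ : S) : SmoothFamily (b x₀) := by
    have h1 := ha.bilin_comp (ρ x₀).contMDiff
      (ContinuousLinearMap.lsmul ℝ ℝ : ℝ →L[ℝ] V →L[ℝ] V)
    have h2 : b x₀ = fun t x => (ContinuousLinearMap.lsmul ℝ ℝ (ρ x₀ x)).comp (a t x) := by
      funext t x
      ext v
      rfl
    rw [h2]
    exact h1
  have hdiff {f : Circle → OneForm (𝓡 2) S V} (hf : SmoothFamily f) {x₀ x : S}
      (hx : x ∈ (chartAt E2 x₀).source) :
      DifferentiableAt ℝ (OneForm.inChart (𝓡 2) (f t) x₀) (extChartAt (𝓡 2) x₀ x) :=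
    ((hf.contDiffOn_inChart t x₀).differentiableOn (by simp)).differentiableAt
      ((isOpen_extChartAt_target x₀).mem_nhds
        ((extChartAt (𝓡 2) x₀).map_source (by simpa using hx)))
  have hbW (x₀ x : S) (y : E2) : OneForm.inChart (𝓡 2) (b x₀ t) x y =
      ρ x₀ ((extChartAt (𝓡 2) x).symm y) • OneForm.inChart (𝓡 2) (a t) x y := by
    ext v; rfl
  have hsum (x : S) : OneForm.d (𝓡 2) (a t) x (posBasis o x) =
      ∑ x₀ ∈ F, OneForm.d (𝓡 2) (b x₀ t) x (posBasis o x) := by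
    have hx := mem_extChartAt_source (I := 𝓡 2) x
    have hx' := mem_chart_source E2 x
    have h1 : OneForm.inChart (𝓡 2) (a t) x = fun y =>
        ∑ x₀ ∈ F, OneForm.inChart (𝓡 2) (b x₀ t) x y := by
      funext y
      simp only [hbW]
      rw [← Finset.sum_smul, hF1, one_smul]
    have h3 := fun x₀ => (hdiff (hb x₀) hx')
    rw [OneForm.d_apply_of_mem_source hx (hdiff ha hx'),
      Finset.sum_congr rfl fun x₀ _ => OneForm.d_apply_of_mem_source hx (h3 x₀) (posBasis o x),
      Finset.sum_sub_distrib, h1, fderiv_fun_sum fun x₀ _ => h3 x₀]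
    have h4 (L : S → E2 →L[ℝ] E2 →L[ℝ] V) (u w : E2) :
        (∑ i ∈ F, L i) u w = ∑ i ∈ F, L i u w := by simp
    exact congrArg₂ (· - ·) (h4 _ _ _) (h4 _ _ _)
  have hint (x₀ : S) : Integrable (fun x => OneForm.d (𝓡 2) (b x₀ t) x (posBasis o x))
      (surfaceMeasure S) := by
    have := isFiniteMeasure_surfaceMeasure o
    have : SecondCountableTopology S := ChartedSpace.secondCountable_of_sigmaCompact E2 S
    exact (((hb x₀).continuous_d ho).comp
      (Continuous.prodMk_left t)).integrable_of_hasCompactSupport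
      (HasCompactSupport.of_compactSpace _)
  simp only [hsum]
  rw [integral_finsetSum _ fun x₀ _ => hint x₀]
  refine Finset.sum_eq_zero fun x₀ _ => ?_
  have hO := (chartAt E2 x₀).open_source.measurableSet
  have hT := isOpen_extChartAt_target (I := 𝓡 2) x₀
  have hzero (x : S) (hx : x ∉ (chartAt E2 x₀).source) :
      OneForm.d (𝓡 2) (b x₀ t) x (posBasis o x) = 0 := by
    have hx0 : x ∉ tsupport (ρ x₀) := fun h => hx (tsupport_chartPartition_subset _ _ x₀ h)
    have hxs := mem_extChartAt_source (I := 𝓡 2) x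
    have h1 : ∀ᶠ z in 𝓝 x, ρ x₀ z = 0 := by
      filter_upwards [(isClosed_tsupport _).isOpen_compl.mem_nhds hx0] with z hz
      exact image_eq_zero_of_notMem_tsupport hz
    have h2 : OneForm.inChart (𝓡 2) (b x₀ t) x =ᶠ[𝓝 (extChartAt (𝓡 2) x x)] fun _ => 0 := by
      have h3 := (continuousAt_extChartAt_symm (I := 𝓡 2) x)
      rw [ContinuousAt, (extChartAt (𝓡 2) x).left_inv hxs] at h3
      filter_upwards [h3.eventually h1] with y hy
      rw [hbW, hy, zero_smul]
    have h4 {L : E2 →L[ℝ] E2 →L[ℝ] V} (hL : L = 0) (u w : E2) : L u w - L w u = 0 := by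
      simp [hL]
    rw [OneForm.d_apply_of_mem_source hxs (hdiff (hb x₀) (mem_chart_source E2 x))]
    exact h4 (by rw [h2.fderiv_eq]; simp) _ _
  have hm := (hint x₀).aestronglyMeasurable.restrict (s := (chartAt E2 x₀).source)
  rw [← setIntegral_eq_integral_of_forall_compl_eq_zero hzero]
  rw [surfaceMeasure_restrict_source o, chartMeasure] at hm ⊢
  rw [integral_map ((aemeasurable_extChartAt_symm x₀).mono_ac
      (withDensity_absolutelyContinuous _ _)) hm,
    integral_withDensity_eq_integral_toReal_smul₀ (aemeasurable_coordDensity_symm x₀)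
      (ae_of_all _ fun _ => ENNReal.ofReal_lt_top)]
  have hKc : IsCompact (extChartAt (𝓡 2) x₀ '' tsupport (ρ x₀)) :=
    (isClosed_tsupport _).isCompact.image_of_continuousOn ((continuousOn_extChartAt x₀).mono
      fun x hx => by simpa using tsupport_chartPartition_subset _ _ x₀ hx)
  have hKT : extChartAt (𝓡 2) x₀ '' tsupport (ρ x₀) ⊆ (extChartAt (𝓡 2) x₀).target := by
    rintro _ ⟨x, hx, rfl⟩
    exact (extChartAt (𝓡 2) x₀).map_source
      (by simpa using tsupport_chartPartition_subset _ _ x₀ hx)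
  have hsrc (y : E2) (hy : y ∈ (extChartAt (𝓡 2) x₀).target) :
      (extChartAt (𝓡 2) x₀).symm y ∈ (chartAt E2 x₀).source := by
    simpa using (extChartAt (𝓡 2) x₀).map_target hy
  let s (y : E2) : ℝ := orientSign (o ((extChartAt (𝓡 2) x₀).symm y)) (fun j =>
    chartFrame (𝓡 2) x₀ y ((EuclideanSpace.basisFun (Fin 2) ℝ).toBasis j))
  have hs (y : E2) (hy : y ∈ (extChartAt (𝓡 2) x₀).target) :
      s y = Real.sign ((o ((extChartAt (𝓡 2) x₀).symm y)).areaForm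
        (coordField x₀ 0 ((extChartAt (𝓡 2) x₀).symm y))
        (coordField x₀ 1 ((extChartAt (𝓡 2) x₀).symm y))) := by
    rw [← orientSign_coordField]
    simp only [s, chartFrame_basisFun hy]
  rw [← setIntegral_sign_smul_curl_eq_zero (volume : Measure E2) hT hKc hKT (ho x₀) (s := s)
    (W := OneForm.inChart (𝓡 2) (b x₀ t) x₀) (fun y hy => ?_) ((hb x₀).contDiffOn_inChart t x₀)
    (fun y hy hyK => ?_) (EuclideanSpace.basisFun (Fin 2) ℝ 0)
      (EuclideanSpace.basisFun (Fin 2) ℝ 1)]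
  · refine setIntegral_congr_fun hT.measurableSet fun y hy => ?_
    have hy' := hsrc y hy
    have h1 := OneForm.d_coordField hy' (hdiff (hb x₀) hy')
    rw [(extChartAt (𝓡 2) x₀).right_inv hy] at h1
    rw [← h1, ← areaForm_smul_apply_posBasis o, smul_smul, hs y hy,
      coordDensity_eq_abs_areaForm o, ENNReal.toReal_ofReal (abs_nonneg _)]
    congr 1
    rcases lt_trichotomy ((o ((extChartAt (𝓡 2) x₀).symm y)).areaForm
        (coordField x₀ 0 ((extChartAt (𝓡 2) x₀).symm y))
        (coordField x₀ 1 ((extChartAt (𝓡 2) x₀).symm y))) 0 with h | h | h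
    · rw [Real.sign_of_neg h, abs_of_neg h]; ring
    · rw [h]; simp
    · rw [Real.sign_of_pos h, abs_of_pos h]; ring
  · rw [hs y hy]
    exact (Real.sign_apply_eq_of_ne_zero _
      (areaForm_coordField_ne_zero o (hsrc y hy))).symm.imp id id
  · have h1 : ρ x₀ ((extChartAt (𝓡 2) x₀).symm y) = 0 := by
      refine image_eq_zero_of_notMem_tsupport fun h => hyK ⟨_, h, ?_⟩
      exact (extChartAt (𝓡 2) x₀).right_inv hy
    rw [hbW, h1, zero_smul]

end SurfaceStokes

theorem HasDerivAt.clm_apply_const {F G : Type*} [NormedAddCommGroup F] [NormedSpace ℝ F]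
    [NormedAddCommGroup G] [NormedSpace ℝ G] {f : ℝ → F →L[ℝ] G} {f' : F →L[ℝ] G} {s : ℝ}
    (h : HasDerivAt f f' s) (v : F) : HasDerivAt (fun r => f r v) (f' v) s := by
  simpa using h.clm_apply (hasDerivAt_const s v)

section CircleForm

local notation "E1" => EuclideanSpace ℝ (Fin 1)
local notation "E2" => EuclideanSpace ℝ (Fin 2)

theorem hasDerivAt_extChartAt_iS1_mul (t₀ : Circle) {t : Circle} (ht : t ∈ (chartAt E1 t₀).source) :
    HasDerivAt (fun r => extChartAt (𝓡 1) t₀ (iS1 r * t))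
      (mfderiv (𝓡 1) 𝓘(ℝ, E1) (extChartAt (𝓡 1) t₀) t (circleVec t) : E1) 0 := by
  obtain ⟨s, rfl⟩ := isOpenQuotientMap_iS1.surjective t
  have h := hasDerivAt_extChartAt_iS1 t₀ ht
  have h' := HasDerivAt.comp_add_const 0 s (by rw [zero_add]; exact h)
  simp only [iS1_add] at h'
  exact h'

theorem contDiffOn_circleVecCoord (t₀ : Circle) :
    ContDiffOn ℝ ∞ (fun z => circleVecCoord t₀ ((extChartAt (𝓡 1) t₀).symm z))
      (extChartAt (𝓡 1) t₀).target := by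
  let P : E1 × ℝ → E1 := fun q => extChartAt (𝓡 1) t₀ (iS1 q.2 * (extChartAt (𝓡 1) t₀).symm q.1)
  let m : E1 × ℝ → Circle := fun q => iS1 q.2 * (extChartAt (𝓡 1) t₀).symm q.1
  have hT : IsOpen ((extChartAt (𝓡 1) t₀).target ×ˢ (univ : Set ℝ)) :=
    (isOpen_extChartAt_target t₀).prod isOpen_univ
  have hm : ContMDiffOn 𝓘(ℝ, E1 × ℝ) (𝓡 1) ∞ m ((extChartAt (𝓡 1) t₀).target ×ˢ univ) :=
    (contMDiff_iS1.comp contDiff_snd.contMDiff).contMDiffOn.mul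
      ((contMDiffOn_extChartAt_symm (I := 𝓡 1) (n := ∞) t₀).comp contDiff_fst.contMDiff.contMDiffOn
        fun q hq => hq.1)
  have hO : IsOpen ((extChartAt (𝓡 1) t₀).target ×ˢ univ ∩ m ⁻¹' (chartAt E1 t₀).source) :=
    hm.continuousOn.isOpen_inter_preimage hT (chartAt E1 t₀).open_source
  have hP : ContDiffOn ℝ ∞ P
      ((extChartAt (𝓡 1) t₀).target ×ˢ univ ∩ m ⁻¹' (chartAt E1 t₀).source) := by
    rw [← contMDiffOn_iff_contDiffOn]
    exact (contMDiffOn_extChartAt (I := 𝓡 1) (n := ∞) (x := t₀)).comp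
      (hm.mono inter_subset_left) fun q hq => hq.2
  have hz (z : E1) (hz : z ∈ (extChartAt (𝓡 1) t₀).target) :
      (z, (0 : ℝ)) ∈ (extChartAt (𝓡 1) t₀).target ×ˢ univ ∩ m ⁻¹' (chartAt E1 t₀).source := by
    refine ⟨⟨hz, mem_univ _⟩, ?_⟩
    simpa [m, iS1_zero] using (extChartAt (𝓡 1) t₀).map_target hz
  have h1 := (hP.fderiv_of_isOpen hO (m := ∞) (by simp)).clm_apply
    (contDiffOn_const (c := ((0 : E1), (1 : ℝ))))
  have h2 := lineCoord.contDiff.comp_contDiffOn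
    (h1.comp (contDiff_prodMk_left (0 : ℝ)).contDiffOn hz)
  refine h2.congr fun z hz' => ?_
  have h3 := HasFDerivAt.comp_hasDerivAt (f := fun r : ℝ => (z, r)) 0
    ((hP.differentiableOn (by simp)).differentiableAt (hO.mem_nhds (hz z hz'))).hasFDerivAt
      ((hasDerivAt_const (0 : ℝ) z).prodMk (hasDerivAt_id (0 : ℝ)))
  have h4 := hasDerivAt_extChartAt_iS1_mul t₀ (t := (extChartAt (𝓡 1) t₀).symm z)
    (by simpa using (extChartAt (𝓡 1) t₀).map_target hz')
  exact congrArg lineCoord (h4.unique h3)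

theorem circleVecCoord_ne_zero {t₀ t : Circle} (ht : t ∈ (chartAt E1 t₀).source) :
    circleVecCoord t₀ t ≠ 0 := fun h => by
  have := circleVecCoord_mul ht
  rw [h, zero_mul] at this
  exact zero_ne_one this

theorem circleDt_chartFrame {t₀ : Circle} {z : E1} (hz : z ∈ (extChartAt (𝓡 1) t₀).target)
    (w : E1) :
    circleDt ((extChartAt (𝓡 1) t₀).symm z) (chartFrame (𝓡 1) t₀ z w) =
      (circleVecCoord t₀ ((extChartAt (𝓡 1) t₀).symm z))⁻¹ * lineCoord w := by
  have ht : (extChartAt (𝓡 1) t₀).symm z ∈ (chartAt E1 t₀).source := by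
    simpa using (extChartAt (𝓡 1) t₀).map_target hz
  have h1 : chartFrame (𝓡 1) t₀ z w =
      lineCoord w • circleCoordField t₀ ((extChartAt (𝓡 1) t₀).symm z) := by
    rw [chartFrame_eq_symmL hz, circleCoordField, ← map_smul, lineCoord_smul_basisFun]
  rw [h1, map_smul, smul_eq_mul, mul_comm]
  congr 1
  exact eq_inv_of_mul_eq_one_right (circleVecCoord_mul ht)

theorem chartFrame_mfderiv_circleVec (t : Circle) :
    chartFrame (𝓡 1) t (extChartAt (𝓡 1) t t)
      (mfderiv (𝓡 1) 𝓘(ℝ, E1) (extChartAt (𝓡 1) t) t (circleVec t)) = (circleVec t : E1) := by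
  have ht := mem_extChartAt_source (I := 𝓡 1) t
  have ht' := mem_chart_source E1 t
  have h1 : chartFrame (𝓡 1) t (extChartAt (𝓡 1) t t) =
      (trivializationAt E1 (TangentSpace (𝓡 1)) t).symmL ℝ t := by
    rw [chartFrame_eq_symmL ((extChartAt (𝓡 1) t).map_source ht), (extChartAt (𝓡 1) t).left_inv ht]
  have h2 := mfderivWithin_extChartAt_symm_comp_mfderiv_extChartAt' (I := 𝓡 1) ht
  let w : E1 := mfderiv (𝓡 1) 𝓘(ℝ, E1) (extChartAt (𝓡 1) t) t (circleVec t)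
  exact (DFunLike.congr_fun h1 w).trans
    ((DFunLike.congr_fun (TangentBundle.symmL_trivializationAt ht') w).trans
      (DFunLike.congr_fun h2 (circleVec t)))

variable {S : Type*} [TopologicalSpace S] [ChartedSpace (EuclideanSpace ℝ (Fin 2)) S]
  {N : ℕ}

theorem mulDt_apply (f : S × Circle → Mat N) (x : S) (t : Circle) (a : E2) (b : E1) :
    mulDt f (x, t) ((a, b) : E2 × E1) = circleDt t b • f (x, t) := rfl

variable [IsManifold (𝓡 2) ∞ S]

theorem inChart_mulDt (f : S × Circle → Mat N) {x₀ : S} {t₀ : Circle} {y : E2 × E1}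
    (hy : y ∈ (extChartAt ((𝓡 2).prod (𝓡 1)) (x₀, t₀)).target) (v : E2 × E1) :
    OneForm.inChart ((𝓡 2).prod (𝓡 1)) (mulDt f) (x₀, t₀) y v =
      ((circleVecCoord t₀ ((extChartAt (𝓡 1) t₀).symm y.2))⁻¹ * lineCoord v.2) •
        f ((extChartAt (𝓡 2) x₀).symm y.1, (extChartAt (𝓡 1) t₀).symm y.2) := by
  have hy2 : y.2 ∈ (extChartAt (𝓡 1) t₀).target := by
    rw [extChartAt_prod_target] at hy; exact hy.2
  have h := congrArg (mulDt f ((extChartAt (𝓡 2) x₀).symm y.1, (extChartAt (𝓡 1) t₀).symm y.2))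
    (chartFrame_prod hy v)
  have h' := mulDt_apply f ((extChartAt (𝓡 2) x₀).symm y.1) ((extChartAt (𝓡 1) t₀).symm y.2)
    (chartFrame (𝓡 2) x₀ y.1 v.1) (chartFrame (𝓡 1) t₀ y.2 v.2)
  exact h.trans (h'.trans (congrArg (· • _) (circleDt_chartFrame hy2 v.2)))

theorem contDiffOn_inChart_mulDt {B : S → Mat N} (hB : ContMDiff (𝓡 2) 𝓘(ℝ, Mat N) ∞ B) (x₀ : S)
    (t₀ : Circle) : ContDiffOn ℝ ∞
      (OneForm.inChart ((𝓡 2).prod (𝓡 1)) (mulDt fun p => B p.1) (x₀, t₀))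
      (extChartAt ((𝓡 2).prod (𝓡 1)) (x₀, t₀)).target := by
  have h1 : ContDiffOn ℝ ∞ (fun y : E2 × E1 =>
      (circleVecCoord t₀ ((extChartAt (𝓡 1) t₀).symm y.2))⁻¹)
      (extChartAt ((𝓡 2).prod (𝓡 1)) (x₀, t₀)).target := by
    rw [extChartAt_prod_target]
    refine ((contDiffOn_circleVecCoord t₀).comp contDiff_snd.contDiffOn fun y hy => hy.2).inv
      fun y hy => circleVecCoord_ne_zero ?_
    simpa using (extChartAt (𝓡 1) t₀).map_target hy.2
  have h2 : ContDiffOn ℝ ∞ (fun y : E2 × E1 => B ((extChartAt (𝓡 2) x₀).symm y.1))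
      (extChartAt ((𝓡 2).prod (𝓡 1)) (x₀, t₀)).target := by
    rw [extChartAt_prod_target]
    exact (contDiffOn_comp_extChartAt_symm hB x₀).comp contDiff_fst.contDiffOn fun y hy => hy.1
  have h3 := (ContinuousLinearMap.smulRightL ℝ (E2 × E1) (Mat N)
    (lineCoord.comp (ContinuousLinearMap.snd ℝ E2 E1))).contDiff.comp_contDiffOn (h1.smul h2)
  refine h3.congr fun y hy => ?_
  refine ContinuousLinearMap.ext fun v => ?_
  rw [inChart_mulDt _ hy]
  simp only [Function.comp_apply, ContinuousLinearMap.smulRightL_apply_apply,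
    ContinuousLinearMap.smulRight_apply, ContinuousLinearMap.comp_apply,
    ContinuousLinearMap.coe_snd']
  rw [mul_comm, mul_smul]
  rfl

end CircleForm

section ProductDerivative

local notation "E1" => EuclideanSpace ℝ (Fin 1)
local notation "E2" => EuclideanSpace ℝ (Fin 2)

variable {S : Type*} [TopologicalSpace S] [ChartedSpace (EuclideanSpace ℝ (Fin 2)) S]
  [IsManifold (𝓡 2) ∞ S] {N : ℕ}

theorem mfderiv_extChartAt_prod (x : S) (t : Circle) (v : E2 × E1) :
    (mfderiv ((𝓡 2).prod (𝓡 1)) 𝓘(ℝ, E2 × E1) (extChartAt ((𝓡 2).prod (𝓡 1)) (x, t)) (x, t) v :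
        E2 × E1) =
      (mfderiv (𝓡 2) 𝓘(ℝ, E2) (extChartAt (𝓡 2) x) x v.1,
        mfderiv (𝓡 1) 𝓘(ℝ, E1) (extChartAt (𝓡 1) t) t v.2) := by
  have : IsManifold (𝓡 2) 1 S := IsManifold.of_le (n := ∞) (by simp)
  have h1 := (mdifferentiableAt_extChartAt (I := 𝓡 2) (mem_chart_source E2 x)).hasMFDerivAt
  have h2 := (mdifferentiableAt_extChartAt (I := 𝓡 1) (mem_chart_source E1 t)).hasMFDerivAt
  have h3 := HasMFDerivAt.prodMap (p := (x, t)) h1 h2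
  rw [← modelWithCornersSelf_prod] at h3
  let L1 : E2 →L[ℝ] E2 := mfderiv (𝓡 2) 𝓘(ℝ, E2) (extChartAt (𝓡 2) x) x
  let L2 : E1 →L[ℝ] E1 := mfderiv (𝓡 1) 𝓘(ℝ, E1) (extChartAt (𝓡 1) t) t
  have h4 : HasMFDerivAt ((𝓡 2).prod (𝓡 1)) 𝓘(ℝ, E2 × E1)
    (extChartAt ((𝓡 2).prod (𝓡 1)) (x, t)) (x, t) (L1.prodMap L2) := h3
  exact DFunLike.congr_fun h4.mfderiv v

theorem fderiv_comp_extChartAt_symm_apply {V : Type*} [NormedAddCommGroup V] [NormedSpace ℝ V]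
    {B : S → V} (hB : ContMDiff (𝓡 2) 𝓘(ℝ, V) ∞ B) (x : S) (v : TangentSpace (𝓡 2) x) :
    fderiv ℝ (B ∘ (extChartAt (𝓡 2) x).symm) (extChartAt (𝓡 2) x x)
      (mfderiv (𝓡 2) 𝓘(ℝ, E2) (extChartAt (𝓡 2) x) x v) = (mfderiv (𝓡 2) 𝓘(ℝ, V) B x v : V) := by
  have hx := mem_extChartAt_source (I := 𝓡 2) x
  let D : OneForm (𝓡 2) S V := fun x => mfderiv (𝓡 2) 𝓘(ℝ, V) B x
  have h := mfderiv_comp (extChartAt (𝓡 2) x x) (hB.mdifferentiable (by simp) _)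
    (mdifferentiableAt_extChartAt_symm ((extChartAt (𝓡 2) x).map_source hx))
  rw [mfderiv_eq_fderiv] at h
  let w : E2 := mfderiv (𝓡 2) 𝓘(ℝ, E2) (extChartAt (𝓡 2) x) x v
  exact (DFunLike.congr_fun h w).trans (D.inChart_extChartAt_apply hx v)

theorem dFun_apply_extChartAt {B : S → Mat N} (hB : ContMDiff (𝓡 2) 𝓘(ℝ, Mat N) ∞ B) (x : S)
    (v : TangentSpace (𝓡 2) x) :
    fderiv ℝ (B ∘ (extChartAt (𝓡 2) x).symm) (extChartAt (𝓡 2) x x)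
      (mfderiv (𝓡 2) 𝓘(ℝ, E2) (extChartAt (𝓡 2) x) x v) = dFun B x v :=
  fderiv_comp_extChartAt_symm_apply hB x v

variable {A : OneForm ((𝓡 2).prod (𝓡 1)) (S × Circle) (Mat N)} {B : S → Mat N}

theorem differentiableAt_inChart_add_mulDt (hA : IsSmoothOneForm ((𝓡 2).prod (𝓡 1)) A)
    (hB : ContMDiff (𝓡 2) 𝓘(ℝ, Mat N) ∞ B) (p : S × Circle) :
    DifferentiableAt ℝ (OneForm.inChart ((𝓡 2).prod (𝓡 1)) (A + mulDt fun p => B p.1) p)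
      (extChartAt ((𝓡 2).prod (𝓡 1)) p p) := by
  have h1 : ContDiffOn ℝ ∞ (OneForm.inChart ((𝓡 2).prod (𝓡 1)) (A + mulDt fun p => B p.1) p)
      (extChartAt ((𝓡 2).prod (𝓡 1)) p).target :=
    ((hA.contDiffOn_inChart p).add (contDiffOn_inChart_mulDt hB p.1 p.2)).congr fun y _ =>
      ContinuousLinearMap.ext fun w => rfl
  exact (h1.differentiableOn (by simp)).differentiableAt ((isOpen_extChartAt_target p).mem_nhds
    ((extChartAt _ p).map_source (mem_extChartAt_source p)))

theorem inChart_add_mulDt_inl (f : S × Circle → Mat N) {x₀ : S} {t₀ : Circle} {y : E2 × E1}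
    (hy : y ∈ (extChartAt ((𝓡 2).prod (𝓡 1)) (x₀, t₀)).target) (u : E2) :
    OneForm.inChart ((𝓡 2).prod (𝓡 1)) (A + mulDt f) (x₀, t₀) y (u, 0) =
      OneForm.inChart (𝓡 2) (A.slice ((extChartAt (𝓡 1) t₀).symm y.2)) x₀ y.1 u := by
  have h1 : OneForm.inChart ((𝓡 2).prod (𝓡 1)) (A + mulDt f) (x₀, t₀) y (u, 0) =
      OneForm.inChart ((𝓡 2).prod (𝓡 1)) A (x₀, t₀) y (u, 0) +
        OneForm.inChart ((𝓡 2).prod (𝓡 1)) (mulDt f) (x₀, t₀) y (u, 0) := rfl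
  rw [h1, inChart_mulDt f hy, A.inChart_slice hy, map_zero, mul_zero, zero_smul, add_zero]
  rfl

theorem inChart_add_mulDt_circleVec (hAperp : ∀ p, A p (prodVec p) = 0) (f : S × Circle → Mat N)
    {x₀ : S} {t : Circle} {y : E2} (hy : y ∈ (extChartAt (𝓡 2) x₀).target) :
    OneForm.inChart ((𝓡 2).prod (𝓡 1)) (A + mulDt f) (x₀, t) (y, extChartAt (𝓡 1) t t)
      (0, mfderiv (𝓡 1) 𝓘(ℝ, E1) (extChartAt (𝓡 1) t) t (circleVec t)) =
        f ((extChartAt (𝓡 2) x₀).symm y, t) := by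
  have ht := mem_extChartAt_source (I := 𝓡 1) t
  let w : E1 := mfderiv (𝓡 1) 𝓘(ℝ, E1) (extChartAt (𝓡 1) t) t (circleVec t)
  have hy' : (y, extChartAt (𝓡 1) t t) ∈ (extChartAt ((𝓡 2).prod (𝓡 1)) (x₀, t)).target := by
    rw [extChartAt_prod_target]
    exact ⟨hy, (extChartAt (𝓡 1) t).map_source ht⟩
  have h1 : OneForm.inChart ((𝓡 2).prod (𝓡 1)) (A + mulDt f) (x₀, t) (y, extChartAt (𝓡 1) t t)
      (0, w) = OneForm.inChart ((𝓡 2).prod (𝓡 1)) A (x₀, t) (y, extChartAt (𝓡 1) t t) (0, w) +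
        OneForm.inChart ((𝓡 2).prod (𝓡 1)) (mulDt f) (x₀, t) (y, extChartAt (𝓡 1) t t) (0, w) := rfl
  have h2 : OneForm.inChart ((𝓡 2).prod (𝓡 1)) (mulDt f) (x₀, t) (y, extChartAt (𝓡 1) t t)
      (0, w) = f ((extChartAt (𝓡 2) x₀).symm y, t) := by
    rw [inChart_mulDt f hy']
    simp only [(extChartAt (𝓡 1) t).left_inv ht]
    have h3 : lineCoord w = circleVecCoord t t := rfl
    rw [h3, inv_mul_cancel₀ (circleVecCoord_ne_zero (mem_chart_source E1 t)), one_smul]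
  have h3 : OneForm.inChart ((𝓡 2).prod (𝓡 1)) A (x₀, t) (y, extChartAt (𝓡 1) t t) (0, w) = 0 := by
    have h4 := chartFrame_prod hy' (0, w)
    have h5 : ((chartFrame (𝓡 2) x₀ y 0, chartFrame (𝓡 1) t (extChartAt (𝓡 1) t t) w) : E2 × E1) =
        (0, circleVec t) :=
      Prod.ext (map_zero (chartFrame (𝓡 2) x₀ y)) (chartFrame_mfderiv_circleVec t)
    have h6 := congrArg (A ((extChartAt ((𝓡 2).prod (𝓡 1)) (x₀, t)).symm
      (y, extChartAt (𝓡 1) t t))) (h4.trans h5)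
    refine h6.trans ?_
    rw [extChartAt_prod_symm_apply]
    simp only
    rw [(extChartAt (𝓡 1) t).left_inv ht]
    exact hAperp ((extChartAt (𝓡 2) x₀).symm y, t)
  exact h1.trans (by rw [h2, h3, zero_add])

theorem d_add_mulDt_surface (hA : IsSmoothOneForm ((𝓡 2).prod (𝓡 1)) A)
    (hB : ContMDiff (𝓡 2) 𝓘(ℝ, Mat N) ∞ B) (p : S × Circle) (u v : TangentSpace (𝓡 2) p.1) :
    OneForm.d ((𝓡 2).prod (𝓡 1)) (A + mulDt fun p => B p.1) p
        ![((u, 0) : E2 × E1), ((v, 0) : E2 × E1)] =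
      OneForm.d (𝓡 2) (A.slice p.2) p.1 ![u, v] := by
  obtain ⟨x, t⟩ := p
  have hD := differentiableAt_inChart_add_mulDt hA hB (x, t)
  have hx := mem_extChartAt_source (I := 𝓡 2) x
  have ht := mem_extChartAt_source (I := 𝓡 1) t
  have hU := (isOpen_extChartAt_target (I := 𝓡 2) x).mem_nhds ((extChartAt (𝓡 2) x).map_source hx)
  have hD2 : DifferentiableAt ℝ (OneForm.inChart (𝓡 2) (A.slice t) x) (extChartAt (𝓡 2) x x) :=
    (((SmoothFamily.slice hA).contDiffOn_inChart t x).differentiableOn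
      (by simp)).differentiableAt hU
  set W := OneForm.inChart ((𝓡 2).prod (𝓡 1)) (A + mulDt fun p => B p.1) (x, t) with hW
  have key (a b : E2) : fderiv ℝ W (extChartAt ((𝓡 2).prod (𝓡 1)) (x, t) (x, t)) (a, 0) (b, 0) =
      fderiv ℝ (OneForm.inChart (𝓡 2) (A.slice t) x) (extChartAt (𝓡 2) x x) a b := by
    have h1 : HasFDerivAt (fun y : E2 => W (y, extChartAt (𝓡 1) t t))
        ((fderiv ℝ W (extChartAt ((𝓡 2).prod (𝓡 1)) (x, t) (x, t))).comp
          (ContinuousLinearMap.inl ℝ E2 E1)) (extChartAt (𝓡 2) x x) :=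
      HasFDerivAt.comp (f := fun y : E2 => (y, extChartAt (𝓡 1) t t)) (extChartAt (𝓡 2) x x)
        hD.hasFDerivAt (hasFDerivAt_prodMk_left _ _)
    have h2 := h1.clm_apply (hasFDerivAt_const ((b, 0) : E2 × E1) (extChartAt (𝓡 2) x x))
    have h3 := hD2.hasFDerivAt.clm_apply (hasFDerivAt_const b (extChartAt (𝓡 2) x x))
    have h4 : (fun y : E2 => W (y, extChartAt (𝓡 1) t t) (b, 0)) =ᶠ[𝓝 (extChartAt (𝓡 2) x x)]
        fun y => OneForm.inChart (𝓡 2) (A.slice t) x y b := by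
      filter_upwards [hU] with y hy
      have h5 := inChart_add_mulDt_inl (A := A) (fun p => B p.1) (x₀ := x) (t₀ := t)
        (y := (y, extChartAt (𝓡 1) t t)) (by
          rw [extChartAt_prod_target]; exact ⟨hy, (extChartAt (𝓡 1) t).map_source ht⟩) b
      simp only [(extChartAt (𝓡 1) t).left_inv ht] at h5
      exact h5
    have h6 := h2.unique (h3.congr_of_eventuallyEq h4)
    simpa using DFunLike.congr_fun h6 a
  refine (OneForm.d_apply_of_mem_source (mem_extChartAt_source (x, t)) hD _).trans
    (Eq.trans ?_ (OneForm.d_apply_of_mem_source hx hD2 _).symm)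
  have hL (a : TangentSpace (𝓡 2) x) : (mfderiv ((𝓡 2).prod (𝓡 1)) 𝓘(ℝ, E2 × E1)
      (extChartAt ((𝓡 2).prod (𝓡 1)) (x, t)) (x, t) ((a, 0) : E2 × E1) : E2 × E1) =
        (mfderiv (𝓡 2) 𝓘(ℝ, E2) (extChartAt (𝓡 2) x) x a, 0) :=
    (mfderiv_extChartAt_prod x t (a, 0)).trans
      (Prod.ext rfl (map_zero (mfderiv (𝓡 1) 𝓘(ℝ, E1) (extChartAt (𝓡 1) t) t)))
  have hG (a b : E2 × E1) (a' b' : E2) (ha : a = (a', 0)) (hb : b = (b', 0)) :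
      fderiv ℝ W (extChartAt ((𝓡 2).prod (𝓡 1)) (x, t) (x, t)) a b -
        fderiv ℝ W (extChartAt ((𝓡 2).prod (𝓡 1)) (x, t) (x, t)) b a =
      fderiv ℝ (OneForm.inChart (𝓡 2) (A.slice t) x) (extChartAt (𝓡 2) x x) a' b' -
        fderiv ℝ (OneForm.inChart (𝓡 2) (A.slice t) x) (extChartAt (𝓡 2) x x) b' a' := by
    rw [ha, hb, key, key]
  exact hG _ _ _ _ (hL u) (hL v)

theorem d_add_mulDt_prodVec (hA : IsSmoothOneForm ((𝓡 2).prod (𝓡 1)) A)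
    (hAperp : ∀ p, A p (prodVec p) = 0)
    (hB : ContMDiff (𝓡 2) 𝓘(ℝ, Mat N) ∞ B) (p : S × Circle) (u : TangentSpace (𝓡 2) p.1) :
    OneForm.d ((𝓡 2).prod (𝓡 1)) (A + mulDt fun p => B p.1) p
        ![((u, 0) : E2 × E1), prodVec p] =
      dFun B p.1 u - ddt A.slice p.2 p.1 u := by
  obtain ⟨x, t⟩ := p
  have hD := differentiableAt_inChart_add_mulDt hA hB (x, t)
  have hx := mem_extChartAt_source (I := 𝓡 2) x
  have ht := mem_extChartAt_source (I := 𝓡 1) t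
  have hxT := (extChartAt (𝓡 2) x).map_source hx
  have hU := (isOpen_extChartAt_target (I := 𝓡 2) x).mem_nhds hxT
  have hD2 : DifferentiableAt ℝ (B ∘ (extChartAt (𝓡 2) x).symm) (extChartAt (𝓡 2) x x) :=
    ((contDiffOn_comp_extChartAt_symm hB x).differentiableOn (by simp)).differentiableAt hU
  set W := OneForm.inChart ((𝓡 2).prod (𝓡 1)) (A + mulDt fun p => B p.1) (x, t) with hW
  let w : E1 := mfderiv (𝓡 1) 𝓘(ℝ, E1) (extChartAt (𝓡 1) t) t (circleVec t)
  have key1 (a : E2) : fderiv ℝ W (extChartAt ((𝓡 2).prod (𝓡 1)) (x, t) (x, t)) (a, 0) (0, w) =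
      fderiv ℝ (B ∘ (extChartAt (𝓡 2) x).symm) (extChartAt (𝓡 2) x x) a := by
    have h1 : HasFDerivAt (fun y : E2 => W (y, extChartAt (𝓡 1) t t))
        ((fderiv ℝ W (extChartAt ((𝓡 2).prod (𝓡 1)) (x, t) (x, t))).comp
          (ContinuousLinearMap.inl ℝ E2 E1)) (extChartAt (𝓡 2) x x) :=
      HasFDerivAt.comp (f := fun y : E2 => (y, extChartAt (𝓡 1) t t)) (extChartAt (𝓡 2) x x)
        hD.hasFDerivAt (hasFDerivAt_prodMk_left _ _)
    have h2 := h1.clm_apply (hasFDerivAt_const ((0, w) : E2 × E1) (extChartAt (𝓡 2) x x))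
    have h4 : (fun y : E2 => W (y, extChartAt (𝓡 1) t t) (0, w)) =ᶠ[𝓝 (extChartAt (𝓡 2) x x)]
        B ∘ (extChartAt (𝓡 2) x).symm := by
      filter_upwards [hU] with y hy
      exact inChart_add_mulDt_circleVec hAperp (fun p => B p.1) hy
    have h6 := h2.unique (hD2.hasFDerivAt.congr_of_eventuallyEq h4)
    simpa using DFunLike.congr_fun h6 a
  have key2 (a : E2) : fderiv ℝ W (extChartAt ((𝓡 2).prod (𝓡 1)) (x, t) (x, t)) (0, w) (a, 0) =
      OneForm.inChart (𝓡 2) (ddt A.slice t) x (extChartAt (𝓡 2) x x) a := by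
    obtain ⟨s, hs⟩ := isOpenQuotientMap_iS1.surjective t
    have hts : iS1 s ∈ (chartAt E1 t).source := by rw [hs]; exact mem_chart_source E1 t
    have h0 : HasDerivAt (fun r => extChartAt (𝓡 1) t (iS1 r)) w s := by
      have := hasDerivAt_extChartAt_iS1 t hts
      rw [hs] at this
      exact this
    have hD' : HasFDerivAt W (fderiv ℝ W (extChartAt ((𝓡 2).prod (𝓡 1)) (x, t) (x, t)))
        (extChartAt (𝓡 2) x x, extChartAt (𝓡 1) t (iS1 s)) := by
      rw [hs]; exact hD.hasFDerivAt
    have h1 := HasFDerivAt.comp_hasDerivAt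
      (f := fun r : ℝ => (extChartAt (𝓡 2) x x, extChartAt (𝓡 1) t (iS1 r))) s hD'
      ((hasDerivAt_const s (extChartAt (𝓡 2) x x)).prodMk h0)
    have h2 := h1.clm_apply_const ((a, 0) : E2 × E1)
    have h3 :=
      ((SmoothFamily.slice hA).hasDerivAt_inChart x (extChartAt (𝓡 2) x x) s).clm_apply_const a
    rw [hs] at h3
    have h4 : (fun r => W (extChartAt (𝓡 2) x x, extChartAt (𝓡 1) t (iS1 r)) (a, 0)) =ᶠ[𝓝 s]
        fun r => OneForm.inChart (𝓡 2) (A.slice (iS1 r)) x (extChartAt (𝓡 2) x x) a := by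
      filter_upwards [((chartAt E1 t).open_source.preimage continuous_iS1).mem_nhds hts] with r hr
      have hr' : iS1 r ∈ (extChartAt (𝓡 1) t).source := by simpa using hr
      have h5 := inChart_add_mulDt_inl (A := A) (fun p => B p.1) (x₀ := x) (t₀ := t)
        (y := (extChartAt (𝓡 2) x x, extChartAt (𝓡 1) t (iS1 r))) (by
          rw [extChartAt_prod_target]; exact ⟨hxT, (extChartAt (𝓡 1) t).map_source hr'⟩) a
      simp only [(extChartAt (𝓡 1) t).left_inv hr'] at h5
      exact h5
    have h6 := h2.unique (h3.congr_of_eventuallyEq h4)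
    simpa using h6
  refine (OneForm.d_apply_of_mem_source (mem_extChartAt_source (x, t)) hD _).trans ?_
  let u' : E2 := mfderiv (𝓡 2) 𝓘(ℝ, E2) (extChartAt (𝓡 2) x) x u
  have hL1 : (mfderiv ((𝓡 2).prod (𝓡 1)) 𝓘(ℝ, E2 × E1)
      (extChartAt ((𝓡 2).prod (𝓡 1)) (x, t)) (x, t) ((u, 0) : E2 × E1) : E2 × E1) = (u', 0) :=
    (mfderiv_extChartAt_prod x t (u, 0)).trans
      (Prod.ext rfl (map_zero (mfderiv (𝓡 1) 𝓘(ℝ, E1) (extChartAt (𝓡 1) t) t)))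
  have hL2 : (mfderiv ((𝓡 2).prod (𝓡 1)) 𝓘(ℝ, E2 × E1)
      (extChartAt ((𝓡 2).prod (𝓡 1)) (x, t)) (x, t) (prodVec (x, t)) : E2 × E1) = (0, w) :=
    (mfderiv_extChartAt_prod x t (0, circleVec t)).trans
      (Prod.ext (map_zero (mfderiv (𝓡 2) 𝓘(ℝ, E2) (extChartAt (𝓡 2) x) x)) rfl)
  have hG (a b : E2 × E1) (ha : a = (u', 0)) (hb : b = (0, w)) :
      fderiv ℝ W (extChartAt ((𝓡 2).prod (𝓡 1)) (x, t) (x, t)) a b -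
        fderiv ℝ W (extChartAt ((𝓡 2).prod (𝓡 1)) (x, t) (x, t)) b a =
      dFun B x u - ddt A.slice t x u := by
    rw [ha, hb, key1, key2]
    exact congrArg₂ (· - ·) (dFun_apply_extChartAt hB x u)
      ((ddt A.slice t).inChart_extChartAt_apply hx u)
  exact hG _ _ hL1 hL2

end ProductDerivative

section WedgeApply

variable {W : Type*} [AddCommGroup W] [Module ℝ W] {R : Type*} [Ring R] [Algebra ℝ R]

theorem wedgeOne_asOneForm_apply (α β : W →ₗ[ℝ] R) (u v : W) :
    wedgeOne α (asOneForm β) ![u, v] = α u * β v - α v * β u := by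
  rw [wedgeOne, AlternatingMap.alternatizeUncurryFin_apply, Fin.sum_univ_two]
  have h : Fin.removeNth (1 : Fin 2) ![u, v] = ![u] := by
    ext i; fin_cases i; rfl
  rw [h]
  simp [asOneForm, sub_eq_add_neg]

theorem wedgeOne_apply_three (α : W →ₗ[ℝ] R) (η : W [⋀^Fin 2]→ₗ[ℝ] R) (v : Fin 3 → W) :
    wedgeOne α η v = α (v 0) * η ![v 1, v 2] - α (v 1) * η ![v 0, v 2] +
      α (v 2) * η ![v 0, v 1] := by
  rw [wedgeOne, AlternatingMap.alternatizeUncurryFin_apply, Fin.sum_univ_three]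
  have h0 : Fin.removeNth (0 : Fin 3) v = ![v 1, v 2] := by
    ext i; fin_cases i <;> rfl
  have h1 : Fin.removeNth (1 : Fin 3) v = ![v 0, v 2] := by
    ext i; fin_cases i <;> rfl
  have h2 : Fin.removeNth (2 : Fin 3) v = ![v 0, v 1] := by
    ext i; fin_cases i <;> rfl
  rw [h0, h1, h2]
  simp [sub_eq_add_neg]

end WedgeApply

section LieValued

local notation "E2" => EuclideanSpace ℝ (Fin 2)

theorem exists_ker_eq {V : Type*} [NormedAddCommGroup V] [NormedSpace ℝ V]
    [FiniteDimensional ℝ V] (U : Submodule ℝ V) : ∃ q : V →L[ℝ] V, ∀ v, q v = 0 ↔ v ∈ U := by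
  obtain ⟨U', h⟩ := U.exists_isCompl
  refine ⟨LinearMap.toContinuousLinearMap (U'.subtype ∘ₗ U'.projectionOnto U h.symm),
    fun v => ?_⟩
  rw [LinearMap.coe_toContinuousLinearMap', LinearMap.comp_apply, Submodule.subtype_apply,
    ZeroMemClass.coe_eq_zero, Submodule.projectionOnto_apply_eq_zero_iff]

variable {S : Type*} [TopologicalSpace S] [ChartedSpace (EuclideanSpace ℝ (Fin 2)) S]
  [IsManifold (𝓡 2) ∞ S] {N : ℕ} {𝔤 : LieSubalgebra ℝ (Mat N)}

theorem dFun_mem {B : S → Mat N} (hB : ContMDiff (𝓡 2) 𝓘(ℝ, Mat N) ∞ B) (hB𝔤 : ∀ x, B x ∈ 𝔤)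
    (x : S) (v : TangentSpace (𝓡 2) x) : dFun B x v ∈ 𝔤 := by
  obtain ⟨q, hq⟩ := exists_ker_eq 𝔤.toSubmodule
  refine (hq _).1 ?_
  have hx := mem_extChartAt_source (I := 𝓡 2) x
  rw [← dFun_apply_extChartAt hB x v]
  have h1 : DifferentiableAt ℝ (B ∘ (extChartAt (𝓡 2) x).symm) (extChartAt (𝓡 2) x x) :=
    ((contDiffOn_comp_extChartAt_symm hB x).differentiableOn (by simp)).differentiableAt
      ((isOpen_extChartAt_target (I := 𝓡 2) x).mem_nhds ((extChartAt (𝓡 2) x).map_source hx))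
  have h2 := q.hasFDerivAt.comp _ h1.hasFDerivAt
  have h3 : q ∘ (B ∘ (extChartAt (𝓡 2) x).symm) = fun _ => 0 :=
    funext fun y => (hq _).2 (hB𝔤 _)
  rw [h3] at h2
  let w : E2 := mfderiv (𝓡 2) 𝓘(ℝ, E2) (extChartAt (𝓡 2) x) x v
  exact (DFunLike.congr_fun ((hasFDerivAt_const (0 : Mat N) _).unique h2) w).symm

theorem ddt_mem {a : Circle → OneForm (𝓡 2) S (Mat N)} (ha : SmoothFamily a)
    (ha𝔤 : ∀ t x v, a t x v ∈ 𝔤) (t : Circle) (x : S) (v : TangentSpace (𝓡 2) x) :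
    ddt a t x v ∈ 𝔤 := by
  obtain ⟨q, hq⟩ := exists_ker_eq 𝔤.toSubmodule
  obtain ⟨s, rfl⟩ := isOpenQuotientMap_iS1.surjective t
  refine (hq _).1 ?_
  have h1 := (ha.hasDerivAt x s).clm_apply_const (v : E2)
  have h2 := q.hasFDerivAt.comp_hasDerivAt s h1
  have h3 : (q ∘ fun r => timeCurve a x r (v : E2)) = fun _ => 0 :=
    funext fun r => (hq _).2 (ha𝔤 (iS1 r) x v)
  rw [h3] at h2
  exact ((hasDerivAt_const s (0 : Mat N)).unique h2).symm

end LieValued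

section LeibnizRule

local notation "E2" => EuclideanSpace ℝ (Fin 2)

variable {S : Type*} [TopologicalSpace S] [ChartedSpace (EuclideanSpace ℝ (Fin 2)) S]
  [IsManifold (𝓡 2) ∞ S] {V : Type*} [NormedAddCommGroup V] [NormedSpace ℝ V]
  {V₂ : Type*} [NormedAddCommGroup V₂] [NormedSpace ℝ V₂]
  {V₁ : Type*} [NormedAddCommGroup V₁] [NormedSpace ℝ V₁]

/-- The Leibniz rule for the exterior derivative of a pairing of a function and a one-form. -/
theorem d_bilin_comp {a : Circle → OneForm (𝓡 2) S V} (ha : SmoothFamily a) {B : S → V₁}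
    (hB : ContMDiff (𝓡 2) 𝓘(ℝ, V₁) ∞ B) (L : V₁ →L[ℝ] V →L[ℝ] V₂) (t : Circle) (x : S)
    (v : Fin 2 → TangentSpace (𝓡 2) x) :
    OneForm.d (𝓡 2) (fun x => (L (B x)).comp (a t x) : OneForm (𝓡 2) S V₂) x v =
      L (mfderiv (𝓡 2) 𝓘(ℝ, V₁) B x (v 0)) (a t x (v 1)) -
        L (mfderiv (𝓡 2) 𝓘(ℝ, V₁) B x (v 1)) (a t x (v 0)) +
        L (B x) (OneForm.d (𝓡 2) (a t) x v) := by
  have hx := mem_extChartAt_source (I := 𝓡 2) x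
  have hU := (isOpen_extChartAt_target (I := 𝓡 2) x).mem_nhds ((extChartAt (𝓡 2) x).map_source hx)
  have ha1 : DifferentiableAt ℝ (OneForm.inChart (𝓡 2) (a t) x) (extChartAt (𝓡 2) x x) :=
    ((ha.contDiffOn_inChart t x).differentiableOn (by simp)).differentiableAt hU
  have hb := (((ha.bilin_comp hB L).contDiffOn_inChart t x).differentiableOn
    (by simp)).differentiableAt hU
  have hB1 : DifferentiableAt ℝ (B ∘ (extChartAt (𝓡 2) x).symm) (extChartAt (𝓡 2) x x) :=
    ((contDiffOn_comp_extChartAt_symm hB x).differentiableOn (by simp)).differentiableAt hU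
  have hBx : (B ∘ (extChartAt (𝓡 2) x).symm) (extChartAt (𝓡 2) x x) = B x := by
    rw [Function.comp_apply, (extChartAt (𝓡 2) x).left_inv hx]
  have hprod := HasFDerivAt.clm_comp (c := L ∘ B ∘ (extChartAt (𝓡 2) x).symm)
    (d := OneForm.inChart (𝓡 2) (a t) x) (L.hasFDerivAt.comp (extChartAt (𝓡 2) x x) hB1.hasFDerivAt)
    ha1.hasFDerivAt
  have key (u w : E2) : fderiv ℝ (OneForm.inChart (𝓡 2)
      (fun x => (L (B x)).comp (a t x) : OneForm (𝓡 2) S V₂) x) (extChartAt (𝓡 2) x x) u w =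
      L (fderiv ℝ (B ∘ (extChartAt (𝓡 2) x).symm) (extChartAt (𝓡 2) x x) u)
        (OneForm.inChart (𝓡 2) (a t) x (extChartAt (𝓡 2) x x) w) +
      L (B x) (fderiv ℝ (OneForm.inChart (𝓡 2) (a t) x) (extChartAt (𝓡 2) x x) u w) := by
    refine (DFunLike.congr_fun (DFunLike.congr_fun hprod.fderiv u) w).trans ?_
    rw [← hBx]
    simp [add_comm]
  refine (OneForm.d_apply_of_mem_source hx hb v).trans ?_
  rw [OneForm.d_apply_of_mem_source hx ha1 v, (L (B x)).map_sub]
  let w (i : Fin 2) : E2 := mfderiv (𝓡 2) 𝓘(ℝ, E2) (extChartAt (𝓡 2) x) x (v i)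
  have hd (i : Fin 2) : fderiv ℝ (B ∘ (extChartAt (𝓡 2) x).symm) (extChartAt (𝓡 2) x x) (w i) =
      mfderiv (𝓡 2) 𝓘(ℝ, V₁) B x (v i) := fderiv_comp_extChartAt_symm_apply hB x (v i)
  have hv (i : Fin 2) : OneForm.inChart (𝓡 2) (a t) x (extChartAt (𝓡 2) x x) (w i) =
      a t x (v i) := (a t).inChart_extChartAt_apply hx (v i)
  rw [← hd, ← hd, ← hv, ← hv]
  refine (congrArg₂ (· - ·) (key (w 0) (w 1)) (key (w 1) (w 0))).trans ?_
  abel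

end LeibnizRule

section TraceAlgebra

/-- The trace identity behind the formula for the Chern–Simons form in axial directions. -/
theorem LinearMap.tracial_chernSimons_identity {R : Type*} [Ring R] [Algebra ℝ R]
    (T : R →ₗ[ℝ] ℂ) (hT : ∀ x y, T (x * y) = T (y * x)) (a₀ a₁ X b₀ b₁ d₀ d₁ D : R) :
    T ((a₀ * (b₁ - d₁) - a₁ * (b₀ - d₀) + X * D) +
        (2 / 3 : ℝ) • (a₀ * (a₁ * X - X * a₁) - a₁ * (a₀ * X - X * a₀) +
          X * (a₀ * a₁ - a₁ * a₀))) =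
      -(T (a₀ * (d₁ + (X * a₁ - a₁ * X))) - T (a₁ * (d₀ + (X * a₀ - a₀ * X)))) +
        (T (a₀ * b₁) - T (a₁ * b₀)) + T (X * D) := by
  have h1 : T (X * (a₀ * a₁)) = T (a₀ * (a₁ * X)) := by rw [hT, mul_assoc]
  have h2 : T (X * (a₁ * a₀)) = T (a₁ * (a₀ * X)) := by rw [hT, mul_assoc]
  have h3 : T (a₀ * (X * a₁)) = T (a₁ * (a₀ * X)) := by rw [← mul_assoc, hT]
  have h4 : T (a₁ * (X * a₀)) = T (a₀ * (a₁ * X)) := by rw [← mul_assoc, hT]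
  simp only [mul_add, mul_sub, map_add, map_sub, map_smul, h1, h2, h3, h4, Complex.real_smul]
  push_cast
  ring

theorem LinearMap.tracial_chernSimons_apply {W R : Type*} [AddCommGroup W] [Module ℝ W] [Ring R]
    [Algebra ℝ R] (T : R →ₗ[ℝ] ℂ) (hT : ∀ x y, T (x * y) = T (y * x)) (α : W →ₗ[ℝ] R)
    (η : W [⋀^Fin 2]→ₗ[ℝ] R) (v : Fin 3 → W) {a₀ a₁ X b₀ b₁ d₀ d₁ D : R} (h0 : α (v 0) = a₀)
    (h1 : α (v 1) = a₁) (h2 : α (v 2) = X) (h02 : η ![v 0, v 2] = b₀ - d₀)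
    (h12 : η ![v 1, v 2] = b₁ - d₁) (h01 : η ![v 0, v 1] = D) :
    T.compAlternatingMap
        (wedgeOne α η + (2 / 3 : ℝ) • wedgeOne α (wedgeOne α (asOneForm α))) v =
      -(T (a₀ * (d₁ + (X * a₁ - a₁ * X))) - T (a₁ * (d₀ + (X * a₀ - a₀ * X)))) +
        (T (a₀ * b₁) - T (a₁ * b₀)) + T (X * D) := by
  rw [← T.tracial_chernSimons_identity hT, LinearMap.compAlternatingMap_apply,
    AlternatingMap.add_apply, AlternatingMap.smul_apply]
  simp only [wedgeOne_apply_three, wedgeOne_asOneForm_apply, h0, h1, h2, h02, h12, h01]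

/-- The bilinear pairing `(x, y) ↦ φ (x * y)` of a normed algebra. -/
noncomputable def mulPairing {R V : Type*} [NormedRing R] [NormedAlgebra ℝ R]
    [NormedAddCommGroup V] [NormedSpace ℝ V] (φ : R →L[ℝ] V) : R →L[ℝ] R →L[ℝ] V :=
  (ContinuousLinearMap.compL ℝ R R V φ).comp (ContinuousLinearMap.mul ℝ R)

theorem Module.Basis.prod_reindex_fin_three {W W' : Type*} [AddCommGroup W] [Module ℝ W]
    [AddCommGroup W'] [Module ℝ W'] (b : Basis (Fin 2) ℝ W) (c : Basis (Fin 1) ℝ W') :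
    ((b.prod c).reindex (finSumFinEquiv (m := 2) (n := 1))) 0 = (b 0, 0) ∧
      ((b.prod c).reindex (finSumFinEquiv (m := 2) (n := 1))) 1 = (b 1, 0) ∧
      ((b.prod c).reindex (finSumFinEquiv (m := 2) (n := 1))) 2 = (0, c 0) := by
  have h0 : (finSumFinEquiv (m := 2) (n := 1)).symm 0 = Sum.inl 0 := rfl
  have h1 : (finSumFinEquiv (m := 2) (n := 1)).symm 1 = Sum.inl 1 := rfl
  have h2 : (finSumFinEquiv (m := 2) (n := 1)).symm 2 = Sum.inr 0 := rfl
  simp only [Basis.reindex_apply]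
  rw [h0, h1, h2]
  simp [Basis.prod_apply]

end TraceAlgebra

section ProductForm

variable {S : Type*} [TopologicalSpace S] [ChartedSpace (EuclideanSpace ℝ (Fin 2)) S]
  {R V : Type*} [NormedRing R] [NormedAlgebra ℝ R] [NormedAddCommGroup V] [NormedSpace ℝ V]

/-- The family of one-forms `φ (B a(t))`. -/
noncomputable def productForm (φ : R →L[ℝ] V) (B : S → R) (a : Circle → OneForm (𝓡 2) S R) :
    Circle → OneForm (𝓡 2) S V :=
  fun t x => (mulPairing φ (B x)).comp (a t x)

variable [IsManifold (𝓡 2) ∞ S] {φ : R →L[ℝ] V} {B : S → R} {a : Circle → OneForm (𝓡 2) S R}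

theorem SmoothFamily.productForm (ha : SmoothFamily a) (hB : ContMDiff (𝓡 2) 𝓘(ℝ, R) ∞ B) :
    SmoothFamily (productForm φ B a) :=
  ha.bilin_comp hB (mulPairing φ)

theorem d_productForm (ha : SmoothFamily a) (hB : ContMDiff (𝓡 2) 𝓘(ℝ, R) ∞ B) (t : Circle) (x : S)
    (v : Fin 2 → TangentSpace (𝓡 2) x) :
    OneForm.d (𝓡 2) (productForm φ B a t) x v =
      mulPairing φ (mfderiv (𝓡 2) 𝓘(ℝ, R) B x (v 0)) (a t x (v 1)) -
        mulPairing φ (mfderiv (𝓡 2) 𝓘(ℝ, R) B x (v 1)) (a t x (v 0)) +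
        φ (B x * OneForm.d (𝓡 2) (a t) x v) :=
  d_bilin_comp ha hB (mulPairing φ) t x v

end ProductForm

section ChernSimonsDensity

local notation "E1" => EuclideanSpace ℝ (Fin 1)
local notation "E2" => EuclideanSpace ℝ (Fin 2)

variable {S : Type*} [TopologicalSpace S] [ChartedSpace (EuclideanSpace ℝ (Fin 2)) S] {N : ℕ}

theorem add_mulDt_apply_inl (A : OneForm ((𝓡 2).prod (𝓡 1)) (S × Circle) (Mat N))
    (f : S × Circle → Mat N) (x : S) (t : Circle) (u : E2) :
    (A + mulDt f) (x, t) ((u, 0) : E2 × E1) = A.slice t x u := by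
  have h : (A + mulDt f) (x, t) ((u, 0) : E2 × E1) =
      A.slice t x u + mulDt f (x, t) ((u, 0) : E2 × E1) := rfl
  have h0 : mulDt f (x, t) ((u, 0) : E2 × E1) = 0 :=
    (mulDt_apply f x t u 0).trans
      ((congrArg (· • f (x, t)) (circleDt t).map_zero).trans (zero_smul ℝ _))
  exact h.trans ((congrArg (A.slice t x u + ·) h0).trans (add_zero _))

theorem add_mulDt_apply_prodVec {A : OneForm ((𝓡 2).prod (𝓡 1)) (S × Circle) (Mat N)}
    (hAperp : ∀ p, A p (prodVec p) = 0) (f : S × Circle → Mat N) (p : S × Circle) :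
    (A + mulDt f) p (prodVec p) = f p := by
  have h : (A + mulDt f) p (prodVec p) = A p (prodVec p) + circleDt p.2 (circleVec p.2) • f p := rfl
  have h1 : circleDt p.2 (circleVec p.2) = 1 := circleBasis_coord_circleVec p.2
  rw [h, hAperp, h1, one_smul, zero_add]

variable [Bundle.RiemannianBundle (fun x : S => TangentSpace (𝓡 2) x)]
  (o : (x : S) → Orientation ℝ (TangentSpace (𝓡 2) x) (Fin 2))
  {𝔤 : LieSubalgebra ℝ (Mat N)} (c : ℝ)

theorem fiberInner_hodgeStar_eq_traceC (h𝔤 : 𝔤 ≤ uLie N) {α β : OneForm (𝓡 2) S (Mat N)} {x : S}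
    (hα : ∀ v, α x v ∈ 𝔤) (hβ : ∀ v, β x v ∈ 𝔤) :
    (fiberInner c α (hodgeStar o β) x : ℂ) =
      traceC c (α x (posBasis o x 0) * β x (posBasis o x 1)) -
        traceC c (α x (posBasis o x 1) * β x (posBasis o x 0)) := by
  rw [fiberInner_hodgeStar, traceC_mul_of_mem_uLie c (h𝔤 (hα _)) (h𝔤 (hβ _)),
    traceC_mul_of_mem_uLie c (h𝔤 (hα _)) (h𝔤 (hβ _))]
  push_cast
  ring

variable [IsManifold (𝓡 2) ∞ S]
  {A : OneForm ((𝓡 2).prod (𝓡 1)) (S × Circle) (Mat N)} {B : S → Mat N}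

/-- The Chern–Simons form of `A + B dt` on a positive orthonormal frame: up to an exact form on the
surface it is the integrand of the right-hand side. -/
theorem chernSimonsForm_posBasis3 (h𝔤 : 𝔤 ≤ uLie N)
    (hA : IsSmoothOneForm ((𝓡 2).prod (𝓡 1)) A) (hA𝔤 : ∀ p v, A p v ∈ 𝔤)
    (hAperp : ∀ p, A p (prodVec p) = 0)
    (hB : ContMDiff (𝓡 2) 𝓘(ℝ, Mat N) ∞ B) (hB𝔤 : ∀ x, B x ∈ 𝔤) (x : S) (t : Circle) :
    chernSimonsForm c (A + mulDt fun p => B p.1) (x, t) (posBasis3 o (x, t)) =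
      ((-fiberInner c (A.slice t) (hodgeStar o (ddt A.slice t + adB B A.slice t)) x +
        2 * fiberInner c (A.slice t) (hodgeStar o (dFun B)) x : ℝ) : ℂ) +
      OneForm.d (𝓡 2) (productForm (LinearMap.toContinuousLinearMap (traceC c)) B A.slice t) x
        (posBasis o x) := by
  have hs := SmoothFamily.slice hA
  have hs𝔤 (t x v) : A.slice t x v ∈ 𝔤 := hA𝔤 _ _
  set e := posBasis o x with he
  set F : Fin 3 → TangentSpace ((𝓡 2).prod (𝓡 1)) (x, t) := ⇑(posBasis3 o (x, t)) with hF
  obtain ⟨hF0, hF1, hF2⟩ := (posBasis o x).prod_reindex_fin_three (circleBasis t)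
  have hF0 : F 0 = ((e 0, 0) : E2 × E1) := hF0
  have hF1 : F 1 = ((e 1, 0) : E2 × E1) := hF1
  have hF2 : F 2 = prodVec (x, t) :=
    hF2.trans (Prod.ext rfl (circleBasis_zero t))
  have ha0 := (congrArg ((A + mulDt fun p => B p.1) (x, t)) hF0).trans
    (add_mulDt_apply_inl A _ x t (e 0))
  have ha1 := (congrArg ((A + mulDt fun p => B p.1) (x, t)) hF1).trans
    (add_mulDt_apply_inl A _ x t (e 1))
  have haX := (congrArg ((A + mulDt fun p => B p.1) (x, t)) hF2).trans
    (add_mulDt_apply_prodVec hAperp _ (x, t))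
  have hd0 : OneForm.d ((𝓡 2).prod (𝓡 1)) (A + mulDt fun p => B p.1) (x, t) ![F 0, F 2] =
      dFun B x (e 0) - ddt A.slice t x (e 0) := by
    rw [hF0, hF2]
    exact d_add_mulDt_prodVec hA hAperp hB (x, t) (e 0)
  have hd1 : OneForm.d ((𝓡 2).prod (𝓡 1)) (A + mulDt fun p => B p.1) (x, t) ![F 1, F 2] =
      dFun B x (e 1) - ddt A.slice t x (e 1) := by
    rw [hF1, hF2]
    exact d_add_mulDt_prodVec hA hAperp hB (x, t) (e 1)
  have hD : OneForm.d ((𝓡 2).prod (𝓡 1)) (A + mulDt fun p => B p.1) (x, t) ![F 0, F 1] =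
      OneForm.d (𝓡 2) (A.slice t) x e := by
    have h1 : ![e 0, e 1] = e := by
      ext i; fin_cases i <;> rfl
    rw [hF0, hF1, ← h1]
    exact d_add_mulDt_surface hA hB (x, t) (e 0) (e 1)
  have hω : OneForm.d (𝓡 2)
        (productForm (LinearMap.toContinuousLinearMap (traceC c)) B A.slice t) x e =
      traceC c (dFun B x (e 0) * A.slice t x (e 1)) -
        traceC c (dFun B x (e 1) * A.slice t x (e 0)) +
        traceC c (B x * OneForm.d (𝓡 2) (A.slice t) x e) :=
    d_productForm hs hB t x e
  have hf1 := fiberInner_hodgeStar_eq_traceC o c h𝔤 (β := ddt A.slice t + adB B A.slice t)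
    (x := x) (hs𝔤 t x) fun v =>
      add_mem (ddt_mem hs hs𝔤 t x v) (𝔤.lie_mem (hB𝔤 x) (hs𝔤 t x v))
  have hf2 := fiberInner_hodgeStar_eq_traceC o c h𝔤 (hs𝔤 t x) (dFun_mem hB hB𝔤 x)
  refine ((traceC c).tracial_chernSimons_apply (traceC_mul_comm c) _ _ F ha0 ha1 haX hd0 hd1
    hD).trans ?_
  rw [Complex.ofReal_add, Complex.ofReal_neg, Complex.ofReal_mul, hf1, hf2, hω,
    traceC_mul_comm c (dFun B x (e 0)), traceC_mul_comm c (dFun B x (e 1))]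
  have had (i : Fin 2) : (ddt A.slice t + adB B A.slice t) x (e i) = ddt A.slice t x (e i) +
      (B x * A.slice t x (e i) - A.slice t x (e i) * B x) := rfl
  rw [← he, had, had]
  push_cast
  ring

end ChernSimonsDensity

theorem proposition1
    {S : Type*} [TopologicalSpace S] [T2Space S] [CompactSpace S]
    [ChartedSpace (EuclideanSpace ℝ (Fin 2)) S] [IsManifold (𝓡 2) ∞ S]
    [MeasurableSpace S] [BorelSpace S]
    [Bundle.RiemannianBundle (fun x : S => TangentSpace (𝓡 2) x)]
    [IsContMDiffRiemannianBundle (𝓡 2) ∞ (EuclideanSpace ℝ (Fin 2))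
      (fun x : S => TangentSpace (𝓡 2) x)]
    (o : (x : S) → Orientation ℝ (TangentSpace (𝓡 2) x) (Fin 2))
    (ho : IsOrientation (𝓡 2) (EuclideanSpace.basisFun (Fin 2) ℝ).toBasis o)
    {N : ℕ} (𝔤 : LieSubalgebra ℝ (Mat N)) (h𝔤 : 𝔤 ≤ uLie N)
    (c : ℝ) (hc : 0 < c) (k : ℤ)
    (A : OneForm ((𝓡 2).prod (𝓡 1)) (S × Circle) (Mat N))
    (hA : IsSmoothOneForm ((𝓡 2).prod (𝓡 1)) A) (hA𝔤 : ∀ p v, A p v ∈ 𝔤)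
    (hAperp : ∀ p, A p (prodVec p) = 0)
    (B : S → Mat N) (hB : ContMDiff (𝓡 2) 𝓘(ℝ, Mat N) ∞ B) (hB𝔤 : ∀ x, B x ∈ 𝔤) :
    MemHPerp 𝔤 c A.slice ∧
    MemHPerp 𝔤 c (fun t => hodgeStar o (ddt A.slice t + adB B A.slice t)) ∧
    MemHPerp 𝔤 c (fun _ => hodgeStar o (dFun B)) ∧
    chernSimons k c o (A + mulDt (fun p => B p.1)) =
      ((-(k / (4 * Real.pi)) *
        (hPerpInner c A.slice (fun t => hodgeStar o (ddt A.slice t + adB B A.slice t)) -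
          2 * hPerpInner c A.slice (fun _ => hodgeStar o (dFun B))) : ℝ) : ℂ) := by
  have := isFiniteMeasure_surfaceMeasure o
  have hs := SmoothFamily.slice hA
  have hs𝔤 (t x v) : A.slice t x v ∈ 𝔤 := hA𝔤 _ _
  have ha := hs.contFamily
  have hb : ContFamily (fun t => hodgeStar o (ddt A.slice t + adB B A.slice t)) :=
    (hs.ddt.add (hs.adB hB)).contFamily.hodgeStar ho
  have hdB : ContFamily (fun _ => hodgeStar o (dFun B)) :=
    (SmoothFamily.dFun hB).contFamily.hodgeStar ho
  have hω : SmoothFamily (productForm (LinearMap.toContinuousLinearMap (traceC c)) B A.slice) :=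
    hs.productForm hB
  refine ⟨ha.memHPerp o h𝔤 hc hs𝔤, hb.memHPerp o h𝔤 hc fun t x v => neg_mem (add_mem
    (ddt_mem hs hs𝔤 t x _) (𝔤.lie_mem (hB𝔤 x) (hs𝔤 t x _))),
    hdB.memHPerp o h𝔤 hc fun t x v => neg_mem (dFun_mem hB hB𝔤 x _), ?_⟩
  have hi1 := integrable_of_continuous o (ha.continuous_fiberInner o c hb)
  have hi2 := integrable_of_continuous o (ha.continuous_fiberInner o c hdB)
  have hiω := integrable_of_continuous o (hω.continuous_d ho)
  have hir := (hi1.neg.add (hi2.const_mul 2))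
  have hcs : (fun p => chernSimonsForm c (A + mulDt fun p => B p.1) p (posBasis3 o p)) =
      fun p : S × Circle =>
        ((-fiberInner c (A.slice p.2) (hodgeStar o (ddt A.slice p.2 + adB B A.slice p.2)) p.1 +
          2 * fiberInner c (A.slice p.2) (hodgeStar o (dFun B)) p.1 : ℝ) : ℂ) +
        OneForm.d (𝓡 2) (productForm (LinearMap.toContinuousLinearMap (traceC c)) B A.slice p.2) p.1
          (posBasis o p.1) :=
    funext fun p => chernSimonsForm_posBasis3 o c h𝔤 hA hA𝔤 hAperp hB hB𝔤 p.1 p.2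
  have hic := hir.ofReal (𝕜 := ℂ)
  have hω0 : ∫ p : S × Circle, OneForm.d (𝓡 2)
      (productForm (LinearMap.toContinuousLinearMap (traceC c)) B A.slice p.2) p.1
      (posBasis o p.1) ∂((surfaceMeasure S).prod circleMeasure) = 0 := by
    rw [integral_prod_symm _ hiω]
    simp only [integral_d_posBasis_eq_zero ho hω, integral_zero]
  have h1 : ∫ p : S × Circle, fiberInner c (A.slice p.2)
      (hodgeStar o (ddt A.slice p.2 + adB B A.slice p.2)) p.1
      ∂((surfaceMeasure S).prod circleMeasure) =
        hPerpInner c A.slice (fun t => hodgeStar o (ddt A.slice t + adB B A.slice t)) :=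
    integral_prod_symm _ hi1
  have h2 : ∫ p : S × Circle, fiberInner c (A.slice p.2) (hodgeStar o (dFun B)) p.1
      ∂((surfaceMeasure S).prod circleMeasure) =
        hPerpInner c A.slice (fun _ => hodgeStar o (dFun B)) :=
    integral_prod_symm _ hi2
  have h3 : ∫ p : S × Circle,
      (-fiberInner c (A.slice p.2) (hodgeStar o (ddt A.slice p.2 + adB B A.slice p.2)) p.1 +
        2 * fiberInner c (A.slice p.2) (hodgeStar o (dFun B)) p.1)
      ∂((surfaceMeasure S).prod circleMeasure) =
      -hPerpInner c A.slice (fun t => hodgeStar o (ddt A.slice t + adB B A.slice t)) +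
        2 * hPerpInner c A.slice (fun _ => hodgeStar o (dFun B)) := by
    rw [← h1, ← h2, ← integral_neg, ← integral_const_mul]
    exact integral_add hi1.neg (hi2.const_mul 2)
  have hform : formIntegral ((𝓡 2).prod (𝓡 1)) stdBasis3 (prodOrientation o)
      (chernSimonsForm c (A + mulDt fun p => B p.1)) =
      ((-hPerpInner c A.slice (fun t => hodgeStar o (ddt A.slice t + adB B A.slice t)) +
        2 * hPerpInner c A.slice (fun _ => hodgeStar o (dFun B)) : ℝ) : ℂ) := by
    rw [formIntegral_eq_integral o (by rw [hcs]; exact hic.add hiω), hcs, ← h3]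
    refine (integral_add hic hiω).trans ?_
    rw [hω0, add_zero]
    exact integral_ofReal
  rw [chernSimons, hform]
  push_cast
  ring
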